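/- Let $\alpha\in(1,2)$, $\beta\in[-1,1]$ and $A>0$. Let $X_1,X_2,\ldots$ be independent and identically distributed real random variables on a common probability space such that the distribution function of $X_1$ is $$F(x)=1-\frac{A+\epsilon(x)}{|x|^{\alpha}}(1+\beta)\ \ (x>0),\qquad F(x)=\frac{A+\epsilon(x)}{|x|^{\alpha}}(1-\beta)\ \ (x<0),$$ where $\epsilon:\mathbb{R}\to\mathbb{R}$ is a bounded measurable function vanishing at $\pm\infty$, with $|\epsilon(x)|\le K/|x|^{\gamma}$ for all $x\neq0$, for some $K>0$ and $\gamma\ge 0$ (with $\gamma=0$ this is just boundedness). Assume in addition that $x\mapsto\epsilon(x)/|x|^{\alpha}$ is ultimately monotone on each half-line, that is, there is $x_0>0$ such that it is monotone (nondecreasing or nonincreasing) on $(x_0,\infty)$ and monotone on $(-\infty,-x_0)$. Put $$\sigma=\Big(A\alpha\int_{\mathbb{R}}\frac{1-\cos y}{|y|^{1+\alpha}}\,dy\Big)^{1/\alpha},\qquad S_n=\frac1\sigma n^{-1/\alpha}\big(X_1+\cdots+X_n-n\mathbb{E}[X_1]\big).$$ Let $S_\alpha(1,\beta)$ be the probability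 law with characteristic function $t\mapsto\exp\{-|t|^{\alpha}(1-i\beta\,\mathrm{sign}(t)\tan\frac{\pi\alpha}{2})\}$, and let $d_W(\mu,\nu)=\sup_h|\int h\,d\mu-\int h\,d\nu|$ be the Wasserstein distance, the supremum running over all $1$-Lipschitz functions $h:\mathbb{R}\to\mathbb{R}$. Then $X_1$ and the law $S_\alpha(1,\beta)$ are integrable, and there is a constant $\hat c_{\alpha,\beta,A}$ depending only on $\alpha$, $\beta$ and $A$ such that, for all $n\ge1$, $$d_W(\mathcal{L}(S_n),S_\alpha(1,\beta))\le \hat c_{\alpha,\beta,A}\left(n^{1-\frac2\alpha}\left[1+\int_{-\sigma n^{1/\alpha}}^{\sigma n^{1/\alpha}}\frac{|\epsilon(x)|}{|x|^{\alpha-1}}\,dx\right]+\sup_{|x|\ge\sigma n^{1/\alpha}}|\epsilon(x)|\right).$$ -/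

import Mathlib

open MeasureTheory ProbabilityTheory Filter Topology

/-- The stable law `S_α(σ, β)` on the real line: the probability measure `ν` with characteristic
function `exp (-σ^α |t|^α (1 - i β sign(t) tan(π α / 2)))`. -/
structure IsStableLaw (α σ β : ℝ) (ν : Measure ℝ) : Prop where
  isProbabilityMeasure : IsProbabilityMeasure ν
  charFun_eq : ∀ t : ℝ, charFun ν t =
    Complex.exp (-((σ ^ α * |t| ^ α : ℝ) : ℂ) *
      (1 - Complex.I * ((β * Real.sign t * Real.tan (Real.pi * α / 2) : ℝ) : ℂ)))

/-- The Wasserstein distance between two integrable laws on the real line: the supremum of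
`|∫ h dμ - ∫ h dν|` over all `1`-Lipschitz functions `h`, as an extended nonnegative real. -/
noncomputable def wassersteinDist (μ ν : Measure ℝ) : ENNReal :=
  ⨆ (h : ℝ → ℝ) (_ : LipschitzWith 1 h), ENNReal.ofReal |(∫ x, h x ∂μ) - ∫ x, h x ∂ν|

/-- The law `μ` has the distribution function
`F(x) = 1 - (A + ε(x)) / |x|^α * (1 + β)` for `x > 0`,
`F(x) = (A + ε(x)) / |x|^α * (1 - β)` for `x < 0`,
where `ε` is a bounded (Borel) function vanishing at `±∞`. (The formula is void at `x = 0`, where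
`F` is determined by right continuity.) -/
structure HasNormalAttractionForm (α A β : ℝ) (ε : ℝ → ℝ) (μ : Measure ℝ) : Prop where
  measurable_eps : Measurable ε
  bounded_eps : ∃ B : ℝ, ∀ x, |ε x| ≤ B
  tendsto_atTop : Tendsto ε atTop (𝓝 0)
  tendsto_atBot : Tendsto ε atBot (𝓝 0)
  cdf_pos : ∀ x : ℝ, 0 < x → cdf μ x = 1 - (A + ε x) / |x| ^ α * (1 + β)
  cdf_neg : ∀ x : ℝ, x < 0 → cdf μ x = (A + ε x) / |x| ^ α * (1 - β)

/-- `f` is monotone (nondecreasing or nonincreasing) on the set `s`. -/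
def IsMonotoneOn (f : ℝ → ℝ) (s : Set ℝ) : Prop :=
  MonotoneOn f s ∨ AntitoneOn f s

/-- The functions `ε(x) / |x|^α` on the two half-lines are ultimately monotone. -/
def UltimatelyMonotone (α : ℝ) (ε : ℝ → ℝ) : Prop :=
  ∃ x₀ : ℝ, 0 < x₀ ∧
    IsMonotoneOn (fun x => ε x / |x| ^ α) (Set.Ioi x₀) ∧
    IsMonotoneOn (fun x => ε x / |x| ^ α) (Set.Iio (-x₀))

/-- The scaling constant `σ = (A α ∫ (1 - cos y) / |y|^(1 + α) dy)^(1 / α)`. -/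
noncomputable def stableScale (α A : ℝ) : ℝ :=
  (A * α * ∫ y : ℝ, (1 - Real.cos y) / |y| ^ (1 + α)) ^ (1 / α)

/-- The normalized sum `S_n = σ⁻¹ n^(-1/α) (X_1 + ⋯ + X_n - n E[X_1])`; the sequence is indexed
from `0`. -/
noncomputable def normalizedSum {Ω : Type*} [MeasurableSpace Ω] (P : Measure Ω) (α A : ℝ)
    (X : ℕ → Ω → ℝ) (n : ℕ) (ω : Ω) : ℝ :=
  1 / stableScale α A * (n : ℝ) ^ (-(1 / α)) *
    (∑ i ∈ Finset.range n, X i ω - n * ∫ ω', X 0 ω' ∂P)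

open scoped FourierTransform SchwartzMap ContDiff

/-! The proof is Lindeberg's replacement argument with stable variables in place of Gaussian ones.
Let Y be stable of scale σ = `stableScale α A`. The n centred summands are exchanged one by one for
independent copies of Y. A sum of j copies has the law of j^(1/α) Y, so the summand exchanged after
j others sees the test function f_j(x) = E H(x + j^(1/α) Y). The density of Y has an integrable
derivative; hence for 1-Lipschitz H the second differences of f_j are at most M |a| |b| with M = C
j^(-1/α) (`IsStableLaw.exists_secondDiffBound`). Only j = 0 lacks this smoothing, and there a first
moment bound suffices.

Everything rests on the cost of one exchange: for a 1-Lipschitz f with second differences bounded by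
M it is at most C (M (1 + J) + e s^(1-α)), where J is the integral of |ε(x)| |x|^(1-α) over [-s, s]
and e bounds |ε| beyond s (`IsStableLaw.exists_abs_integral_sub_integral_le`). Both variables being
centred, the affine part of f at the base point may be removed, leaving g with g(0) = g'(0) = 0. For
the summand X, integration by parts gives E g(X) as the integral of g' (1_{x>0} - F), a weight that
differs from `stableTail` only through ε; here |g'(x)| ≤ M |x| is used within s and |g'| ≤ 2 beyond.
The centring shift costs a multiple of M (E|X|)², and E|X| = O(√(1 + J) + e s^(1-α)).

For Y itself, halving replaces any knowledge of its distribution function. With c = 2^(-1/α), Y has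
the law of c Y' + c Y'' for two independent copies, so E g(Y) = 2 E g(c Y) + O(M c²). Iterating
gives a geometric series of ratio 2c² < 1, and 2^k E g(c^k Y) tends to the integral of g' against
`stableTail`; the limit is identified by Fourier inversion and the Lévy–Khintchine formula.

Summing j^(-1/α) over 0 < j < n gives n^(1-1/α). Division by s = σ n^(1/α) turns the total into a
multiple of n^(1-2/α) (1 + J) + e. -/

/-! ### The stable exponent ψ and the Fourier transform of t exp(-ψ(t)) -/

theorem integrable_comp_abs_of_integrableOn {f : ℝ → ℝ} (hf : IntegrableOn f (Set.Ioi 0)) :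
    Integrable (fun x => f |x|) := by
  have h1 : IntegrableOn (fun x => f |x|) (Set.Ioi 0) :=
    hf.congr_fun (fun x hx => by simp [abs_of_pos (Set.mem_Ioi.1 hx)]) measurableSet_Ioi
  have h2 : IntegrableOn (fun x => f |x|) (Set.Iic 0) := by
    have h3 : IntegrableOn (fun x => f |x|) (Set.Ici 0) := by
      rwa [integrableOn_Ici_iff_integrableOn_Ioi]
    have := (integrable_indicator_iff measurableSet_Ici).2 h3
    have h4 := this.comp_neg
    rw [← integrable_indicator_iff measurableSet_Iic]
    refine h4.congr (Eventually.of_forall fun x => ?_)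
    by_cases hx : x ≤ 0
    · simp [Set.indicator, hx]
    · simp [Set.indicator, hx]
  have := h2.union h1
  rwa [Set.Iic_union_Ioi, integrableOn_univ] at this

theorem integrable_abs_rpow_mul_exp_neg {p s b : ℝ} (hs : -1 < s) (hp : 0 < p) (hb : 0 < b) :
    Integrable (fun t : ℝ => |t| ^ s * Real.exp (-b * |t| ^ p)) :=
  integrable_comp_abs_of_integrableOn
    (f := fun t : ℝ => t ^ s * Real.exp (-b * t ^ p)) (integrableOn_rpow_mul_exp_neg_mul_rpow hs hp hb)

/-- The characteristic exponent `b |t|^α - i c sign(t) |t|^α`. -/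
noncomputable def stableExponent (α b c t : ℝ) : ℂ :=
  ((b * |t| ^ α : ℝ) : ℂ) - ((c * (t * |t| ^ (α - 1)) : ℝ) : ℂ) * Complex.I

/-- The derivative of `stableExponent`. -/
noncomputable def stableExponentDeriv (α b c t : ℝ) : ℂ :=
  ((b * (α * |t| ^ (α - 2) * t) : ℝ) : ℂ) - ((c * (α * |t| ^ (α - 1)) : ℝ) : ℂ) * Complex.I

theorem hasDerivAt_mul_abs_rpow (x : ℝ) {p : ℝ} (hp : 1 < p) :
    HasDerivAt (fun x : ℝ => x * |x| ^ (p - 1)) (p * |x| ^ (p - 1)) x := by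
  rcases lt_trichotomy x 0 with hx | rfl | hx
  · have h1 : HasDerivAt (fun x : ℝ => x * (-x) ^ (p - 1))
        (1 * (-x) ^ (p - 1) + x * ((-1) * (p - 1) * (-x) ^ (p - 1 - 1))) x :=
      (hasDerivAt_id x).mul ((hasDerivAt_id x).neg.rpow_const (Or.inl (by simp; exact hx.ne)))
    have h2 : (fun x : ℝ => x * |x| ^ (p - 1)) =ᶠ[𝓝 x] fun x : ℝ => x * (-x) ^ (p - 1) := by
      filter_upwards [Iio_mem_nhds hx] with y hy
      rw [abs_of_neg hy]
    convert! h1.congr_of_eventuallyEq h2 using 1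
    rw [abs_of_neg hx, Real.rpow_sub_one (neg_pos.2 hx).ne' (p - 1)]
    have := hx.ne
    field_simp
    ring
  · rw [hasDerivAt_iff_tendsto_slope_zero]
    have h1 : Tendsto (fun t : ℝ => |t| ^ (p - 1)) (𝓝[≠] 0) (𝓝 (p * |0| ^ (p - 1))) := by
      have : ContinuousAt (fun t : ℝ => |t| ^ (p - 1)) 0 :=
        (continuous_abs.rpow_const fun _ => Or.inr (by linarith)).continuousAt
      have h := this.tendsto.mono_left (nhdsWithin_le_nhds (s := {0}ᶜ))
      simpa [Real.zero_rpow (by linarith : p - 1 ≠ 0)] using h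
    refine h1.congr' ?_
    filter_upwards [self_mem_nhdsWithin] with t ht
    have : t ≠ 0 := ht
    simp only [zero_add, zero_mul, sub_zero, smul_eq_mul]
    field_simp
  · have h1 : HasDerivAt (fun x : ℝ => x * x ^ (p - 1))
        (1 * x ^ (p - 1) + x * (1 * (p - 1) * x ^ (p - 1 - 1))) x :=
      (hasDerivAt_id x).mul ((hasDerivAt_id x).rpow_const (Or.inl (by simp; exact hx.ne')))
    have h2 : (fun x : ℝ => x * |x| ^ (p - 1)) =ᶠ[𝓝 x] fun x : ℝ => x * x ^ (p - 1) := by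
      filter_upwards [Ioi_mem_nhds hx] with y hy
      rw [abs_of_pos hy]
    convert! h1.congr_of_eventuallyEq h2 using 1
    rw [abs_of_pos hx, Real.rpow_sub_one hx.ne' (p - 1)]
    field_simp
    ring

theorem hasDerivAt_stableExponent {α : ℝ} (hα : 1 < α) (b c t : ℝ) :
    HasDerivAt (stableExponent α b c) (stableExponentDeriv α b c t) t :=
  (((hasDerivAt_abs_rpow t hα).const_mul b).ofReal_comp).sub
    ((((hasDerivAt_mul_abs_rpow t hα).const_mul c).ofReal_comp).mul_const Complex.I)

theorem abs_rpow_sub_two_mul_sq {α : ℝ} (hα : 1 < α) (t : ℝ) :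
    |t| ^ (α - 2) * t * t = |t| ^ α := by
  rcases eq_or_ne t 0 with rfl | ht
  · simp [Real.zero_rpow (by linarith : α ≠ 0)]
  · have h : 0 < |t| := abs_pos.2 ht
    rw [Real.rpow_sub h]
    rw [mul_assoc, ← abs_mul_abs_self t]
    norm_num
    field_simp

/-- Euler's identity for a function homogeneous of degree α. It replaces t ψ'(t) by α ψ(t), so that
t exp(-ψ(t)) can be differentiated twice although ψ itself need not be twice differentiable at 0. -/
theorem mul_stableExponentDeriv {α : ℝ} (hα : 1 < α) (b c t : ℝ) :
    (t : ℂ) * stableExponentDeriv α b c t = α * stableExponent α b c t := by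
  rw [stableExponent, stableExponentDeriv, ← abs_rpow_sub_two_mul_sq hα]
  push_cast
  ring

theorem norm_stableExponent_le {α : ℝ} (hα : 1 < α) (b c t : ℝ) :
    ‖stableExponent α b c t‖ ≤ (|b| + |c|) * |t| ^ α := by
  have h0 : |t| * |t| ^ (α - 1) = |t| ^ α := by
    rw [← Real.rpow_one_add' (abs_nonneg t) (by linarith)]; ring_nf
  refine (norm_sub_le _ _).trans ?_
  rw [norm_mul, Complex.norm_I, mul_one, Complex.norm_real, Complex.norm_real, norm_mul, norm_mul,
    norm_mul]
  simp only [Real.norm_eq_abs, abs_of_nonneg (Real.rpow_nonneg (abs_nonneg t) _), h0]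
  rw [add_mul]

theorem norm_stableExponentDeriv_le {α : ℝ} (hα : 1 < α) (b c t : ℝ) :
    ‖stableExponentDeriv α b c t‖ ≤ α * (|b| + |c|) * |t| ^ (α - 1) := by
  have h0 : |t| ^ (α - 2) * |t| ≤ |t| ^ (α - 1) := by
    rcases eq_or_ne t 0 with rfl | ht
    · simp; positivity
    · rw [← Real.rpow_add_one (abs_pos.2 ht).ne']; ring_nf; rfl
  refine (norm_sub_le _ _).trans ?_
  rw [norm_mul, Complex.norm_I, mul_one, Complex.norm_real, Complex.norm_real]
  simp only [norm_mul, Real.norm_eq_abs, abs_of_nonneg (Real.rpow_nonneg (abs_nonneg t) _),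
    abs_of_pos (by linarith : 0 < α)]
  have := mul_le_mul_of_nonneg_left h0 (by positivity : 0 ≤ |b| * α)
  linarith

theorem norm_exp_neg_stableExponent (α b c t : ℝ) :
    ‖Complex.exp (-stableExponent α b c t)‖ = Real.exp (-b * |t| ^ α) := by
  rw [Complex.norm_exp, stableExponent]
  simp

/-- The function `t exp (-(b |t|^α - i c sign(t) |t|^α))`. -/
noncomputable def idMulStable (α b c t : ℝ) : ℂ := t * Complex.exp (-stableExponent α b c t)

/-- The derivative of `idMulStable`. -/
noncomputable def idMulStableDeriv (α b c t : ℝ) : ℂ :=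
  (1 - α * stableExponent α b c t) * Complex.exp (-stableExponent α b c t)

/-- The second derivative of `idMulStable`. -/
noncomputable def idMulStableDeriv₂ (α b c t : ℝ) : ℂ :=
  -stableExponentDeriv α b c t * (1 + α - α * stableExponent α b c t) *
    Complex.exp (-stableExponent α b c t)

theorem hasDerivAt_idMulStable {α : ℝ} (hα : 1 < α) (b c t : ℝ) :
    HasDerivAt (idMulStable α b c) (idMulStableDeriv α b c t) t := by
  have h := (Complex.ofRealCLM.hasDerivAt (x := t)).mul (hasDerivAt_stableExponent hα b c t).neg.cexp
  simp only [Complex.ofRealCLM_apply, Complex.ofReal_one] at h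
  convert! h using 1
  rw [idMulStableDeriv, ← mul_stableExponentDeriv hα, Pi.neg_apply]
  ring

theorem hasDerivAt_idMulStableDeriv {α : ℝ} (hα : 1 < α) (b c t : ℝ) :
    HasDerivAt (idMulStableDeriv α b c) (idMulStableDeriv₂ α b c t) t := by
  have h := (((hasDerivAt_stableExponent hα b c t).const_mul (α : ℂ)).const_sub 1).mul
    (hasDerivAt_stableExponent hα b c t).neg.cexp
  convert! h using 1
  rw [idMulStableDeriv₂, Pi.neg_apply]
  ring

theorem continuous_stableExponent {α : ℝ} (hα : 1 < α) (b c : ℝ) :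
    Continuous (stableExponent α b c) :=
  continuous_iff_continuousAt.2 fun t => (hasDerivAt_stableExponent hα b c t).continuousAt

theorem measurable_stableExponentDeriv (α b c : ℝ) : Measurable (stableExponentDeriv α b c) := by
  unfold stableExponentDeriv
  fun_prop

theorem integrable_idMulStable {α b : ℝ} (hα : 1 < α) (hb : 0 < b) (c : ℝ) :
    Integrable (idMulStable α b c) := by
  refine (integrable_abs_rpow_mul_exp_neg (s := 1) (p := α) (by norm_num) (by linarith) hb).mono'
    (Continuous.aestronglyMeasurable ?_) (Eventually.of_forall fun t => ?_)
  · exact Complex.continuous_ofReal.mul (continuous_stableExponent hα b c).neg.cexp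
  · rw [idMulStable, norm_mul, norm_exp_neg_stableExponent, Complex.norm_real, Real.rpow_one]
    rfl

theorem integrable_idMulStableDeriv₂ {α b : ℝ} (hα : 1 < α) (hb : 0 < b) (c : ℝ) :
    Integrable (idMulStableDeriv₂ α b c) := by
  set D := α * (|b| + |c|)
  have h1 := (integrable_abs_rpow_mul_exp_neg (s := α - 1) (p := α) (by linarith) (by linarith)
    hb).const_mul (D * (1 + α))
  have h2 := (integrable_abs_rpow_mul_exp_neg (s := α - 1 + α) (p := α) (by linarith) (by linarith)
    hb).const_mul (D * D)
  refine (h1.add h2).mono' (Measurable.aestronglyMeasurable ?_) (Eventually.of_forall fun t => ?_)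
  · have := (continuous_stableExponent hα b c).measurable
    have := measurable_stableExponentDeriv α b c
    unfold idMulStableDeriv₂
    fun_prop
  · rw [idMulStableDeriv₂, norm_mul, norm_mul, norm_exp_neg_stableExponent, norm_neg]
    have e1 := norm_stableExponentDeriv_le hα b c t
    have e2 : ‖1 + (α : ℂ) - α * stableExponent α b c t‖ ≤ (1 + α) + D * |t| ^ α := by
      refine (norm_sub_le _ _).trans (add_le_add ?_ ?_)
      · refine (norm_add_le _ _).trans ?_
        simp [abs_of_pos (by linarith : 0 < α)]
      · rw [norm_mul, Complex.norm_real, Real.norm_eq_abs, abs_of_pos (by linarith : 0 < α)]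
        have := mul_le_mul_of_nonneg_left (norm_stableExponent_le hα b c t) (by linarith : 0 ≤ α)
        simp only [D]; linarith
    have e3 := mul_le_mul_of_nonneg_right (mul_le_mul e1 e2 (norm_nonneg _) (by positivity))
      (Real.exp_pos (-b * |t| ^ α)).le
    refine e3.trans (le_of_eq ?_)
    simp only [Pi.add_apply]
    rw [Real.rpow_add_of_nonneg (abs_nonneg t) (by linarith) (by linarith)]
    ring

theorem integrable_idMulStableDeriv {α b : ℝ} (hα : 1 < α) (hb : 0 < b) (c : ℝ) :
    Integrable (idMulStableDeriv α b c) := by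
  have h1 := (integrable_abs_rpow_mul_exp_neg (s := 0) (p := α) (by norm_num) (by linarith) hb)
  have h2 := (integrable_abs_rpow_mul_exp_neg (s := α) (p := α) (by linarith) (by linarith)
    hb).const_mul (α * (|b| + |c|))
  refine (h1.add h2).mono' (Continuous.aestronglyMeasurable ?_) (Eventually.of_forall fun t => ?_)
  · exact continuous_iff_continuousAt.2 fun t => (hasDerivAt_idMulStableDeriv hα b c t).continuousAt
  · rw [idMulStableDeriv, norm_mul, norm_exp_neg_stableExponent]
    have e2 : ‖1 - (α : ℂ) * stableExponent α b c t‖ ≤ 1 + α * (|b| + |c|) * |t| ^ α := by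
      refine (norm_sub_le _ _).trans (add_le_add (by simp) ?_)
      rw [norm_mul, Complex.norm_real, Real.norm_eq_abs, abs_of_pos (by linarith : 0 < α), mul_assoc]
      exact mul_le_mul_of_nonneg_left (norm_stableExponent_le hα b c t) (by linarith : 0 ≤ α)
    refine (mul_le_mul_of_nonneg_right e2 (Real.exp_pos _).le).trans (le_of_eq ?_)
    simp only [Pi.add_apply, Real.rpow_zero]
    ring

/-- Two integrations by parts: x² times the transform is bounded by the L¹ norm of f'', and the
transform itself by the L¹ norm of f, so it is O(1 / (1 + x²)). -/
theorem integrable_fourier_of_hasDerivAt₂ {f f' f'' : ℝ → ℂ} (h1 : ∀ t, HasDerivAt f (f' t) t)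
    (h2 : ∀ t, HasDerivAt f' (f'' t) t) (i0 : Integrable f) (i1 : Integrable f')
    (i2 : Integrable f'') : Integrable (𝓕 f) := by
  have d1 : deriv f = f' := funext fun t => (h1 t).deriv
  have d2 : deriv f' = f'' := funext fun t => (h2 t).deriv
  have e1 := Real.fourier_deriv i0 (fun t => (h1 t).differentiableAt) (d1 ▸ i1)
  have e2 := Real.fourier_deriv i1 (fun t => (h2 t).differentiableAt) (d2 ▸ i2)
  rw [d1] at e1
  rw [d2, e1] at e2
  have b0 : ∀ x, ‖𝓕 f x‖ ≤ ∫ t, ‖f t‖ := fun x =>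
    VectorFourier.norm_fourierIntegral_le_integral_norm _ _ _ _ _
  have b2 : ∀ x, ‖𝓕 f'' x‖ ≤ ∫ t, ‖f'' t‖ := fun x =>
    VectorFourier.norm_fourierIntegral_le_integral_norm _ _ _ _ _
  have hc : Continuous (𝓕 f) :=
    VectorFourier.fourierIntegral_continuous Real.continuous_fourierChar
      (by exact continuous_inner) i0
  refine (integrable_inv_one_add_sq.mul_const ((∫ t, ‖f t‖) + ∫ t, ‖f'' t‖)).mono'
    hc.aestronglyMeasurable (Eventually.of_forall fun x => ?_)
  have h3 := b2 x
  rw [e2] at h3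
  simp only [norm_smul, norm_mul, Complex.norm_I, Complex.norm_real, Complex.norm_ofNat,
    Real.norm_eq_abs, abs_of_pos Real.pi_pos, mul_one] at h3
  have h4 : x ^ 2 * ‖𝓕 f x‖ ≤ ∫ t, ‖f'' t‖ := by
    refine le_trans ?_ h3
    rw [← sq_abs x]
    have : (1 : ℝ) ≤ (2 * Real.pi) * (2 * Real.pi) := by nlinarith [Real.pi_gt_three]
    have h5 : 0 ≤ |x| ^ 2 * ‖𝓕 f x‖ := by positivity
    nlinarith
  have h6 := b0 x
  rw [inv_mul_eq_div, le_div_iff₀ (by positivity)]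
  nlinarith

theorem integrable_fourier_idMulStable {α b : ℝ} (hα : 1 < α) (hb : 0 < b) (c : ℝ) :
    Integrable (𝓕 (idMulStable α b c)) :=
  integrable_fourier_of_hasDerivAt₂ (hasDerivAt_idMulStable hα b c)
    (hasDerivAt_idMulStableDeriv hα b c) (integrable_idMulStable hα hb c)
    (integrable_idMulStableDeriv hα hb c) (integrable_idMulStableDeriv₂ hα hb c)

/-! ### Integrals of derivatives against a stable law, and cutoffs -/

theorem mul_abs_rpow_sub_one (α t : ℝ) :
    t * |t| ^ (α - 1) = Real.sign t * |t| ^ α := by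
  rcases lt_trichotomy t 0 with h | rfl | h
  · rw [Real.sign_of_neg h, Real.rpow_sub_one (abs_pos.2 h.ne).ne', abs_of_neg h]
    have := h.ne
    field_simp
  · simp
  · rw [Real.sign_of_pos h, Real.rpow_sub_one (abs_pos.2 h.ne').ne', abs_of_pos h]
    field_simp

theorem stableExponent_mul {α r : ℝ} (hr : 0 < r) (b c t : ℝ) :
    stableExponent α b c (r * t) = stableExponent α (b * r ^ α) (c * r ^ α) t := by
  have h : r ^ α = r * r ^ (α - 1) := by
    rw [Real.rpow_sub_one hr.ne']; field_simp
  rw [stableExponent, stableExponent, abs_mul, abs_of_pos hr,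
    Real.mul_rpow hr.le (abs_nonneg t), Real.mul_rpow hr.le (abs_nonneg t)]
  congr 2
  · ring_nf
  · congr 1
    rw [h]; ring

theorem stableExponent_smul (α b c r t : ℝ) :
    stableExponent α (b * r) (c * r) t = r * stableExponent α b c t := by
  rw [stableExponent, stableExponent]
  push_cast
  ring

theorem IsStableLaw.charFun_eq' {α σ β : ℝ} {ρ : Measure ℝ} (h : IsStableLaw α σ β ρ)
    (t : ℝ) :
    charFun ρ t = Complex.exp
      (-stableExponent α (σ ^ α) (σ ^ α * (β * Real.tan (Real.pi * α / 2))) t) := by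
  rw [h.charFun_eq, stableExponent, mul_abs_rpow_sub_one]
  congr 1
  push_cast
  ring

/-- Fubini, in the form of the self-adjointness of the Fourier transform with the constant 1 on the
side of ρ. The argument -2πs reconciles the conventions of `𝓕` and `charFun`. -/
theorem integral_fourier_eq_integral_mul_charFun (ρ : Measure ℝ) [IsProbabilityMeasure ρ]
    {k : ℝ → ℂ} (hk : Integrable k) :
    ∫ y, 𝓕 k y ∂ρ = ∫ s, k s * charFun ρ (-(2 * Real.pi * s)) := by
  have h := VectorFourier.integral_fourierIntegral_smul_eq_flip (μ := volume) (ν := ρ)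
    (L := innerₗ ℝ) (f := k) (g := fun _ => (1 : ℂ)) Real.continuous_fourierChar
    continuous_inner hk (integrable_const _)
  simp only [smul_eq_mul, mul_one] at h
  refine h.trans (integral_congr_ae (Eventually.of_forall fun s => ?_))
  simp only
  congr 1
  rw [charFun_apply_real, VectorFourier.fourierIntegral]
  refine integral_congr_ae (Eventually.of_forall fun x => ?_)
  simp only [LinearMap.flip_apply, innerₗ_apply_apply, RCLike.inner_apply, conj_trivial,
    Circle.smul_def, Real.fourierChar_apply, smul_eq_mul, mul_one]
  congr 1
  push_cast
  ring

/-- Integrating by parts against a stable law: its density has an integrable derivative. -/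
theorem IsStableLaw.exists_norm_integral_deriv_schwartz_le {α σ β : ℝ} {ρ : Measure ℝ}
    (h : IsStableLaw α σ β ρ) (hα : 1 < α) (hσ : 0 < σ) :
    ∃ C : ℝ, 0 ≤ C ∧ ∀ (g : 𝓢(ℝ, ℂ)) (B : ℝ), (∀ x, ‖g x‖ ≤ B) →
      ‖∫ y, deriv g y ∂ρ‖ ≤ C * B := by
  have := h.isProbabilityMeasure
  set b := σ ^ α * (2 * Real.pi) ^ α with hb
  set c := σ ^ α * (β * Real.tan (Real.pi * α / 2)) * (2 * Real.pi) ^ α with hc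
  have hbpos : 0 < b := by positivity
  have hφ : ∀ s : ℝ, charFun ρ (2 * Real.pi * s) = Complex.exp (-stableExponent α b c s) := by
    intro s
    rw [h.charFun_eq', stableExponent_mul (by positivity)]
  -- Up to normalisation this is the L¹ norm of the derivative of the density of ρ, expressed
  -- through its Fourier transform; the density itself never appears.
  refine ⟨2 * Real.pi * ∫ x, ‖𝓕 (idMulStable α b c) x‖, by positivity, fun g B hB => ?_⟩
  set k : 𝓢(ℝ, ℂ) := 𝓕⁻ g
  have hk : 𝓕 (k : ℝ → ℂ) = g := by
    rw [← SchwartzMap.fourier_coe, FourierTransform.fourier_fourierInv_eq]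
  have hki : Integrable (fun x : ℝ => x • k x) := by
    have := (k.integrable_pow_mul volume 1)
    refine this.mono' (by fun_prop) (Eventually.of_forall fun x => ?_)
    rw [norm_smul, pow_one]
  have hd : deriv g = 𝓕 (fun x : ℝ => (-2 * Real.pi * Complex.I * x) • k x) := by
    rw [← hk, Real.deriv_fourier k.integrable hki]
  have hki' : Integrable (fun x : ℝ => (-2 * Real.pi * Complex.I * x) • k x) := by
    refine (hki.const_mul (-2 * Real.pi * Complex.I)).congr (Eventually.of_forall fun x => ?_)
    simp only [smul_eq_mul, Complex.real_smul]
    ring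
  -- Differentiation becomes multiplication by s on the Fourier side; the factor s is moved from g
  -- to the characteristic function, which thereby turns into `idMulStable`.
  have key : ∫ y, deriv g y ∂ρ = 2 * Real.pi * Complex.I * ∫ x, g x * 𝓕 (idMulStable α b c) x := by
    rw [hd, integral_fourier_eq_integral_mul_charFun ρ hki']
    have e1 : ∀ s : ℝ, (-2 * Real.pi * Complex.I * s) • k s * charFun ρ (-(2 * Real.pi * s)) =
        2 * Real.pi * Complex.I * (𝓕 (g : ℝ → ℂ) (-s) * idMulStable α b c (-s)) := by
      intro s
      have : 𝓕 (g : ℝ → ℂ) (-s) = k s := by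
        rw [← Real.fourierInv_eq_fourier_neg, ← SchwartzMap.fourierInv_coe]
      rw [this, idMulStable, ← hφ]
      simp only [smul_eq_mul, mul_neg]
      push_cast
      ring
    simp_rw [e1]
    rw [integral_const_mul, integral_neg_eq_self
      (fun s => 𝓕 (g : ℝ → ℂ) s * idMulStable α b c s)]
    congr 1
    have hflip := VectorFourier.integral_fourierIntegral_smul_eq_flip (μ := volume) (ν := volume)
      (L := innerₗ ℝ) (f := g) (g := idMulStable α b c) Real.continuous_fourierChar
      continuous_inner g.integrable (integrable_idMulStable hα hbpos c)
    rw [flip_innerₗ] at hflip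
    exact hflip
  rw [key, norm_mul]
  have hn : ‖2 * (Real.pi : ℂ) * Complex.I‖ = 2 * Real.pi := by
    simp [abs_of_pos Real.pi_pos]
  rw [hn, mul_assoc (2 * Real.pi)]
  refine mul_le_mul_of_nonneg_left ?_ (by positivity)
  rw [← integral_mul_const]
  refine norm_integral_le_of_norm_le
    ((integrable_fourier_idMulStable hα hbpos c).norm.mul_const B)
    (Eventually.of_forall fun x => ?_)
  rw [norm_mul, mul_comm]
  exact mul_le_mul_of_nonneg_left (hB x) (norm_nonneg _)

/-- A smooth cutoff function with bounded derivatives of the first two orders. -/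
theorem exists_smooth_cutoff : ∃ (χ : ℝ → ℝ) (C : ℝ), ContDiff ℝ ∞ χ ∧ 0 ≤ C ∧
    (∀ x, |x| ≤ 1 → χ x = 1) ∧ (∀ x, 2 ≤ |x| → χ x = 0) ∧ (∀ x, |χ x| ≤ 1) ∧
    (∀ x, (1 + |x|) * |deriv χ x| ≤ C) ∧ (∀ x, |x| * |deriv (deriv χ) x| ≤ C) := by
  let f : ContDiffBump (0 : ℝ) := ⟨1, 2, one_pos, one_lt_two⟩
  have hs : ContDiff ℝ ∞ f := f.contDiff
  have hc : HasCompactSupport f := f.hasCompactSupport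
  have hs1 : ContDiff ℝ ∞ (deriv f) := (contDiff_infty_iff_deriv.1 hs).2
  have hs2 : ContDiff ℝ ∞ (deriv (deriv f)) := (contDiff_infty_iff_deriv.1 hs1).2
  obtain ⟨C1, h1⟩ := ((continuous_const.add continuous_abs).mul
    hs1.continuous).bounded_above_of_compact_support (f := fun x : ℝ => (1 + |x|) * deriv f x)
    hc.deriv.mul_left
  obtain ⟨C2, h2⟩ := (continuous_abs.mul hs2.continuous).bounded_above_of_compact_support
    (f := fun x : ℝ => |x| * deriv (deriv f) x) hc.deriv.deriv.mul_left
  refine ⟨f, max C1 C2, hs, ?_, fun x hx => ?_, fun x hx => ?_, fun x => ?_, fun x => ?_,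
    fun x => ?_⟩
  · exact le_max_of_le_left ((norm_nonneg _).trans (h1 0))
  · exact f.one_of_mem_closedBall (by simpa using hx)
  · exact f.zero_of_le_dist (by simpa using hx)
  · rw [abs_of_nonneg f.nonneg]; exact f.le_one
  · refine le_trans (le_of_eq ?_) ((h1 x).trans (le_max_left _ _))
    rw [Real.norm_eq_abs, abs_mul, abs_of_pos (by positivity : 0 < 1 + |x|)]
  · refine le_trans (le_of_eq ?_) ((h2 x).trans (le_max_right _ _))
    rw [Real.norm_eq_abs, abs_mul, abs_abs]

/-- Near a fixed point the truncated function is eventually g itself, which gives pointwise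
convergence of values and derivatives at once in the dominated convergence arguments. -/
theorem eventuallyEq_mul_cutoff {χ : ℝ → ℝ} (hχ : ∀ x, |x| ≤ 1 → χ x = 1) (g : ℝ → ℝ) (x : ℝ) :
    ∀ᶠ N : ℕ in atTop, (fun y => g y * χ (y / (N + 1))) =ᶠ[𝓝 x] g := by
  filter_upwards [eventually_gt_atTop ⌈|x|⌉₊] with N hN
  have hN' : |x| < N := Nat.lt_of_ceil_lt hN
  have hpos : (0 : ℝ) < N + 1 := by positivity
  have : ∀ᶠ y in 𝓝 x, |y| < (N : ℝ) := continuous_abs.continuousAt.eventually_lt_const hN'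
  filter_upwards [this] with y hy
  rw [hχ _ (by rw [abs_div, abs_of_pos hpos, div_le_one hpos]; linarith), mul_one]

theorem hasDerivAt_mul_cutoff {χ g : ℝ → ℝ} (hχ : Differentiable ℝ χ) (hg : Differentiable ℝ g)
    (R x : ℝ) : HasDerivAt (fun y => g y * χ (y / R))
      (deriv g x * χ (x / R) + g x * (deriv χ (x / R) / R)) x := by
  have e2 : HasDerivAt (fun x : ℝ => χ (x / R)) (deriv χ (x / R) * (1 / R)) x :=
    (hχ _).hasDerivAt.comp x ((hasDerivAt_id x).div_const _)
  convert! (hg x).hasDerivAt.mul e2 using 1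
  ring

theorem hasCompactSupport_mul_cutoff {χ : ℝ → ℝ} (hχ : ∀ x, 2 ≤ |x| → χ x = 0) (g : ℝ → ℝ)
    {R : ℝ} (hR : 0 < R) : HasCompactSupport (fun y => g y * χ (y / R)) := by
  refine HasCompactSupport.intro (K := Metric.closedBall 0 (2 * R))
    (isCompact_closedBall _ _) fun x hx => ?_
  have hx' : 2 * R < |x| := by simpa using hx
  have : χ (x / R) = 0 := by
    refine hχ _ ?_
    rw [abs_div, abs_of_pos hR, le_div_iff₀ hR]
    exact hx'.le
  simp [this]

/-! ### First moment, uniqueness and strict stability of stable laws -/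

/-- Mean value inequality on the convex left half-plane, where the derivative of the exponential has
norm at most 1. -/
theorem Complex.norm_exp_sub_one_le_of_re_nonpos {z : ℂ} (hz : z.re ≤ 0) :
    ‖Complex.exp z - 1‖ ≤ ‖z‖ := by
  have hconv : Convex ℝ {w : ℂ | w.re ≤ 0} := convex_halfSpace_re_le 0
  have := hconv.norm_image_sub_le_of_norm_hasDerivWithin_le (f := Complex.exp) (f' := Complex.exp)
    (C := 1) (x := 0) (y := z) (fun w _ => (Complex.hasDerivAt_exp w).hasDerivWithinAt)
    (fun w hw => by rw [Complex.norm_exp]; exact Real.exp_le_one_iff.2 hw) (by simp) hz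
  simpa using this

theorem stableExponent_re (α b c t : ℝ) : (stableExponent α b c t).re = b * |t| ^ α := by
  simp [stableExponent]

theorem integrable_id_of_measure_abs_gt_le {μ : Measure ℝ} [IsProbabilityMeasure μ] {α C : ℝ}
    (hα : 1 < α) (h : ∀ r, 1 ≤ r → μ.real {x | r < |x|} ≤ C * r ^ (-α)) :
    Integrable (fun x : ℝ => x) μ := by
  refine ⟨by fun_prop, ?_⟩
  have h1 : ∫⁻ x, ‖x‖ₑ ∂μ = ∫⁻ t in Set.Ioi 0, μ {x : ℝ | t < |x|} := by
    rw [← lintegral_eq_lintegral_meas_lt μ (Eventually.of_forall fun x : ℝ => abs_nonneg x)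
      (by fun_prop)]
    refine lintegral_congr fun x => ?_
    rw [Real.enorm_eq_ofReal_abs]
  rw [HasFiniteIntegral, h1, ← Set.Ioc_union_Ioi_eq_Ioi (zero_le_one' ℝ)]
  refine (lintegral_union_le _ _ _).trans_lt (ENNReal.add_lt_top.2 ⟨?_, ?_⟩)
  · refine (setLIntegral_mono measurable_const (fun t _ => prob_le_one)).trans_lt ?_
    simp
  · have hi : IntegrableOn (fun t : ℝ => C * t ^ (-α)) (Set.Ioi 1) :=
      (integrableOn_Ioi_rpow_of_lt (by linarith) one_pos).const_mul C
    refine lt_of_le_of_lt ?_ hi.lintegral_lt_top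
    refine setLIntegral_mono (by fun_prop) (fun t ht => ?_)
    rw [← ofReal_measureReal]
    exact ENNReal.ofReal_le_ofReal (h t (le_of_lt ht))

/-- The mass beyond r is controlled by the average of 1 - φ over |t| ≤ 2/r, which is of order r^(-α)
because 1 - φ(t) = O(|t|^α). Such tails are integrable at infinity since α > 1. -/
theorem IsStableLaw.integrable {α σ β : ℝ} {ρ : Measure ℝ} (h : IsStableLaw α σ β ρ)
    (hα : 1 < α) (hσ : 0 < σ) : Integrable (fun x : ℝ => x) ρ := by
  have := h.isProbabilityMeasure
  set b := σ ^ α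
  set c := σ ^ α * (β * Real.tan (Real.pi * α / 2)) with hc
  refine integrable_id_of_measure_abs_gt_le (C := 2⁻¹ * (b + |c|) * 2 ^ α * 4) hα fun r hr => ?_
  have hr0 : 0 < r := by linarith
  refine (measureReal_abs_gt_le_integral_charFun hr0).trans ?_
  have hb : ∀ t ∈ Set.uIoc (-2 * r⁻¹) (2 * r⁻¹), ‖1 - charFun ρ t‖ ≤ (b + |c|) * (2 * r⁻¹) ^ α := by
    intro t ht
    rw [Set.uIoc_of_le (by have := inv_pos.2 hr0; linarith)] at ht
    have ht' : |t| ≤ 2 * r⁻¹ := abs_le.2 ⟨by linarith [ht.1], ht.2⟩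
    rw [h.charFun_eq', norm_sub_rev]
    refine (Complex.norm_exp_sub_one_le_of_re_nonpos ?_).trans ?_
    · rw [Complex.neg_re, stableExponent_re]
      have : 0 ≤ σ ^ α * |t| ^ α := by positivity
      linarith
    · rw [norm_neg]
      refine (norm_stableExponent_le hα _ _ _).trans ?_
      rw [abs_of_nonneg (by positivity : 0 ≤ σ ^ α)]
      refine mul_le_mul_of_nonneg_left ?_ (by positivity)
      exact Real.rpow_le_rpow (abs_nonneg _) ht' (by linarith)
  have h2 := intervalIntegral.norm_integral_le_of_norm_le_const hb
  refine (mul_le_mul_of_nonneg_left h2 (by positivity)).trans (le_of_eq ?_)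
  have e1 : |2 * r⁻¹ - -2 * r⁻¹| = 4 * r⁻¹ := by
    rw [show 2 * r⁻¹ - -2 * r⁻¹ = 4 * r⁻¹ by ring, abs_of_pos (by positivity)]
  rw [e1, Real.mul_rpow (by norm_num) (by positivity), Real.inv_rpow hr0.le, Real.rpow_neg hr0.le]
  field_simp

theorem IsStableLaw.eq {α σ β : ℝ} {μ ν : Measure ℝ} (hμ : IsStableLaw α σ β μ)
    (hν : IsStableLaw α σ β ν) : μ = ν := by
  have := hμ.isProbabilityMeasure
  have := hν.isProbabilityMeasure
  exact Measure.ext_of_charFun (funext fun t => by rw [hμ.charFun_eq, hν.charFun_eq])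

theorem IsStableLaw.map_mul {α σ β r : ℝ} {ρ : Measure ℝ} (h : IsStableLaw α σ β ρ)
    (hσ : 0 ≤ σ) (hr : 0 < r) : IsStableLaw α (r * σ) β (ρ.map (r * ·)) := by
  have := h.isProbabilityMeasure
  refine ⟨Measure.isProbabilityMeasure_map (by fun_prop), fun t => ?_⟩
  have hs : Real.sign (r * t) = Real.sign t := by
    rcases lt_trichotomy t 0 with ht | rfl | ht
    · rw [Real.sign_of_neg ht, Real.sign_of_neg (mul_neg_of_pos_of_neg hr ht)]
    · simp
    · rw [Real.sign_of_pos ht, Real.sign_of_pos (mul_pos hr ht)]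
  rw [charFun_map_mul, h.charFun_eq, abs_mul, abs_of_pos hr, Real.mul_rpow hr.le (abs_nonneg t),
    Real.mul_rpow hr.le hσ, hs]
  congr 2
  push_cast
  ring

/-- Strict stability: `r Y + s Y'` has the law of `(r^α + s^α)^(1/α) Y`. -/
theorem IsStableLaw.conv_map_mul {α σ β r s : ℝ} {ρ : Measure ℝ} (h : IsStableLaw α σ β ρ)
    (hα : 0 < α) (hσ : 0 ≤ σ) (hr : 0 < r) (hs : 0 < s) :
    (ρ.map (r * ·)) ∗ (ρ.map (s * ·)) = ρ.map ((r ^ α + s ^ α) ^ (1 / α) * ·) := by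
  have := h.isProbabilityMeasure
  have h1 := h.map_mul hσ hr
  have h2 := h.map_mul hσ hs
  have h3 := h.map_mul hσ (r := (r ^ α + s ^ α) ^ (1 / α)) (by positivity)
  have := h1.isProbabilityMeasure
  have := h2.isProbabilityMeasure
  have := h3.isProbabilityMeasure
  refine Measure.ext_of_charFun (funext fun t => ?_)
  rw [charFun_conv, h1.charFun_eq, h2.charFun_eq, h3.charFun_eq, ← Complex.exp_add, ← add_mul,
    Real.mul_rpow hr.le hσ, Real.mul_rpow hs.le hσ, Real.mul_rpow (by positivity) hσ,
    ← Real.rpow_mul (by positivity), one_div, inv_mul_cancel₀ hα.ne', Real.rpow_one]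
  congr 2
  push_cast
  ring

theorem IsStableLaw.integral_integral_comp_add {α σ β r s : ℝ} {ρ : Measure ℝ}
    (h : IsStableLaw α σ β ρ) (hα : 0 < α) (hσ : 0 ≤ σ) (hr : 0 < r) (hs : 0 < s)
    {f : ℝ → ℝ} (hf : Continuous f)
    (hi : Integrable (fun y => f ((r ^ α + s ^ α) ^ (1 / α) * y)) ρ) :
    ∫ y, f ((r ^ α + s ^ α) ^ (1 / α) * y) ∂ρ = ∫ x, ∫ y, f (r * x + s * y) ∂ρ ∂ρ := by
  have := h.isProbabilityMeasure
  have e0 : (ρ.map (r * ·)) ∗ (ρ.map (s * ·)) =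
      (ρ.prod ρ).map (fun p => r * p.1 + s * p.2) := by
    rw [Measure.conv, Measure.map_prod_map _ _ (by fun_prop) (by fun_prop),
      Measure.map_map (by fun_prop) (by fun_prop)]
    rfl
  have e1 := h.conv_map_mul hα hσ hr hs
  rw [e0] at e1
  have i1 : Integrable (fun p : ℝ × ℝ => f (r * p.1 + s * p.2)) (ρ.prod ρ) := by
    have i2 : Integrable f (ρ.map ((r ^ α + s ^ α) ^ (1 / α) * ·)) :=
      (integrable_map_measure hf.aestronglyMeasurable (by fun_prop)).2 hi
    rw [← e1] at i2
    exact (integrable_map_measure hf.aestronglyMeasurable (by fun_prop)).1 i2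
  rw [← integral_map (φ := ((r ^ α + s ^ α) ^ (1 / α) * ·)) (by fun_prop) hf.aestronglyMeasurable,
    ← e1, integral_map (by fun_prop) hf.aestronglyMeasurable, integral_prod _ i1]

/-- Y + Y' has the law of 2^(1/α) Y, so the mean m satisfies 2 m = 2^(1/α) m, while 2^(1/α) < 2. -/
theorem IsStableLaw.integral_eq_zero {α σ β : ℝ} {ρ : Measure ℝ} (h : IsStableLaw α σ β ρ)
    (hα : 1 < α) (hσ : 0 < σ) : ∫ y, y ∂ρ = 0 := by
  have := h.isProbabilityMeasure
  have hi := h.integrable hα hσ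
  have e := h.integral_integral_comp_add (by linarith) hσ.le one_pos one_pos continuous_id
    (hi.const_mul _)
  simp only [id, one_mul, Real.one_rpow] at e
  have e2 : ∫ x, ∫ y, (x + y) ∂ρ ∂ρ = 2 * ∫ y, y ∂ρ := by
    have : ∀ x : ℝ, ∫ y, (x + y) ∂ρ = x + ∫ y, y ∂ρ := fun x => by
      rw [integral_add (integrable_const _) hi]; simp
    simp_rw [this]
    rw [integral_add hi (integrable_const _)]
    simp
    ring
  rw [e2, integral_const_mul] at e
  have hlt : (1 + 1 : ℝ) ^ (1 / α) < 2 := by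
    have : (1 + 1 : ℝ) ^ (1 / α) < (1 + 1 : ℝ) ^ (1 : ℝ) :=
      Real.rpow_lt_rpow_of_exponent_lt (by norm_num) (by rw [div_lt_one (by linarith)]; exact hα)
    rw [Real.rpow_one] at this
    linarith
  have : ((1 + 1 : ℝ) ^ (1 / α) - 2) * ∫ y, y ∂ρ = 0 := by linarith
  rcases mul_eq_zero.1 this with h | h
  · linarith
  · exact h

/-! ### Lipschitz and second-difference bounds, and mollification -/

/-- `f` is Lipschitz with constant `B`. -/
def LipBound (B : ℝ) (f : ℝ → ℝ) : Prop := ∀ x y, |f x - f y| ≤ B * |x - y|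

/-- The second differences of `f` are bounded by `M |a| |b|`. -/
def SecondDiffBound (M : ℝ) (f : ℝ → ℝ) : Prop :=
  ∀ x a b, |f (x + a + b) - f (x + a) - f (x + b) + f x| ≤ M * |a| * |b|

theorem LipBound.continuous {B : ℝ} {f : ℝ → ℝ} (h : LipBound B f) : Continuous f :=
  (LipschitzWith.of_dist_le' (K := B) fun x y => h x y).continuous

theorem LipBound.nonneg {B : ℝ} {f : ℝ → ℝ} (h : LipBound B f) : 0 ≤ B := by
  have := (abs_nonneg _).trans (h 1 0)
  simpa using this

theorem SecondDiffBound.nonneg {B : ℝ} {f : ℝ → ℝ} (h : SecondDiffBound B f) : 0 ≤ B := by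
  have := (abs_nonneg _).trans (h 0 1 1)
  simpa using this

theorem LipBound.integrable_comp {B : ℝ} {f : ℝ → ℝ} (h : LipBound B f) {Ω : Type*}
    [MeasurableSpace Ω] {P : Measure Ω} [IsFiniteMeasure P] {Z : Ω → ℝ} (hZ : Integrable Z P) :
    Integrable (fun w => f (Z w)) P := by
  refine ((integrable_const |f 0|).add (hZ.norm.const_mul B)).mono'
    (h.continuous.comp_aestronglyMeasurable hZ.aestronglyMeasurable)
    (Eventually.of_forall fun w => ?_)
  have h1 := h (Z w) 0
  rw [sub_zero] at h1
  have h2 := abs_sub_abs_le_abs_sub (f (Z w)) (f 0)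
  simp only [Pi.add_apply, Real.norm_eq_abs]
  linarith

theorem LipBound.comp_affine {B : ℝ} {f : ℝ → ℝ} (h : LipBound B f) (x t : ℝ) :
    LipBound (B * |t|) (fun y => f (x + t * y)) := fun y z => by
  refine (h _ _).trans (le_of_eq ?_)
  rw [mul_assoc, ← abs_mul]
  ring_nf

theorem SecondDiffBound.comp_affine {M : ℝ} {f : ℝ → ℝ} (h : SecondDiffBound M f) (x t : ℝ) :
    SecondDiffBound (M * t ^ 2) (fun y => f (x + t * y)) := fun y a b => by
  have := h (x + t * y) (t * a) (t * b)
  rw [abs_mul, abs_mul] at this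
  rw [← sq_abs t]
  ring_nf at this ⊢
  exact this

theorem integral_secondDiff {Ω : Type*} [MeasurableSpace Ω] {P : Measure Ω} {f₁ f₂ f₃ f₄ : Ω → ℝ}
    (h₁ : Integrable f₁ P) (h₂ : Integrable f₂ P) (h₃ : Integrable f₃ P) (h₄ : Integrable f₄ P) :
    ∫ w, (f₁ w - f₂ w - f₃ w + f₄ w) ∂P =
      ∫ w, f₁ w ∂P - ∫ w, f₂ w ∂P - ∫ w, f₃ w ∂P + ∫ w, f₄ w ∂P := by
  have e1 : Integrable (fun w => f₁ w - f₂ w) P := h₁.sub h₂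
  have e2 : Integrable (fun w => f₁ w - f₂ w - f₃ w) P := e1.sub h₃
  rw [integral_add e2 h₄, integral_sub e1 h₃, integral_sub h₁ h₂]

theorem LipBound.integral {Ω : Type*} [MeasurableSpace Ω] {P : Measure Ω} [IsProbabilityMeasure P]
    {B : ℝ} {F : ℝ → Ω → ℝ} (hi : ∀ x, Integrable (F x) P) (h : ∀ w, LipBound B (fun x => F x w)) :
    LipBound B (fun x => ∫ w, F x w ∂P) := fun x y => by
  rw [← integral_sub (hi x) (hi y)]
  have := norm_integral_le_of_norm_le_const (μ := P) (f := fun w => F x w - F y w)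
    (Eventually.of_forall fun w => h w x y)
  simpa using this

theorem SecondDiffBound.integral {Ω : Type*} [MeasurableSpace Ω] {P : Measure Ω}
    [IsProbabilityMeasure P] {M : ℝ} {F : ℝ → Ω → ℝ} (hi : ∀ x, Integrable (F x) P)
    (h : ∀ w, SecondDiffBound M (fun x => F x w)) :
    SecondDiffBound M (fun x => ∫ w, F x w ∂P) := fun x a b => by
  rw [← integral_secondDiff (hi _) (hi _) (hi _) (hi _)]
  have := norm_integral_le_of_norm_le_const (μ := P)
    (f := fun w => F (x + a + b) w - F (x + a) w - F (x + b) w + F x w)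
    (Eventually.of_forall fun w => h w x a b)
  simpa using this

/-- Convolution with a bump averages translates of f, and both kinds of bound survive translation
and averaging. One g serves every M. -/
theorem LipBound.exists_smooth {B : ℝ} {f : ℝ → ℝ} (h : LipBound B f) {δ : ℝ} (hδ : 0 < δ) :
    ∃ g : ℝ → ℝ, ContDiff ℝ ∞ g ∧ LipBound B g ∧ (∀ x, |g x - f x| ≤ B * δ) ∧
      ∀ M, SecondDiffBound M f → SecondDiffBound M g := by
  let φ : ContDiffBump (0 : ℝ) := ⟨δ / 2, δ, half_pos hδ, half_lt_self hδ⟩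
  set ψ := φ.normed volume
  let P : Measure ℝ := volume.withDensity (fun t => ENNReal.ofReal (ψ t))
  have hψ0 : ∀ t, 0 ≤ ψ t := fun t => φ.nonneg_normed t
  have hψc : Continuous ψ := φ.continuous_normed
  have hψi : Integrable ψ := φ.integrable_normed
  have hP : IsProbabilityMeasure P := ⟨by
    rw [withDensity_apply _ MeasurableSet.univ, Measure.restrict_univ,
      ← ofReal_integral_eq_lintegral_ofReal hψi (Eventually.of_forall hψ0), φ.integral_normed]
    simp⟩
  have hint : ∀ F : ℝ → ℝ, ∫ t, F t ∂P = ∫ t, ψ t * F t := fun F => by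
    rw [integral_withDensity_eq_integral_toReal_smul (by fun_prop) (by simp)]
    simp [ENNReal.toReal_ofReal (hψ0 _)]
  have hi : ∀ x, Integrable (fun t => f (x - t)) P := fun x => by
    rw [integrable_withDensity_iff_integrable_smul' (by fun_prop) (by simp)]
    simp only [ENNReal.toReal_ofReal (hψ0 _), smul_eq_mul]
    exact (hψc.mul (h.continuous.comp (continuous_const.sub continuous_id))).integrable_of_hasCompactSupport
      (φ.hasCompactSupport_normed.mul_right)
  have hg : (fun x => ∫ t, f (x - t) ∂P) =
      MeasureTheory.convolution ψ f (ContinuousLinearMap.lsmul ℝ ℝ) volume := by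
    funext x
    rw [hint]
    rfl
  refine ⟨fun x => ∫ t, f (x - t) ∂P, ?_, ?_, fun x => ?_, fun M hM => ?_⟩
  · rw [hg]
    exact φ.hasCompactSupport_normed.contDiff_convolution_left _ φ.contDiff_normed
      h.continuous.locallyIntegrable
  · exact LipBound.integral hi fun t x y => by
      refine (h _ _).trans (le_of_eq ?_)
      ring_nf
  · rw [← Real.dist_eq, hg]
    refine φ.dist_normed_convolution_le h.continuous.aestronglyMeasurable fun y hy => ?_
    refine (h y x).trans (mul_le_mul_of_nonneg_left ?_ h.nonneg)
    exact (le_of_lt hy)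
  · exact SecondDiffBound.integral hi fun t x a b => by
      have := hM (x - t) a b
      ring_nf at this ⊢
      exact this

theorem LipBound.abs_deriv_le {B : ℝ} {f : ℝ → ℝ} (h : LipBound B f) (x : ℝ) :
    |deriv f x| ≤ B := by
  rw [← Real.norm_eq_abs]
  exact norm_deriv_le_of_lip' h.nonneg (Eventually.of_forall fun y => h y x)

theorem lipBound_of_abs_deriv_le {B : ℝ} {f : ℝ → ℝ} (hd : Differentiable ℝ f)
    (h : ∀ x, |deriv f x| ≤ B) : LipBound B f := fun x y => by
  exact convex_univ.norm_image_sub_le_of_norm_deriv_le (fun z _ => hd z)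
    (fun z _ => h z) (Set.mem_univ y) (Set.mem_univ x)

/-- Second differences need no differentiability and pass to averages. For differentiable functions,
this lemma and its converse below identify the bound with a Lipschitz bound on the derivative. -/
theorem SecondDiffBound.lipBound_deriv {M : ℝ} {f : ℝ → ℝ} (h : SecondDiffBound M f)
    (hd : Differentiable ℝ f) : LipBound M (deriv f) := fun x y => by
  have h1 : HasDerivAt (fun z => f (x + z) - f (y + z)) (deriv f x - deriv f y) 0 := by
    have e1 : HasDerivAt (fun z => f (x + z)) (deriv f x) 0 := by
      have := (hd (x + 0)).hasDerivAt.comp_const_add x 0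
      simpa using this
    have e2 : HasDerivAt (fun z => f (y + z)) (deriv f y) 0 := by
      have := (hd (y + 0)).hasDerivAt.comp_const_add y 0
      simpa using this
    exact e1.sub e2
  refine h1.le_of_lip' (mul_nonneg h.nonneg (abs_nonneg _)) (Eventually.of_forall fun z => ?_)
  have := h y (x - y) z
  simp only [Real.norm_eq_abs, add_zero, sub_zero]
  refine le_of_eq_of_le ?_ this
  congr 1
  ring_nf

theorem secondDiffBound_of_lipBound_deriv {M : ℝ} {f : ℝ → ℝ} (hd : Differentiable ℝ f)
    (h : LipBound M (deriv f)) : SecondDiffBound M f := fun x a b => by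
  have h1 : LipBound (M * |a|) (fun z => f (x + a + z) - f (x + z)) := by
    refine lipBound_of_abs_deriv_le (by fun_prop) fun z => ?_
    have e : deriv (fun z => f (x + a + z) - f (x + z)) z = deriv f (x + a + z) - deriv f (x + z) :=
      (((hd _).hasDerivAt.comp_const_add (x + a) z).sub
        ((hd _).hasDerivAt.comp_const_add x z)).deriv
    rw [e]
    refine (h _ _).trans (le_of_eq ?_)
    ring_nf
  have := h1 b 0
  simp only [add_zero, sub_zero] at this
  refine le_of_eq_of_le ?_ this
  congr 1
  ring

/-! ### Smoothing by a stable average -/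

/-- Truncation reduces the claim to Schwartz functions without enlarging B, as the cutoff is at most
1 in absolute value. The bound D only serves to dominate the passage to the limit and does not enter
the estimate. -/
theorem IsStableLaw.exists_abs_integral_deriv_le {α σ β : ℝ} {ρ : Measure ℝ}
    (h : IsStableLaw α σ β ρ) (hα : 1 < α) (hσ : 0 < σ) :
    ∃ C : ℝ, 0 ≤ C ∧ ∀ (g : ℝ → ℝ) (B D : ℝ), ContDiff ℝ ∞ g → (∀ x, |g x| ≤ B) →
      (∀ x, |deriv g x| ≤ D) → |∫ y, deriv g y ∂ρ| ≤ C * B := by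
  have := h.isProbabilityMeasure
  obtain ⟨C, hC, hS⟩ := h.exists_norm_integral_deriv_schwartz_le hα hσ
  obtain ⟨χ, K, hχ, hK, hχ1, hχ2, hχb, hχd, -⟩ := exists_smooth_cutoff
  refine ⟨C, hC, fun g B D hg hB hD => ?_⟩
  have hB0 : 0 ≤ B := (abs_nonneg _).trans (hB 0)
  have hD0 : 0 ≤ D := (abs_nonneg _).trans (hD 0)
  let G : ℕ → ℝ → ℝ := fun N x => g x * χ (x / (N + 1))
  have hG : ∀ N, ContDiff ℝ ∞ (G N) := fun N =>
    hg.mul (hχ.comp (contDiff_id.div_const _))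
  have hGd : ∀ N x, deriv (G N) x =
      deriv g x * χ (x / (N + 1)) + g x * (deriv χ (x / (N + 1)) / (N + 1)) := fun N x =>
    (hasDerivAt_mul_cutoff (hχ.differentiable (by simp)) (hg.differentiable (by simp)) _ x).deriv
  have hGc : ∀ N, HasCompactSupport (G N) := fun N =>
    hasCompactSupport_mul_cutoff hχ2 g (by positivity)
  have hbd : ∀ N, |∫ y, deriv (G N) y ∂ρ| ≤ C * B := fun N => by
    have hsm : ContDiff ℝ ∞ (fun x => (G N x : ℂ)) := Complex.ofRealCLM.contDiff.comp (hG N)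
    have hcs : HasCompactSupport (fun x => (G N x : ℂ)) :=
      (hGc N).comp_left (g := Complex.ofReal) (by simp)
    have := hS (hcs.toSchwartzMap hsm) B (fun x => by
      change ‖((g x * χ (x / (N + 1)) : ℝ) : ℂ)‖ ≤ B
      rw [Complex.norm_real, norm_mul]
      exact (mul_le_mul (hB x) (hχb _) (abs_nonneg _) hB0).trans (by rw [mul_one]))
    have e : ∀ y, deriv (hcs.toSchwartzMap hsm) y = ((deriv (G N) y : ℝ) : ℂ) := fun y =>
      ((hG N).differentiable (by simp) y).hasDerivAt.ofReal_comp.deriv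
    simp_rw [e] at this
    rwa [integral_complex_ofReal, Complex.norm_real] at this
  have hlim : Tendsto (fun N : ℕ => ∫ y, deriv (G N) y ∂ρ) atTop (𝓝 (∫ y, deriv g y ∂ρ)) := by
    refine tendsto_integral_of_dominated_convergence (fun _ => D + B * K) (fun N => ?_)
      (integrable_const _) (fun N => Eventually.of_forall fun x => ?_)
      (Eventually.of_forall fun x => ?_)
    · exact (contDiff_infty_iff_deriv.1 (hG N)).2.continuous.aestronglyMeasurable
    · rw [hGd]
      refine (norm_add_le _ _).trans (add_le_add ?_ ?_)
      · rw [norm_mul]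
        exact (mul_le_mul (hD x) (hχb _) (abs_nonneg _) hD0).trans (by rw [mul_one])
      · rw [norm_mul]
        refine mul_le_mul (hB x) ?_ (norm_nonneg _) hB0
        rw [norm_div]
        refine (div_le_self (norm_nonneg _) ?_).trans ((le_mul_of_one_le_left (abs_nonneg _)
          (by linarith [abs_nonneg (x / (N + 1))])).trans (hχd _))
        rw [Real.norm_of_nonneg (by positivity)]
        simp
    · refine tendsto_const_nhds.congr' ?_
      filter_upwards [eventuallyEq_mul_cutoff hχ1 g x] with N hN
      exact (EventuallyEq.deriv_eq hN).symm
  exact le_of_tendsto hlim.abs (Eventually.of_forall hbd)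

/-- Averaging a `1`-Lipschitz function against a stable law of scale `t` bounds its second
differences by a multiple of `1 / t`. -/
theorem IsStableLaw.exists_secondDiffBound {α σ β : ℝ} {ρ : Measure ℝ}
    (h : IsStableLaw α σ β ρ) (hα : 1 < α) (hσ : 0 < σ) :
    ∃ C : ℝ, 0 ≤ C ∧ ∀ (f : ℝ → ℝ) (t : ℝ), LipBound 1 f → 0 < t →
      SecondDiffBound (C / t) (fun x => ∫ y, f (x + t * y) ∂ρ) := by
  have := h.isProbabilityMeasure
  have hid := h.integrable hα hσ
  obtain ⟨C, hC, hS⟩ := h.exists_abs_integral_deriv_le hα hσ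
  have hint : ∀ (f : ℝ → ℝ) (t x : ℝ), LipBound 1 f → Integrable (fun y => f (x + t * y)) ρ :=
    fun f t x hf => LipBound.integrable_comp (hf.comp_affine x t) hid
  have smooth : ∀ (f : ℝ → ℝ) (t : ℝ), ContDiff ℝ ∞ f → LipBound 1 f → 0 < t →
      SecondDiffBound (C / t) (fun x => ∫ y, f (x + t * y) ∂ρ) := by
    intro f t hsm hf ht x a b
    -- The second difference of f with increments a and b is the increment of q by b.
    let q : ℝ → ℝ := fun u => f (u + a) - f u
    have hqs : ContDiff ℝ ∞ q := (hsm.comp (contDiff_id.add contDiff_const)).sub hsm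
    have hqc : Continuous q := hqs.continuous
    have hq : ∀ u, |q u| ≤ |a| := fun u => by
      have := hf (u + a) u
      simpa using this
    let Q : ℝ → ℝ := fun v => ∫ u in (0 : ℝ)..v, q u
    have hQ : ∀ v, HasDerivAt Q (q v) v := fun v => hqc.integral_hasStrictDerivAt 0 v |>.hasDerivAt
    have hQs : ContDiff ℝ ∞ Q := contDiff_infty_iff_deriv.2
      ⟨fun v => (hQ v).differentiableAt, by rwa [show deriv Q = q from funext fun v => (hQ v).deriv]⟩
    -- A function of y whose derivative is the second difference of f at x + t y. It is an integral
    -- of q over an interval of length |b|, divided by t, so |q| ≤ |a| gives |g| ≤ |a| |b| / t; this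
    -- is the gain 1/t from averaging at scale t.
    let g : ℝ → ℝ := fun y => 1 / t * (Q (x + b + t * y) - Q (x + t * y))
    have hgd : ∀ y, HasDerivAt g (q (x + b + t * y) - q (x + t * y)) y := fun y => by
      have e1 : ∀ z, HasDerivAt (fun y => z + t * y) t y := fun z => by
        simpa using ((hasDerivAt_id y).const_mul t).const_add z
      have := (((hQ (x + b + t * y)).comp y (e1 (x + b))).sub
        ((hQ (x + t * y)).comp y (e1 x))).const_mul (1 / t)
      convert! this using 1
      field_simp
    have hgs : ContDiff ℝ ∞ g := by
      refine contDiff_const.mul ((hQs.comp ?_).sub (hQs.comp ?_)) <;> fun_prop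
    have hgb : ∀ y, |g y| ≤ |a| * |b| / t := fun y => by
      have e : Q (x + b + t * y) - Q (x + t * y) = ∫ u in (x + t * y)..(x + b + t * y), q u :=
        intervalIntegral.integral_interval_sub_left (hqc.intervalIntegrable _ _)
          (hqc.intervalIntegrable _ _)
      have e2 := intervalIntegral.norm_integral_le_of_norm_le_const (a := x + t * y) (f := q)
        (b := x + b + t * y) (C := |a|) (fun u _ => hq u)
      rw [show x + b + t * y - (x + t * y) = b by ring, ← e] at e2
      simp only [g, abs_mul, abs_of_pos (one_div_pos.2 ht)]
      rw [one_div, inv_mul_eq_div]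
      exact div_le_div_of_nonneg_right e2 ht.le
    have key := hS g (|a| * |b| / t) (2 * |a|) hgs hgb (fun y => by
      rw [(hgd y).deriv]
      refine (abs_sub _ _).trans ?_
      linarith [hq (x + b + t * y), hq (x + t * y)])
    have e : ∫ y, deriv g y ∂ρ = ∫ y, f (x + a + b + t * y) ∂ρ - ∫ y, f (x + a + t * y) ∂ρ -
        ∫ y, f (x + b + t * y) ∂ρ + ∫ y, f (x + t * y) ∂ρ := by
      rw [← integral_secondDiff (hint _ _ _ hf) (hint _ _ _ hf) (hint _ _ _ hf) (hint _ _ _ hf)]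
      refine integral_congr_ae (Eventually.of_forall fun y => ?_)
      simp only [(hgd y).deriv, q]
      ring_nf
    rw [← e]
    refine key.trans (le_of_eq ?_)
    ring
  refine ⟨C, hC, fun f t hf ht x a b => ?_⟩
  refine le_of_forall_pos_le_add fun δ hδ => ?_
  -- The error δ / 4 is used four times, once for each point of the second difference.
  obtain ⟨g, hgs, hgl, hgf, -⟩ := hf.exists_smooth (δ := δ / 4) (by positivity)
  have h1 := smooth g t hgs hgl ht x a b
  have h2 : ∀ z, |(∫ y, f (z + t * y) ∂ρ) - ∫ y, g (z + t * y) ∂ρ| ≤ δ / 4 := fun z => by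
    rw [← integral_sub (hint _ _ _ hf) (hint _ _ _ hgl)]
    have := norm_integral_le_of_norm_le_const (μ := ρ)
      (f := fun y => f (z + t * y) - g (z + t * y)) (C := δ / 4)
      (Eventually.of_forall fun y => by
        rw [Real.norm_eq_abs, abs_sub_comm]; simpa using hgf (z + t * y))
    simpa using this
  have a1 := abs_le.1 (h2 (x + a + b))
  have a2 := abs_le.1 (h2 (x + a))
  have a3 := abs_le.1 (h2 (x + b))
  have a4 := abs_le.1 (h2 x)
  have a5 := abs_le.1 h1
  rw [abs_le]
  constructor <;> linarith [a1.1, a1.2, a2.1, a2.2, a3.1, a3.2, a4.1, a4.2, a5.1, a5.2]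

/-! ### The Gamma integrals behind the scale constant -/

theorem integrableOn_min_rpow_mul_rpow {p q : ℝ} (hp : 0 < p) (hq : p < q) :
    IntegrableOn (fun y : ℝ => min 1 (y ^ q) * y ^ (-p - 1)) (Set.Ioi 0) := by
  rw [← Set.Ioc_union_Ioi_eq_Ioi (zero_le_one' ℝ)]
  have hm : ∀ s : Set ℝ, AEStronglyMeasurable (fun y : ℝ => min 1 (y ^ q) * y ^ (-p - 1))
      (volume.restrict s) := fun s => by fun_prop
  refine IntegrableOn.union ?_ ?_
  · have h : IntegrableOn (fun y : ℝ => y ^ (q - p - 1)) (Set.Ioc 0 1) := by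
      rw [← intervalIntegrable_iff_integrableOn_Ioc_of_le zero_le_one]
      exact intervalIntegral.intervalIntegrable_rpow' (by linarith)
    refine h.mono' (hm _) ((ae_restrict_mem measurableSet_Ioc).mono fun y hy => ?_)
    have hy0 : 0 < y := hy.1
    rw [Real.norm_of_nonneg (by positivity), show q - p - 1 = q + (-p - 1) by ring,
      Real.rpow_add hy0]
    exact mul_le_mul_of_nonneg_right (min_le_right _ _) (by positivity)
  · have h : IntegrableOn (fun y : ℝ => y ^ (-p - 1)) (Set.Ioi 1) :=
      integrableOn_Ioi_rpow_of_lt (by linarith) one_pos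
    refine h.mono' (hm _) ((ae_restrict_mem measurableSet_Ioi).mono fun y hy => ?_)
    have hy0 : 0 < y := one_pos.trans hy
    rw [Real.norm_of_nonneg (by positivity)]
    exact mul_le_of_le_one_left (by positivity) (min_le_left _ _)

/-- Integration by parts with the primitive -y^(-p)/p. The bound D min(1, y^q) with q > p > 0 kills
the boundary term at 0 through y^(q-p) and at infinity through y^(-p). -/
theorem integral_mul_rpow_eq_integral_deriv_mul_rpow {F F' : ℝ → ℂ} {p q D : ℝ} (hp : 0 < p)
    (hq : p < q) (hF : ∀ y, HasDerivAt F (F' y) y)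
    (hb : ∀ y, 0 < y → ‖F y‖ ≤ D * min 1 (y ^ q))
    (hi : IntegrableOn (fun y : ℝ => F' y * ((y ^ (-p) : ℝ) : ℂ)) (Set.Ioi 0)) :
    ∫ y in Set.Ioi (0 : ℝ), F y * ((y ^ (-p - 1) : ℝ) : ℂ) =
      (1 / p : ℝ) * ∫ y in Set.Ioi (0 : ℝ), F' y * ((y ^ (-p) : ℝ) : ℂ) := by
  have hD : 0 ≤ D := by
    have := (norm_nonneg _).trans (hb 1 one_pos)
    simpa using this
  let v : ℝ → ℂ := fun y => ((-(1 / p) * y ^ (-p) : ℝ) : ℂ)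
  have hv : ∀ y ∈ Set.Ioi (0 : ℝ), HasDerivAt v ((y ^ (-p - 1) : ℝ) : ℂ) y := by
    intro y hy
    have h := ((Real.hasDerivAt_rpow_const (x := y) (p := -p)
      (Or.inl (ne_of_gt hy))).const_mul (-(1 / p))).ofReal_comp
    convert! h using 2
    field_simp
  have hFc : Continuous F := continuous_iff_continuousAt.2 fun y => (hF y).continuousAt
  have i1 : IntegrableOn (F * fun y : ℝ => ((y ^ (-p - 1) : ℝ) : ℂ)) (Set.Ioi 0) := by
    refine ((integrableOn_min_rpow_mul_rpow hp hq).const_mul D).mono' ?_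
      ((ae_restrict_mem measurableSet_Ioi).mono fun y hy => ?_)
    · exact (hFc.measurable.mul (by fun_prop)).aestronglyMeasurable
    · have hy0 : (0 : ℝ) < y := hy
      rw [Pi.mul_apply, norm_mul, Complex.norm_real, Real.norm_of_nonneg (by positivity),
        ← mul_assoc]
      exact mul_le_mul_of_nonneg_right (hb y hy) (by positivity)
  have i2 : IntegrableOn (F' * v) (Set.Ioi 0) := by
    refine (hi.const_mul (-(1 / p) : ℝ)).congr (Eventually.of_forall fun y => ?_)
    simp only [Pi.mul_apply, v]
    push_cast
    ring
  have hbound : ∀ y, 0 < y → ‖(F * v) y‖ ≤ D / p * min (y ^ (-p)) (y ^ (q - p)) := fun y hy => by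
    have e : ‖v y‖ = 1 / p * y ^ (-p) := by
      simp only [v]
      rw [Complex.norm_real, norm_mul, norm_neg, Real.norm_of_nonneg (by positivity),
        Real.norm_of_nonneg (by positivity)]
    rw [Pi.mul_apply, norm_mul, e]
    refine (mul_le_mul_of_nonneg_right (hb y hy) (by positivity)).trans (le_of_eq ?_)
    rw [sub_eq_add_neg, Real.rpow_add hy]
    rcases le_total 1 (y ^ q) with h | h
    · rw [min_eq_left h, min_eq_left]
      · ring
      · exact le_mul_of_one_le_left (by positivity) h
    · rw [min_eq_right h, min_eq_right]
      · ring
      · exact mul_le_of_le_one_left (by positivity) h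
  have t0 : Tendsto (F * v) (𝓝[>] 0) (𝓝 0) := by
    refine squeeze_zero_norm' (a := fun y => D / p * y ^ (q - p)) ?_ ?_
    · filter_upwards [self_mem_nhdsWithin] with y hy
      exact (hbound y hy).trans (mul_le_mul_of_nonneg_left (min_le_right _ _) (by positivity))
    · have : ContinuousAt (fun y : ℝ => D / p * y ^ (q - p)) 0 :=
        continuousAt_const.mul (Real.continuousAt_rpow_const _ _ (Or.inr (by linarith)))
      have := this.tendsto.mono_left (nhdsWithin_le_nhds (s := Set.Ioi 0))
      simpa [Real.zero_rpow (by linarith : q - p ≠ 0)] using this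
  have t1 : Tendsto (F * v) atTop (𝓝 0) := by
    refine squeeze_zero_norm' (a := fun y => D / p * y ^ (-p)) ?_ ?_
    · filter_upwards [eventually_gt_atTop 0] with y hy
      exact (hbound y hy).trans (mul_le_mul_of_nonneg_left (min_le_left _ _) (by positivity))
    · simpa using (tendsto_rpow_neg_atTop hp).const_mul (D / p)
  have key := integral_Ioi_mul_deriv_eq_deriv_mul (fun y _ => hF y) hv i1 i2 t0 t1
  refine key.trans ?_
  rw [← integral_const_mul, sub_zero, zero_sub, ← integral_neg]
  refine integral_congr_ae (Eventually.of_forall fun y => ?_)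
  simp only [v]
  push_cast
  ring

theorem Complex.norm_exp_sub_one_le_two_of_re_nonpos {z : ℂ} (hz : z.re ≤ 0) :
    ‖Complex.exp z - 1‖ ≤ 2 := by
  refine (norm_sub_le _ _).trans ?_
  have : ‖Complex.exp z‖ ≤ 1 := by rw [Complex.norm_exp]; exact Real.exp_le_one_iff.2 hz
  simp only [norm_one]
  linarith

theorem Complex.norm_exp_sub_one_le_min {z : ℂ} (hz : z.re ≤ 0) {y D : ℝ} (hD : 2 ≤ D)
    (h : ‖z‖ ≤ D * y) : ‖Complex.exp z - 1‖ ≤ D * min 1 y := by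
  rcases le_total 1 y with hy | hy
  · rw [min_eq_left hy, mul_one]
    exact (Complex.norm_exp_sub_one_le_two_of_re_nonpos hz).trans hD
  · rw [min_eq_right hy]
    exact (Complex.norm_exp_sub_one_le_of_re_nonpos hz).trans h

/-- Writing J(z) for the left side, the integral on the right is -J'(z), so this is the differential
equation z J' = (α - 1) J. -/
theorem integral_exp_neg_mul_sub_one_mul_rpow_eq {α : ℝ} (h1 : 1 < α) (h2 : α < 2) {z : ℂ}
    (hz : 0 < z.re) :
    ∫ y in Set.Ioi (0 : ℝ), (Complex.exp (-(z * y)) - 1) * ((y ^ (-α) : ℝ) : ℂ) =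
      (-(z / ((α - 1 : ℝ) : ℂ))) *
        ∫ y in Set.Ioi (0 : ℝ), Complex.exp (-(z * y)) * ((y ^ (1 - α) : ℝ) : ℂ) := by
  have hd : ∀ y : ℝ, HasDerivAt (fun y : ℝ => Complex.exp (-(z * y)) - 1)
      (Complex.exp (-(z * y)) * -z) y := fun y => by
    have := (((Complex.ofRealCLM.hasDerivAt (x := y)).const_mul z).neg.cexp).sub_const 1
    simpa using! this
  have hre : ∀ y : ℝ, 0 < y → (-(z * y)).re ≤ 0 := fun y hy => by
    simp only [Complex.neg_re, Complex.mul_re, Complex.ofReal_re, Complex.ofReal_im, mul_zero,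
      sub_zero]
    have := mul_pos hz hy
    linarith
  have hb : ∀ y : ℝ, 0 < y → ‖Complex.exp (-(z * y)) - 1‖ ≤ max 2 ‖z‖ * min 1 (y ^ (1 : ℝ)) := by
    intro y hy
    rw [Real.rpow_one]
    refine Complex.norm_exp_sub_one_le_min (hre y hy) (le_max_left _ _) ?_
    rw [norm_neg, norm_mul, Complex.norm_real, Real.norm_of_nonneg hy.le]
    exact mul_le_mul_of_nonneg_right (le_max_right _ _) hy.le
  have hi : IntegrableOn (fun y : ℝ => Complex.exp (-(z * y)) * -z * ((y ^ (-(α - 1)) : ℝ) : ℂ))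
      (Set.Ioi 0) := by
    have h := (integrableOn_rpow_mul_exp_neg_mul_rpow (p := 1) (s := -(α - 1)) (by linarith) one_pos
      hz).const_mul ‖z‖
    refine h.mono' ?_ ((ae_restrict_mem measurableSet_Ioi).mono fun y hy => ?_)
    · exact Measurable.aestronglyMeasurable (by fun_prop)
    · have hy0 : (0 : ℝ) < y := hy
      rw [norm_mul, norm_mul, Complex.norm_exp, norm_neg, Complex.norm_real,
        Real.norm_of_nonneg (by positivity), Real.rpow_one]
      simp only [Complex.neg_re, Complex.mul_re, Complex.ofReal_re, Complex.ofReal_im, mul_zero,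
        sub_zero]
      rw [neg_mul]
      linarith
  have key := integral_mul_rpow_eq_integral_deriv_mul_rpow (p := α - 1) (q := 1) (by linarith)
    (by linarith) hd hb hi
  rw [show -(α - 1) - 1 = -α by ring] at key
  rw [key]
  rw [← integral_const_mul, ← integral_const_mul]
  refine setIntegral_congr_fun measurableSet_Ioi fun y hy => ?_
  rw [show -(α - 1) = 1 - α by ring]
  push_cast
  ring

theorem hasDerivAt_integral_exp_neg_mul_sub_one_mul_rpow {α : ℝ} (h1 : 1 < α) (h2 : α < 2) {z : ℂ}
    (hz : 0 < z.re) :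
    HasDerivAt (fun z : ℂ => ∫ y in Set.Ioi (0 : ℝ),
      (Complex.exp (-(z * y)) - 1) * ((y ^ (-α) : ℝ) : ℂ))
      (-∫ y in Set.Ioi (0 : ℝ), Complex.exp (-(z * y)) * ((y ^ (1 - α) : ℝ) : ℂ)) z := by
  have hint : IntegrableOn (fun y : ℝ => (Complex.exp (-(z * y)) - 1) * ((y ^ (-α) : ℝ) : ℂ))
      (Set.Ioi 0) := by
    refine ((integrableOn_min_rpow_mul_rpow (p := α - 1) (q := 1) (by linarith)
      (by linarith)).const_mul (max 2 ‖z‖)).mono' (Measurable.aestronglyMeasurable (by fun_prop))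
      ((ae_restrict_mem measurableSet_Ioi).mono fun y hy => ?_)
    have hy0 : (0 : ℝ) < y := hy
    rw [norm_mul, Complex.norm_real, Real.norm_of_nonneg (by positivity), ← mul_assoc,
      show -(α - 1) - 1 = -α by ring, Real.rpow_one]
    refine mul_le_mul_of_nonneg_right ?_ (by positivity)
    refine Complex.norm_exp_sub_one_le_min ?_ (le_max_left _ _) ?_
    · simp
      positivity
    · rw [norm_neg, norm_mul, Complex.norm_real, Real.norm_of_nonneg hy0.le]
      exact mul_le_mul_of_nonneg_right (le_max_right _ _) hy0.le
  -- Keeping half of Re z leaves a uniform exponential decay, which dominates the derivative near z.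
  have hs : {w : ℂ | z.re / 2 < w.re} ∈ 𝓝 z :=
    (isOpen_lt continuous_const Complex.continuous_re).mem_nhds (by simp [hz])
  have key := hasDerivAt_integral_of_dominated_loc_of_deriv_le (μ := volume.restrict (Set.Ioi (0 : ℝ)))
    (F := fun (w : ℂ) (y : ℝ) => (Complex.exp (-(w * y)) - 1) * ((y ^ (-α) : ℝ) : ℂ))
    (F' := fun (w : ℂ) (y : ℝ) => Complex.exp (-(w * y)) * -y * ((y ^ (-α) : ℝ) : ℂ))
    (bound := fun y : ℝ => y ^ (1 - α) * Real.exp (-(z.re / 2) * y ^ (1 : ℝ))) (x₀ := z) hs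
    (Eventually.of_forall fun w => Measurable.aestronglyMeasurable (by fun_prop)) hint
    (Measurable.aestronglyMeasurable (by fun_prop)) ?_ ?_ ?_
  · convert! key.2 using 1
    rw [← integral_neg]
    refine setIntegral_congr_fun measurableSet_Ioi fun y hy => ?_
    have hy0 : (0 : ℝ) < y := hy
    rw [sub_eq_add_neg, Real.rpow_add hy0, Real.rpow_one]
    push_cast
    ring
  · refine (ae_restrict_mem measurableSet_Ioi).mono fun y hy w hw => ?_
    have hy0 : (0 : ℝ) < y := hy
    have hw' : z.re / 2 < w.re := hw
    rw [norm_mul, norm_mul, norm_neg, Complex.norm_real, Complex.norm_real,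
      Real.norm_of_nonneg hy0.le, Real.norm_of_nonneg (by positivity), Complex.norm_exp,
      Real.rpow_one, mul_assoc, sub_eq_add_neg, Real.rpow_add hy0, Real.rpow_one, mul_comm]
    refine mul_le_mul_of_nonneg_left (Real.exp_le_exp.2 ?_) (by positivity)
    simp only [Complex.neg_re, Complex.mul_re, Complex.ofReal_re, Complex.ofReal_im, mul_zero,
      sub_zero]
    nlinarith
  · exact integrableOn_rpow_mul_exp_neg_mul_rpow (by linarith) one_pos (by linarith)
  · refine Eventually.of_forall fun y w _ => ?_
    have := ((((hasDerivAt_id w).mul_const (y : ℂ)).neg.cexp).sub_const 1).mul_const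
      ((y ^ (-α) : ℝ) : ℂ)
    simpa using! this

/-- The constant `Γ(2 - α) / (α - 1) = -Γ(1 - α)`. -/
noncomputable def gammaConst (α : ℝ) : ℝ := Real.Gamma (2 - α) / (α - 1)

/-- The differential equation makes J(z) z^(1-α) constant on the right half-plane, and at z = 1 the
integral reduces to a Gamma value. -/
theorem integral_exp_neg_mul_sub_one_mul_rpow {α : ℝ} (h1 : 1 < α) (h2 : α < 2) {z : ℂ}
    (hz : 0 < z.re) :
    ∫ y in Set.Ioi (0 : ℝ), (Complex.exp (-(z * y)) - 1) * ((y ^ (-α) : ℝ) : ℂ) =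
      -(gammaConst α : ℂ) * z ^ ((α - 1 : ℝ) : ℂ) := by
  let J : ℂ → ℂ := fun z =>
    ∫ y in Set.Ioi (0 : ℝ), (Complex.exp (-(z * y)) - 1) * ((y ^ (-α) : ℝ) : ℂ)
  let s : Set ℂ := {w : ℂ | 0 < w.re}
  have hs : IsOpen s := isOpen_lt continuous_const Complex.continuous_re
  have hs' : IsPreconnected s := (convex_halfSpace_re_gt 0).isPreconnected
  have hα : ((α - 1 : ℝ) : ℂ) ≠ 0 := Complex.ofReal_ne_zero.2 (by linarith)
  have hd : ∀ w ∈ s, HasDerivAt (fun w => J w * w ^ (-((α - 1 : ℝ) : ℂ))) 0 w := by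
    intro w hw
    have hw0 : w ≠ 0 := by rintro rfl; simp [s] at hw
    have e1 := hasDerivAt_integral_exp_neg_mul_sub_one_mul_rpow h1 h2 hw
    have e2 := (hasDerivAt_id w).cpow_const (c := -((α - 1 : ℝ) : ℂ)) (Or.inl hw)
    have e3 := integral_exp_neg_mul_sub_one_mul_rpow_eq h1 h2 hw
    convert! e1.mul e2 using 1
    rw [e3]
    simp only [id]
    rw [Complex.cpow_sub _ _ hw0, Complex.cpow_one]
    field_simp
    ring
  have hc := hs.is_const_of_deriv_eq_zero hs' (f := fun w => J w * w ^ (-((α - 1 : ℝ) : ℂ)))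
    (fun w hw => (hd w hw).differentiableAt.differentiableWithinAt) (fun w hw => (hd w hw).deriv)
    (show z ∈ s from hz) (show (1 : ℂ) ∈ s by simp [s])
  have hJ1 : J 1 = -(gammaConst α : ℂ) := by
    have hG := Real.integral_rpow_mul_exp_neg_mul_Ioi (a := 2 - α) (r := 1) (by linarith) one_pos
    have e3 := integral_exp_neg_mul_sub_one_mul_rpow_eq h1 h2 (z := 1) (by simp)
    have e4 : ∫ y in Set.Ioi (0 : ℝ), Complex.exp (-(1 * y)) * ((y ^ (1 - α) : ℝ) : ℂ) =
        ((Real.Gamma (2 - α) : ℝ) : ℂ) := by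
      rw [one_div, inv_one, Real.one_rpow, one_mul] at hG
      rw [← hG, ← integral_complex_ofReal]
      refine setIntegral_congr_fun measurableSet_Ioi fun y hy => ?_
      rw [show 2 - α - 1 = 1 - α by ring]
      push_cast
      ring
    refine e3.trans ?_
    rw [e4, gammaConst]
    push_cast
    ring
  have hz0 : z ≠ 0 := by rintro rfl; simp at hz
  simp only [Complex.one_cpow, mul_one, hJ1] at hc
  rw [← hc, mul_assoc, ← Complex.cpow_add _ _ hz0]
  simp [J]

/-- The boundary value at z = -i of the half-plane formula, approached along z = δ - i with δ
decreasing to 0. The principal power of -i has angle -π(α - 1)/2, whence the sine and the cosine. -/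
theorem integral_exp_I_sub_one_mul_rpow {α : ℝ} (h1 : 1 < α) (h2 : α < 2) :
    ∫ y in Set.Ioi (0 : ℝ), (Complex.exp (y * Complex.I) - 1) * ((y ^ (-α) : ℝ) : ℂ) =
      -(gammaConst α * Real.sin (Real.pi * α / 2) : ℝ) -
        (gammaConst α * Real.cos (Real.pi * α / 2) : ℝ) * Complex.I := by
  have hlim1 : Tendsto (fun δ : ℝ => ∫ y in Set.Ioi (0 : ℝ),
      (Complex.exp (-((δ - Complex.I) * y)) - 1) * ((y ^ (-α) : ℝ) : ℂ)) (𝓝[>] 0)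
      (𝓝 (∫ y in Set.Ioi (0 : ℝ), (Complex.exp (y * Complex.I) - 1) * ((y ^ (-α) : ℝ) : ℂ))) := by
    refine tendsto_integral_filter_of_dominated_convergence
      (fun y : ℝ => 2 * (min 1 (y ^ (1 : ℝ)) * y ^ (-(α - 1) - 1))) ?_ ?_ ?_ ?_
    · exact Eventually.of_forall fun δ => Measurable.aestronglyMeasurable (by fun_prop)
    · have : ∀ᶠ δ : ℝ in 𝓝[>] 0, δ < 1 := nhdsWithin_le_nhds (Iio_mem_nhds one_pos)
      filter_upwards [self_mem_nhdsWithin, this] with δ hδ0 hδ1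
      have hδ0' : (0 : ℝ) < δ := hδ0
      refine (ae_restrict_mem measurableSet_Ioi).mono fun y hy => ?_
      have hy0 : (0 : ℝ) < y := hy
      rw [norm_mul, Complex.norm_real, Real.norm_of_nonneg (by positivity), ← mul_assoc,
        show -(α - 1) - 1 = -α by ring, Real.rpow_one]
      refine mul_le_mul_of_nonneg_right ?_ (by positivity)
      refine Complex.norm_exp_sub_one_le_min ?_ le_rfl ?_
      · simp
        positivity
      · rw [norm_neg, norm_mul, Complex.norm_real, Real.norm_of_nonneg hy0.le]
        refine mul_le_mul_of_nonneg_right ((norm_sub_le _ _).trans ?_) hy0.le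
        rw [Complex.norm_I, Complex.norm_real, Real.norm_of_nonneg hδ0'.le]
        linarith
    · exact (integrableOn_min_rpow_mul_rpow (by linarith) (by linarith)).const_mul 2
    · refine Eventually.of_forall fun y => ?_
      have hc : Continuous fun δ : ℝ =>
          (Complex.exp (-((δ - Complex.I) * y)) - 1) * ((y ^ (-α) : ℝ) : ℂ) := by fun_prop
      have := (hc.tendsto 0).mono_left (nhdsWithin_le_nhds (s := Set.Ioi 0))
      convert this using 2
      simp [mul_comm Complex.I]
  have hlim2 : Tendsto (fun δ : ℝ => -(gammaConst α : ℂ) *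
      ((δ : ℂ) - Complex.I) ^ ((α - 1 : ℝ) : ℂ)) (𝓝[>] 0)
      (𝓝 (-(gammaConst α : ℂ) * (-Complex.I) ^ ((α - 1 : ℝ) : ℂ))) := by
    have hc : ContinuousAt (fun δ : ℝ => -(gammaConst α : ℂ) *
        ((δ : ℂ) - Complex.I) ^ ((α - 1 : ℝ) : ℂ)) 0 := by
      refine ContinuousAt.mul continuousAt_const (ContinuousAt.cpow (by fun_prop)
        continuousAt_const ?_)
      simp [Complex.mem_slitPlane_iff]
    have := hc.tendsto.mono_left (nhdsWithin_le_nhds (s := Set.Ioi 0))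
    simpa using this
  have heq := tendsto_nhds_unique (hlim1.congr' ?_) hlim2
  · rw [heq, Complex.cpow_def_of_ne_zero (neg_ne_zero.2 Complex.I_ne_zero), Complex.log_neg_I]
    have : -(Real.pi / 2 : ℂ) * Complex.I * ((α - 1 : ℝ) : ℂ) =
        ((Real.pi / 2 - Real.pi * α / 2 : ℝ) : ℂ) * Complex.I := by
      push_cast; ring
    rw [this, Complex.exp_mul_I, ← Complex.ofReal_cos, ← Complex.ofReal_sin, Real.cos_pi_div_two_sub,
      Real.sin_pi_div_two_sub]
    push_cast
    ring
  · filter_upwards [self_mem_nhdsWithin] with δ hδ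
    exact integral_exp_neg_mul_sub_one_mul_rpow h1 h2 (by simpa using hδ)

theorem integral_exp_mul_I_sub_one_mul_rpow_neg (α u : ℝ) :
    ∫ y in Set.Ioi (0 : ℝ), (Complex.exp ((-u : ℝ) * y * Complex.I) - 1) * ((y ^ (-α) : ℝ) : ℂ) =
      (starRingEnd ℂ) (∫ y in Set.Ioi (0 : ℝ), (Complex.exp (u * y * Complex.I) - 1) *
        ((y ^ (-α) : ℝ) : ℂ)) := by
  rw [← integral_conj]
  refine integral_congr_ae (Eventually.of_forall fun y => ?_)
  simp only [map_mul, map_sub, ← Complex.exp_conj, map_one, Complex.conj_ofReal, Complex.conj_I]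
  push_cast
  ring_nf

theorem integral_exp_mul_I_sub_one_mul_rpow_pos {α u : ℝ} (hu : 0 < u) :
    ∫ y in Set.Ioi (0 : ℝ), (Complex.exp (u * y * Complex.I) - 1) * ((y ^ (-α) : ℝ) : ℂ) =
      ((u ^ (α - 1) : ℝ) : ℂ) * ∫ y in Set.Ioi (0 : ℝ), (Complex.exp (y * Complex.I) - 1) *
        ((y ^ (-α) : ℝ) : ℂ) := by
  have h := integral_comp_mul_left_Ioi' (fun y : ℝ => (Complex.exp (y * Complex.I) - 1) *
        ((y ^ (-α) : ℝ) : ℂ)) 0 hu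
  rw [mul_zero] at h
  rw [← h, ← integral_smul, ← integral_const_mul]
  refine setIntegral_congr_fun measurableSet_Ioi fun y hy => ?_
  have hy0 : (0 : ℝ) < y := hy
  have e : u * (u * y) ^ (-α) * u ^ (α - 1) = y ^ (-α) := by
    rw [Real.mul_rpow hu.le hy0.le, Real.rpow_sub_one hu.ne', Real.rpow_neg hu.le]
    have : u ^ α ≠ 0 := (Real.rpow_pos_of_pos hu _).ne'
    field_simp
  have e' := congrArg Complex.ofReal e
  push_cast at e'
  simp only [Complex.real_smul]
  push_cast
  rw [← e']
  ring

theorem integral_sin_mul_rpow {α : ℝ} (h1 : 1 < α) (h2 : α < 2) :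
    IntegrableOn (fun y : ℝ => Real.sin y * y ^ (-α)) (Set.Ioi 0) ∧
    ∫ y in Set.Ioi (0 : ℝ), Real.sin y * y ^ (-α) =
      -(gammaConst α * Real.cos (Real.pi * α / 2)) := by
  have hint : IntegrableOn (fun y : ℝ => (Complex.exp (y * Complex.I) - 1) * ((y ^ (-α) : ℝ) : ℂ))
      (Set.Ioi 0) := by
    refine ((integrableOn_min_rpow_mul_rpow (p := α - 1) (q := 1) (by linarith)
      (by linarith)).const_mul 2).mono' (Measurable.aestronglyMeasurable (by fun_prop))
      ((ae_restrict_mem measurableSet_Ioi).mono fun y hy => ?_)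
    have hy0 : (0 : ℝ) < y := hy
    rw [norm_mul, Complex.norm_real, Real.norm_of_nonneg (by positivity), ← mul_assoc,
      show -(α - 1) - 1 = -α by ring, Real.rpow_one]
    refine mul_le_mul_of_nonneg_right ?_ (by positivity)
    refine Complex.norm_exp_sub_one_le_min (by simp) le_rfl ?_
    rw [norm_mul, Complex.norm_real, Real.norm_of_nonneg hy0.le, Complex.norm_I]
    linarith
  have e : ∀ y : ℝ, RCLike.im ((Complex.exp (y * Complex.I) - 1) * ((y ^ (-α) : ℝ) : ℂ)) =
      Real.sin y * y ^ (-α) := fun y => by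
    rw [RCLike.im_eq_complex_im, Complex.im_mul_ofReal, Complex.sub_im, Complex.exp_ofReal_mul_I_im,
      Complex.one_im, sub_zero]
  refine ⟨?_, ?_⟩
  · have := Integrable.im (𝕜 := ℂ) hint
    simp only [e] at this
    exact this
  · have := integral_im (𝕜 := ℂ) hint
    simp only [e] at this
    rw [this, integral_exp_I_sub_one_mul_rpow h1 h2, RCLike.im_eq_complex_im]
    simp [-Complex.ofReal_mul, -Complex.ofReal_sin, -Complex.ofReal_cos]

theorem gammaConst_mul_cos_neg {α : ℝ} (h1 : 1 < α) (h2 : α < 2) :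
    gammaConst α * Real.cos (Real.pi * α / 2) < 0 := by
  have hG : 0 < gammaConst α := div_pos (Real.Gamma_pos_of_pos (by linarith)) (by linarith)
  refine mul_neg_of_pos_of_neg hG (Real.cos_neg_of_pi_div_two_lt_of_lt ?_ ?_) <;>
    nlinarith [Real.pi_pos]

/-- Integration by parts reduces the integral over a half-line to the sine integral; the two
half-lines contribute equally, whence the factor 2. -/
theorem integral_one_sub_cos_div_rpow {α : ℝ} (h1 : 1 < α) (h2 : α < 2) :
    α * ∫ y : ℝ, (1 - Real.cos y) / |y| ^ (1 + α) =
      -2 * (gammaConst α * Real.cos (Real.pi * α / 2)) := by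
  obtain ⟨hi, hsin⟩ := integral_sin_mul_rpow h1 h2
  have hd : ∀ y : ℝ, HasDerivAt (fun y : ℝ => ((1 - Real.cos y : ℝ) : ℂ)) ((Real.sin y : ℝ) : ℂ) y :=
    fun y => by
      have := ((Real.hasDerivAt_cos y).const_sub 1).ofReal_comp
      simpa using this
  have hb : ∀ y : ℝ, 0 < y → ‖((1 - Real.cos y : ℝ) : ℂ)‖ ≤ 2 * min 1 (y ^ (2 : ℝ)) := fun y hy => by
    have c1 := Real.one_sub_sq_div_two_le_cos (x := y)
    have c2 := Real.neg_one_le_cos y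
    have c3 := Real.cos_le_one y
    rw [Complex.norm_real, Real.norm_of_nonneg (by linarith), Real.rpow_two,
      mul_min_of_nonneg _ _ (by norm_num)]
    exact le_min (by linarith) (by nlinarith)
  have hi' : IntegrableOn (fun y : ℝ => ((Real.sin y : ℝ) : ℂ) * ((y ^ (-α) : ℝ) : ℂ)) (Set.Ioi 0) := by
    refine (Integrable.ofReal (𝕜 := ℂ) hi).congr (Eventually.of_forall fun y => ?_)
    simp
  have key := integral_mul_rpow_eq_integral_deriv_mul_rpow (p := α) (q := 2) (by linarith) h2 hd hb hi'
  simp only [← Complex.ofReal_mul] at key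
  rw [integral_complex_ofReal, integral_complex_ofReal, ← Complex.ofReal_mul, Complex.ofReal_inj,
    hsin] at key
  have habs := integral_comp_abs (f := fun y : ℝ => (1 - Real.cos y) / y ^ (1 + α))
  simp only [Real.cos_abs] at habs
  have e : ∫ y in Set.Ioi (0 : ℝ), (1 - Real.cos y) / y ^ (1 + α) =
      ∫ y in Set.Ioi (0 : ℝ), (1 - Real.cos y) * y ^ (-α - 1) := by
    refine setIntegral_congr_fun measurableSet_Ioi fun y hy => ?_
    have hy0 : (0 : ℝ) < y := hy
    rw [show -α - 1 = -(1 + α) by ring, Real.rpow_neg hy0.le, div_eq_mul_inv]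
  rw [habs, e, key]
  have : α ≠ 0 := by linarith
  field_simp

/-- The bridge between the definition of the scale by 1 - cos y and the Gamma constant produced by
the Lévy–Khintchine computation. -/
theorem stableScale_rpow {α A : ℝ} (h1 : 1 < α) (h2 : α < 2) (hA : 0 < A) :
    stableScale α A ^ α = -2 * A * (gammaConst α * Real.cos (Real.pi * α / 2)) := by
  have e := integral_one_sub_cos_div_rpow h1 h2
  have hneg := gammaConst_mul_cos_neg h1 h2
  rw [stableScale, mul_assoc, e, ← Real.rpow_mul (by nlinarith), one_div,
    inv_mul_cancel₀ (by linarith), Real.rpow_one]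
  ring

theorem stableScale_pos {α A : ℝ} (h1 : 1 < α) (h2 : α < 2) (hA : 0 < A) :
    0 < stableScale α A := by
  have e := integral_one_sub_cos_div_rpow h1 h2
  have hneg := gammaConst_mul_cos_neg h1 h2
  rw [stableScale, mul_assoc, e]
  have : 0 < A * (-2 * (gammaConst α * Real.cos (Real.pi * α / 2))) := by
    apply mul_pos hA; linarith
  positivity

/-! ### Lévy tails and the Lévy–Khintchine formula -/

/-- The signed tail function of the Lévy measure of a stable law: `A (1 + β) x^(-α)` for `x > 0`
and `-A (1 - β) |x|^(-α)` for `x < 0`. -/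
noncomputable def stableTail (α A β x : ℝ) : ℝ := A * (Real.sign x + β) * |x| ^ (-α)

theorem measurable_stableTail (α A β : ℝ) : Measurable (stableTail α A β) := by
  have : Measurable Real.sign := by
    unfold Real.sign
    exact Measurable.ite measurableSet_Iio measurable_const
      (Measurable.ite measurableSet_Ioi measurable_const measurable_const)
  unfold stableTail
  fun_prop

theorem abs_sign_add_le {β : ℝ} (hβ : β ∈ Set.Icc (-1 : ℝ) 1) (x : ℝ) :
    |Real.sign x + β| ≤ 2 := by
  rw [abs_le]
  rcases Real.sign_apply_eq x with h | h | h <;> rw [h] <;> constructor <;> linarith [hβ.1, hβ.2]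

theorem abs_stableTail_le {α A β : ℝ} (hA : 0 ≤ A) (hβ : β ∈ Set.Icc (-1 : ℝ) 1) (x : ℝ) :
    |stableTail α A β x| ≤ 2 * A * |x| ^ (-α) := by
  have h0 : 0 ≤ |x| ^ (-α) := by positivity
  rw [stableTail, abs_mul, abs_mul, abs_of_nonneg hA, abs_of_nonneg h0]
  have := mul_le_mul_of_nonneg_left (abs_sign_add_le hβ x) hA
  nlinarith

theorem integrable_min_one_abs_mul_rpow {α : ℝ} (h1 : 1 < α) (h2 : α < 2) :
    Integrable (fun x : ℝ => min 1 |x| * |x| ^ (-α)) := by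
  have h := integrableOn_min_rpow_mul_rpow (p := α - 1) (q := 1) (by linarith) (by linarith)
  simp only [Real.rpow_one, show -(α - 1) - 1 = -α by ring] at h
  exact integrable_comp_abs_of_integrableOn (f := fun x : ℝ => min 1 x * x ^ (-α)) h

theorem norm_mul_stableTail_le {E : Type*} [NormedAddCommGroup E] {α A β D x : ℝ} (hA : 0 ≤ A)
    (hβ : β ∈ Set.Icc (-1 : ℝ) 1) {v : E} (h : ‖v‖ ≤ D * min 1 |x|) :
    ‖v‖ * |stableTail α A β x| ≤ D * (2 * A) * (min 1 |x| * |x| ^ (-α)) := by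
  refine (mul_le_mul h (abs_stableTail_le hA hβ x) (abs_nonneg _)
    ((norm_nonneg _).trans h)).trans (le_of_eq ?_)
  ring

theorem norm_exp_mul_I_sub_one_le (u x : ℝ) :
    ‖Complex.exp (u * x * Complex.I) - 1‖ ≤ (2 + |u|) * min 1 |x| := by
  refine Complex.norm_exp_sub_one_le_min (by simp) (by linarith [abs_nonneg u]) ?_
  rw [norm_mul, norm_mul, Complex.norm_real, Complex.norm_real, Complex.norm_I, mul_one]
  simp only [Real.norm_eq_abs]
  nlinarith [abs_nonneg x]

theorem integrable_exp_sub_one_mul_stableTail {α A β : ℝ} (h1 : 1 < α) (h2 : α < 2) (hA : 0 ≤ A)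
    (hβ : β ∈ Set.Icc (-1 : ℝ) 1) (u : ℝ) :
    Integrable (fun x : ℝ => (Complex.exp (u * x * Complex.I) - 1) * (stableTail α A β x : ℂ)) := by
  have := measurable_stableTail α A β
  refine ((integrable_min_one_abs_mul_rpow h1 h2).const_mul ((2 + |u|) * (2 * A))).mono'
    (Measurable.aestronglyMeasurable (by fun_prop)) (Eventually.of_forall fun x => ?_)
  rw [norm_mul, Complex.norm_real]
  exact norm_mul_stableTail_le hA hβ (norm_exp_mul_I_sub_one_le u x)

/-- The Lévy–Khintchine formula for stable laws, in terms of the tails of the Lévy measure. -/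
theorem mul_integral_exp_sub_one_mul_stableTail {α A β : ℝ} (h1 : 1 < α) (h2 : α < 2) (hA : 0 < A)
    (hβ : β ∈ Set.Icc (-1 : ℝ) 1) (u : ℝ) :
    u * Complex.I * ∫ x : ℝ, (Complex.exp (u * x * Complex.I) - 1) * (stableTail α A β x : ℂ) =
      -stableExponent α (stableScale α A ^ α)
        (stableScale α A ^ α * (β * Real.tan (Real.pi * α / 2))) u := by
  set H : ℝ → ℂ := fun x => (Complex.exp (u * x * Complex.I) - 1) * (stableTail α A β x : ℂ)
  set k : ℝ → ℂ := fun u => ∫ y in Set.Ioi (0 : ℝ), (Complex.exp (u * y * Complex.I) - 1) *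
        ((y ^ (-α) : ℝ) : ℂ) with hk
  have hH : Integrable H := integrable_exp_sub_one_mul_stableTail h1 h2 hA.le hβ u
  have hpos : ∫ x in Set.Ioi (0 : ℝ), H x = ((A * (1 + β) : ℝ) : ℂ) * k u := by
    rw [hk, ← integral_const_mul]
    refine setIntegral_congr_fun measurableSet_Ioi fun y hy => ?_
    have hy0 : (0 : ℝ) < y := hy
    simp only [H, stableTail, Real.sign_of_pos hy0, abs_of_pos hy0]
    push_cast
    ring
  have hneg : ∫ x in Set.Iic (0 : ℝ), H x = -((A * (1 - β) : ℝ) : ℂ) * k (-u) := by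
    rw [← neg_zero, ← integral_comp_neg_Ioi, hk, ← integral_const_mul]
    refine setIntegral_congr_fun measurableSet_Ioi fun y hy => ?_
    have hy0 : (0 : ℝ) < y := hy
    simp only [H, stableTail, Real.sign_of_neg (neg_neg_of_pos hy0), abs_neg, abs_of_pos hy0]
    push_cast
    ring_nf
  have hsum : ∫ x, H x = ((A * (1 + β) : ℝ) : ℂ) * k u - ((A * (1 - β) : ℝ) : ℂ) * k (-u) := by
    rw [← intervalIntegral.integral_Iic_add_Ioi hH.integrableOn hH.integrableOn, hpos, hneg]
    ring
  have hkneg : k (-u) = (starRingEnd ℂ) (k u) := integral_exp_mul_I_sub_one_mul_rpow_neg α u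
  set G := gammaConst α
  set T := Real.pi * α / 2
  have hcos : Real.cos T ≠ 0 := fun h => by
    have := gammaConst_mul_cos_neg h1 h2
    rw [h, mul_zero] at this
    exact lt_irrefl _ this
  -- Positive u follows from the scaling of the integral, negative u by conjugation; the sign is
  -- then absorbed in u |u|^(α-1), so that one formula covers both.
  have hval : (u : ℂ) * Complex.I * k u =
      ((|u| ^ α * (G * Real.cos T) : ℝ) : ℂ) -
        ((u * |u| ^ (α - 1) * (G * Real.sin T) : ℝ) : ℂ) * Complex.I := by
    have hp : ∀ v : ℝ, 0 < v → k v =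
        ((v ^ (α - 1) : ℝ) : ℂ) * (-(G * Real.sin T : ℝ) - (G * Real.cos T : ℝ) * Complex.I) :=
      fun v hv => by
        rw [hk]
        simp only
        rw [integral_exp_mul_I_sub_one_mul_rpow_pos hv, integral_exp_I_sub_one_mul_rpow h1 h2]
    rcases lt_trichotomy u 0 with hu | hu | hu
    · have e1 := hp (-u) (by linarith)
      have e2 : k u = (starRingEnd ℂ) (k (-u)) := by rw [hkneg, Complex.conj_conj]
      have e3 : |u| ^ α = -u * (-u) ^ (α - 1) := by
        rw [abs_of_neg hu, Real.rpow_sub_one (by linarith)]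
        have := hu.ne
        field_simp
      rw [e2, e1, e3, abs_of_neg hu]
      simp only [map_mul, map_sub, map_neg, Complex.conj_ofReal, Complex.conj_I]
      push_cast
      ring_nf
      rw [Complex.I_sq]
      ring
    · rw [hu]
      simp [Real.zero_rpow (by linarith : α ≠ 0)]
    · have e1 := hp u hu
      have e3 : |u| ^ α = u * u ^ (α - 1) := by
        rw [abs_of_pos hu, Real.rpow_sub_one hu.ne']
        field_simp
      rw [e1, e3, abs_of_pos hu]
      push_cast
      ring_nf
      rw [Complex.I_sq]
      ring
  have hval' : (u : ℂ) * Complex.I * k (-u) =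
      -((|u| ^ α * (G * Real.cos T) : ℝ) : ℂ) -
        ((u * |u| ^ (α - 1) * (G * Real.sin T) : ℝ) : ℂ) * Complex.I := by
    have := congrArg (starRingEnd ℂ) hval
    simp only [map_mul, map_sub, Complex.conj_ofReal, Complex.conj_I, ← hkneg] at this
    linear_combination -this
  have hT : Real.sin T = Real.cos T * Real.tan T := by
    rw [Real.tan_eq_sin_div_cos]; field_simp
  have hσ : stableScale α A ^ α = -2 * A * (G * Real.cos T) := stableScale_rpow h1 h2 hA
  rw [hsum, mul_sub, mul_left_comm, mul_left_comm _ ((A * (1 - β) : ℝ) : ℂ), hval, hval',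
    stableExponent, hσ, hT]
  push_cast
  ring

/-! ### Stable expectations as integrals against the Lévy tails, by halving -/

/-- With this factor c, strict stability says that c Y + c Y' has the law of Y. -/
theorem two_rpow_neg_inv {α : ℝ} (hα : 0 < α) :
    0 < (2 : ℝ) ^ (-(1 / α)) ∧ ((2 : ℝ) ^ (-(1 / α))) ^ α = 1 / 2 := by
  refine ⟨by positivity, ?_⟩
  rw [← Real.rpow_mul (by norm_num), neg_mul, one_div, inv_mul_cancel₀ hα.ne', Real.rpow_neg_one,
    one_div]

/-- Halving: a stable law is nearly additive on functions with bounded second differences. -/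
theorem IsStableLaw.abs_integral_sub_two_mul_integral_le {α σ β : ℝ} {ρ : Measure ℝ}
    (h : IsStableLaw α σ β ρ) (hα : 1 < α) (hσ : 0 < σ) {c : ℝ} (hc : 0 < c) (hc' : c ^ α = 1 / 2)
    {f : ℝ → ℝ} {B M : ℝ} (hf : LipBound B f) (hM : SecondDiffBound M f) (h0 : f 0 = 0) :
    |∫ y, f y ∂ρ - 2 * ∫ y, f (c * y) ∂ρ| ≤ M * c ^ 2 * (∫ y, |y| ∂ρ) ^ 2 := by
  have := h.isProbabilityMeasure
  have hid := h.integrable hα hσ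
  have hfc : ∀ x, Integrable (fun y => f (x + c * y)) ρ := fun x =>
    LipBound.integrable_comp (hf.comp_affine x c) hid
  have hfc0 : Integrable (fun y => f (c * y)) ρ := by simpa using hfc 0
  set a := ∫ y, |y| ∂ρ
  set E := ∫ y, f (c * y) ∂ρ
  have e1 : ∫ y, f y ∂ρ = ∫ x, ∫ y, f (c * x + c * y) ∂ρ ∂ρ := by
    have := h.integral_integral_comp_add (by linarith) hσ.le hc hc hf.continuous ?_
    · rw [hc'] at this
      norm_num at this
      exact this
    · rw [hc']
      norm_num
      exact hf.integrable_comp hid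
  have hI : Integrable (fun x => ∫ y, f (c * x + c * y) ∂ρ) ρ := by
    have hL : LipBound B (fun x => ∫ y, f (x + c * y) ∂ρ) := LipBound.integral hfc fun y x z => by
      refine (hf _ _).trans (le_of_eq ?_)
      ring_nf
    exact hL.integrable_comp (hid.const_mul c)
  -- As f(0) = 0, the integrand is the second difference of f at 0 with increments c x and c y.
  have hpt : ∀ x, |(∫ y, f (c * x + c * y) ∂ρ) - f (c * x) - E| ≤ M * c ^ 2 * a * |x| := by
    intro x
    have e2 : (∫ y, f (c * x + c * y) ∂ρ) - f (c * x) - E =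
        ∫ y, (f (c * x + c * y) - f (c * x) - f (c * y)) ∂ρ := by
      have i1 : Integrable (fun y => f (c * x + c * y) - f (c * x)) ρ :=
        (hfc _).sub (integrable_const _)
      rw [integral_sub i1 hfc0, integral_sub (hfc _) (integrable_const _)]
      simp [E]
    rw [e2]
    have := norm_integral_le_of_norm_le (hid.abs.const_mul (M * c ^ 2 * |x|))
      (f := fun y => f (c * x + c * y) - f (c * x) - f (c * y)) (Eventually.of_forall fun y => by
        have := hM 0 (c * x) (c * y)
        rw [zero_add, zero_add, h0, add_zero, abs_mul, abs_mul, abs_of_pos hc] at this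
        refine this.trans (le_of_eq ?_)
        ring)
    refine this.trans (le_of_eq ?_)
    rw [integral_const_mul]
    ring
  have e3 : (∫ y, f y ∂ρ) - 2 * E =
      ∫ x, ((∫ y, f (c * x + c * y) ∂ρ) - f (c * x) - E) ∂ρ := by
    have i1 : Integrable (fun x => (∫ y, f (c * x + c * y) ∂ρ) - f (c * x)) ρ := hI.sub hfc0
    rw [integral_sub i1 (integrable_const _), integral_sub hI hfc0, e1]
    simp only [integral_const, probReal_univ, one_smul]
    ring
  rw [e3]
  have := norm_integral_le_of_norm_le (hid.abs.const_mul (M * c ^ 2 * a))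
    (f := fun x => (∫ y, f (c * x + c * y) ∂ρ) - f (c * x) - E) (Eventually.of_forall hpt)
  refine this.trans (le_of_eq ?_)
  rw [integral_const_mul]
  ring

/-- Halving is applied to y ↦ f(c^k y), whose second differences carry the factor c^(2k). With the
weight 2^k the successive errors form a geometric series, so the distance to the limit is a multiple
of M alone. -/
theorem IsStableLaw.abs_integral_sub_le_of_tendsto {α σ β : ℝ} {ρ : Measure ℝ}
    (h : IsStableLaw α σ β ρ) (h1 : 1 < α) (h2 : α < 2) (hσ : 0 < σ) :
    ∃ C : ℝ, 0 ≤ C ∧ ∀ (f : ℝ → ℝ) (B M ℓ : ℝ), LipBound B f → SecondDiffBound M f → f 0 = 0 →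
      Tendsto (fun k : ℕ => 2 ^ k * ∫ y, f (((2 : ℝ) ^ (-(1 / α))) ^ k * y) ∂ρ) atTop (𝓝 ℓ) →
      |∫ y, f y ∂ρ - ℓ| ≤ C * M := by
  obtain ⟨hc, hc'⟩ := two_rpow_neg_inv (α := α) (by linarith)
  set c := (2 : ℝ) ^ (-(1 / α)) with hcdef
  set a := ∫ y, |y| ∂ρ
  -- 2c² = 2^(1-2/α), and this is where α < 2 makes the series converge.
  have hr : 2 * c ^ 2 < 1 := by
    have e : 2 * c ^ 2 = (2 : ℝ) ^ (1 - 2 / α) := by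
      rw [hcdef, ← Real.rpow_natCast, ← Real.rpow_mul (by norm_num), Real.rpow_sub (by norm_num),
        Real.rpow_one, div_eq_mul_inv (2 : ℝ) (2 ^ _), ← Real.rpow_neg (by norm_num)]
      congr 2
      push_cast
      ring
    rw [e]
    refine Real.rpow_lt_one_of_one_lt_of_neg (by norm_num) ?_
    rw [sub_neg, lt_div_iff₀ (by linarith)]
    linarith
  refine ⟨c ^ 2 * a ^ 2 / (1 - 2 * c ^ 2), div_nonneg (by positivity) (by linarith),
    fun f B M ℓ hf hM h0 hℓ => ?_⟩
  have hstep : ∀ k : ℕ, dist (2 ^ k * ∫ y, f (c ^ k * y) ∂ρ) (2 ^ (k + 1) * ∫ y, f (c ^ (k + 1) * y) ∂ρ)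
      ≤ M * c ^ 2 * a ^ 2 * (2 * c ^ 2) ^ k := fun k => by
    have := h.abs_integral_sub_two_mul_integral_le h1 hσ hc hc' (hf.comp_affine 0 (c ^ k))
      (hM.comp_affine 0 (c ^ k)) (by simpa using h0)
    simp only [zero_add] at this
    rw [Real.dist_eq, pow_succ, pow_succ, mul_assoc, ← mul_sub, abs_mul,
      abs_of_pos (by positivity : (0 : ℝ) < 2 ^ k)]
    simp only [mul_assoc (c ^ k)]
    refine (mul_le_mul_of_nonneg_left this (by positivity)).trans (le_of_eq ?_)
    rw [mul_pow]
    ring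
  have := dist_le_of_le_geometric_of_tendsto₀ _ _ hr hstep hℓ
  simp only [pow_zero, one_mul] at this
  rw [Real.dist_eq] at this
  refine this.trans (le_of_eq ?_)
  ring

theorem tendsto_mul_exp_neg_div_sub_one (w : ℂ) :
    Tendsto (fun k : ℕ => (2 : ℂ) ^ k * (Complex.exp (-(((1 / 2 : ℝ) ^ k : ℝ) * w)) - 1)) atTop
      (𝓝 (-w)) := by
  have hd : HasDerivAt (fun t : ℝ => Complex.exp (-(t * w))) (-w) 0 := by
    have := ((Complex.ofRealCLM.hasDerivAt (x := 0)).mul_const w).neg.cexp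
    simpa using! this
  have ht : Tendsto (fun k : ℕ => (1 / 2 : ℝ) ^ k) atTop (𝓝[≠] 0) :=
    tendsto_nhdsWithin_iff.2 ⟨tendsto_pow_atTop_nhds_zero_of_lt_one (by norm_num) (by norm_num),
      Eventually.of_forall fun k => by simp⟩
  refine ((hasDerivAt_iff_tendsto_slope_zero.1 hd).comp ht).congr fun k => ?_
  simp

theorem IsStableLaw.charFun_map_pow_mul {α σ β : ℝ} {ρ : Measure ℝ} (h : IsStableLaw α σ β ρ)
    {c : ℝ} (hc : 0 < c) (hc' : c ^ α = 1 / 2) (k : ℕ) (t : ℝ) :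
    charFun (ρ.map (c ^ k * ·)) t = Complex.exp (-(((1 / 2 : ℝ) ^ k : ℝ) *
      stableExponent α (σ ^ α) (σ ^ α * (β * Real.tan (Real.pi * α / 2))) t)) := by
  rw [charFun_map_mul, h.charFun_eq', stableExponent_mul (by positivity), ← Real.rpow_natCast c,
    ← Real.rpow_mul hc.le, mul_comm (k : ℝ) α, Real.rpow_mul hc.le, hc', Real.rpow_natCast,
    stableExponent_smul]

/-- In frequency, 2^n (exp(-2^(-n) ψ) - 1) tends to -ψ. The Lévy–Khintchine formula writes -ψ as an
integral against `stableTail`, and Fubini leads back from frequencies to g'. -/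
theorem IsStableLaw.tendsto_two_pow_mul_integral_schwartz {α A β : ℝ} {ρ : Measure ℝ}
    (h : IsStableLaw α (stableScale α A) β ρ) (h1 : 1 < α) (h2 : α < 2) (hA : 0 < A)
    (hβ : β ∈ Set.Icc (-1 : ℝ) 1) (g : 𝓢(ℝ, ℂ)) (h0 : g 0 = 0) :
    Tendsto (fun k : ℕ => (2 : ℂ) ^ k * ∫ y, g (((2 : ℝ) ^ (-(1 / α))) ^ k * y) ∂ρ) atTop
      (𝓝 (∫ x, (deriv g x - deriv g 0) * (stableTail α A β x : ℂ))) := by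
  have := h.isProbabilityMeasure
  have hσ := stableScale_pos h1 h2 hA
  obtain ⟨hc, hc'⟩ := two_rpow_neg_inv (α := α) (by linarith)
  set c := (2 : ℝ) ^ (-(1 / α)) with hcdef
  set b := stableScale α A ^ α with hb
  have hb0 : 0 < b := by positivity
  set b' := stableScale α A ^ α * (β * Real.tan (Real.pi * α / 2)) with hb'
  set k : 𝓢(ℝ, ℂ) := 𝓕⁻ g
  have hk : 𝓕 (k : ℝ → ℂ) = g := by
    rw [← SchwartzMap.fourier_coe, FourierTransform.fourier_fourierInv_eq]
  have hki : Integrable (fun x : ℝ => x • k x) := by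
    refine (k.integrable_pow_mul volume 1).mono' (by fun_prop) (Eventually.of_forall fun x => ?_)
    rw [norm_smul, pow_one]
  have hk1 : Integrable (fun x : ℝ => |x| * ‖k x‖) := by
    refine hki.norm.congr (Eventually.of_forall fun x => ?_)
    simp
  have hk2 : Integrable (fun x : ℝ => |x| ^ 2 * ‖k x‖) := k.integrable_pow_mul volume 2
  -- This is g(0) = 0 read on the Fourier side; it allows 1 to be subtracted from the characteristic
  -- function.
  have hk0 : ∫ s, k s = 0 := by
    have : 𝓕 (k : ℝ → ℂ) 0 = ∫ s, k s := by rw [Real.fourier_real_eq]; simp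
    rw [← this, hk, h0]
  let w : ℝ → ℂ := fun s => stableExponent α b b' (-(2 * Real.pi * s))
  have hwc : Continuous w := (continuous_stableExponent h1 b b').comp (by fun_prop)
  have hwre : ∀ s, 0 ≤ (w s).re := fun s => by
    simp only [w, stableExponent_re]
    positivity
  -- Since 0 ≤ α < 2, a power t^α is at most 1 + t²; the Schwartz decay of k then dominates the
  -- limit.
  have hwb : ∀ s, ‖w s‖ ≤ (|b| + |b'|) * (1 + (2 * Real.pi) ^ 2 * |s| ^ 2) := fun s => by
    refine (norm_stableExponent_le h1 _ _ _).trans (mul_le_mul_of_nonneg_left ?_ (by positivity))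
    rw [abs_neg, abs_mul, abs_of_pos (by positivity : 0 < 2 * Real.pi), ← mul_pow]
    rcases le_total (2 * Real.pi * |s|) 1 with hs | hs
    · have := Real.rpow_le_one (by positivity) hs (by linarith : 0 ≤ α)
      nlinarith [sq_nonneg (2 * Real.pi * |s|)]
    · have := Real.rpow_le_rpow_of_exponent_le hs h2.le
      rw [Real.rpow_two] at this
      linarith
  have e1 : ∀ n : ℕ, (2 : ℂ) ^ n * ∫ y, g (c ^ n * y) ∂ρ =
      ∫ s, k s * ((2 : ℂ) ^ n * (Complex.exp (-(((1 / 2 : ℝ) ^ n : ℝ) * w s)) - 1)) := by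
    intro n
    have hP : IsProbabilityMeasure (ρ.map (c ^ n * ·)) :=
      Measure.isProbabilityMeasure_map (by fun_prop)
    have f1 : ∫ y, g (c ^ n * y) ∂ρ = ∫ y, g y ∂(ρ.map (c ^ n * ·)) :=
      (integral_map (by fun_prop) g.continuous.aestronglyMeasurable).symm
    have f2 := integral_fourier_eq_integral_mul_charFun (ρ.map (c ^ n * ·)) k.integrable
    rw [hk] at f2
    have i1 : Integrable (fun s => k s * Complex.exp (-(((1 / 2 : ℝ) ^ n : ℝ) * w s))) := by
      refine k.integrable.norm.mono' (by fun_prop) (Eventually.of_forall fun s => ?_)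
      rw [norm_mul, Complex.norm_exp]
      refine mul_le_of_le_one_right (norm_nonneg _) (Real.exp_le_one_iff.2 ?_)
      rw [Complex.neg_re, Complex.re_ofReal_mul]
      have := mul_nonneg (by positivity : (0 : ℝ) ≤ (1 / 2) ^ n) (hwre s)
      linarith
    have f3 : ∫ s, k s * Complex.exp (-(((1 / 2 : ℝ) ^ n : ℝ) * w s)) =
        ∫ s, k s * (Complex.exp (-(((1 / 2 : ℝ) ^ n : ℝ) * w s)) - 1) := by
      simp only [mul_sub, mul_one]
      rw [integral_sub i1 k.integrable, hk0, sub_zero]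
    rw [f1, f2]
    simp only [h.charFun_map_pow_mul hc hc']
    rw [show (∫ s, k s * Complex.exp (-(((1 / 2 : ℝ) ^ n : ℝ) *
      stableExponent α b b' (-(2 * Real.pi * s))))) = _ from f3, ← integral_const_mul]
    refine integral_congr_ae (Eventually.of_forall fun s => ?_)
    simp only
    ring
  have hlim : Tendsto (fun n : ℕ => (2 : ℂ) ^ n * ∫ y, g (c ^ n * y) ∂ρ) atTop
      (𝓝 (∫ s, k s * -w s)) := by
    simp only [e1]
    refine tendsto_integral_of_dominated_convergence
      (fun s => (|b| + |b'|) * (‖k s‖ + (2 * Real.pi) ^ 2 * (|s| ^ 2 * ‖k s‖)))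
      (fun n => (by fun_prop : Continuous _).aestronglyMeasurable)
      ((k.integrable.norm.add (hk2.const_mul _)).const_mul _)
      (fun n => Eventually.of_forall fun s => ?_)
      (Eventually.of_forall fun s => (tendsto_mul_exp_neg_div_sub_one (w s)).const_mul _)
    rw [norm_mul, norm_mul, norm_pow]
    have f1 : ‖Complex.exp (-(((1 / 2 : ℝ) ^ n : ℝ) * w s)) - 1‖ ≤ (1 / 2) ^ n * ‖w s‖ := by
      refine (Complex.norm_exp_sub_one_le_of_re_nonpos ?_).trans (le_of_eq ?_)
      · rw [Complex.neg_re, Complex.re_ofReal_mul]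
        have := mul_nonneg (by positivity : (0 : ℝ) ≤ (1 / 2) ^ n) (hwre s)
        linarith
      · rw [norm_neg, norm_mul, Complex.norm_real, Real.norm_of_nonneg (by positivity)]
    have f2 : ‖(2 : ℂ)‖ ^ n * ‖Complex.exp (-(((1 / 2 : ℝ) ^ n : ℝ) * w s)) - 1‖ ≤ ‖w s‖ := by
      refine (mul_le_mul_of_nonneg_left f1 (by positivity)).trans (le_of_eq ?_)
      rw [← mul_assoc, ← mul_pow]
      norm_num
    refine (mul_le_mul_of_nonneg_left (f2.trans (hwb s)) (norm_nonneg _)).trans (le_of_eq ?_)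
    ring
  have hfub : ∫ s, k s * -w s = ∫ x, (deriv g x - deriv g 0) * (stableTail α A β x : ℂ) := by
    -- The double integrand is dominated by an integrable function of s times min(1, |x|) |x|^(-α),
    -- which is integrable because 1 < α < 2.
    let Φ : ℝ → ℝ → ℂ := fun s x => k s * ((-(2 * Real.pi * s) : ℝ) * Complex.I) *
      ((Complex.exp ((-(2 * Real.pi * s) : ℝ) * x * Complex.I) - 1) * (stableTail α A β x : ℂ))
    have hΦ : Integrable (Function.uncurry Φ) (volume.prod volume) := by
      have hm : Measurable (stableTail α A β) := measurable_stableTail α A β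
      have hb := ((hk1.const_mul (2 * (2 * Real.pi))).add
        (hk2.const_mul ((2 * Real.pi) ^ 2))).mul_prod
        ((integrable_min_one_abs_mul_rpow h1 h2).const_mul (2 * A))
      refine hb.mono' ?_ (Eventually.of_forall fun p => ?_)
      · have : Measurable k := k.continuous.measurable
        exact Measurable.aestronglyMeasurable (by unfold Function.uncurry; fun_prop)
      · simp only [Function.uncurry, Φ]
        rw [norm_mul, norm_mul, norm_mul, norm_mul, Complex.norm_I, mul_one, Complex.norm_real,
          Complex.norm_real, norm_neg, norm_mul, Real.norm_of_nonneg (by positivity : 0 ≤ 2 * Real.pi)]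
        have f1 := norm_mul_stableTail_le (α := α) hA.le hβ
          (norm_exp_mul_I_sub_one_le (-(2 * Real.pi * p.1)) p.2)
        refine (mul_le_mul_of_nonneg_left f1 (by positivity)).trans (le_of_eq ?_)
        rw [abs_neg, abs_mul, abs_of_pos (by positivity : 0 < 2 * Real.pi)]
        simp only [Pi.add_apply, Real.norm_eq_abs]
        ring
    have f1 : ∀ s, k s * -w s = ∫ x, Φ s x := fun s => by
      simp only [Φ]
      rw [integral_const_mul, mul_assoc,
        mul_integral_exp_sub_one_mul_stableTail h1 h2 hA hβ (-(2 * Real.pi * s))]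
    have hki' : Integrable (fun x : ℝ => (-2 * Real.pi * Complex.I * x) • k x) := by
      refine (hki.const_mul (-2 * Real.pi * Complex.I)).congr (Eventually.of_forall fun x => ?_)
      simp only [smul_eq_mul, Complex.real_smul]
      ring
    have f2 : ∀ x, ∫ s, Φ s x = (deriv g x - deriv g 0) * (stableTail α A β x : ℂ) := fun x => by
      have hd : ∀ x, deriv g x = ∫ s, Complex.exp ((-(2 * Real.pi * s) : ℝ) * x * Complex.I) *
          ((-2 * Real.pi * Complex.I * s) • k s) := fun x => by
        rw [← hk, Real.deriv_fourier k.integrable hki, Real.fourier_real_eq_integral_exp_smul]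
        refine integral_congr_ae (Eventually.of_forall fun s => ?_)
        simp only [smul_eq_mul]
        congr 2
        push_cast
        ring
      have hi : ∀ x : ℝ, Integrable (fun s : ℝ =>
          Complex.exp ((-(2 * Real.pi * s) : ℝ) * x * Complex.I) *
          ((-2 * Real.pi * Complex.I * s) • k s)) := fun x => by
        refine hki'.norm.mono' (Continuous.aestronglyMeasurable (by fun_prop))
          (Eventually.of_forall fun s => ?_)
        rw [norm_mul, ← Complex.ofReal_mul, Complex.norm_exp_ofReal_mul_I, one_mul]
      rw [hd x, hd 0, ← integral_sub (hi x) (hi 0), ← integral_mul_const]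
      refine integral_congr_ae (Eventually.of_forall fun s => ?_)
      simp only [Φ, smul_eq_mul, Complex.ofReal_zero, mul_zero, zero_mul, Complex.exp_zero]
      push_cast
      ring
    simp only [f1]
    rw [integral_integral_swap hΦ]
    simp only [f2]
  rw [← hfub]
  exact hlim

/-- Smooth functions of compact support are Schwartz, so the limit in the halving estimate is known;
f'(0) = 0 removes its compensating term. -/
theorem IsStableLaw.exists_abs_integral_sub_tail_le_of_hasCompactSupport {α A β : ℝ} {ρ : Measure ℝ}
    (h : IsStableLaw α (stableScale α A) β ρ) (h1 : 1 < α) (h2 : α < 2) (hA : 0 < A)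
    (hβ : β ∈ Set.Icc (-1 : ℝ) 1) :
    ∃ C : ℝ, 0 ≤ C ∧ ∀ (f : ℝ → ℝ) (B M : ℝ), ContDiff ℝ ∞ f → HasCompactSupport f → LipBound B f →
      SecondDiffBound M f → f 0 = 0 → deriv f 0 = 0 →
      |∫ y, f y ∂ρ - ∫ x, deriv f x * stableTail α A β x| ≤ C * M := by
  obtain ⟨C, hC, hS⟩ := h.abs_integral_sub_le_of_tendsto h1 h2 (stableScale_pos h1 h2 hA)
  refine ⟨C, hC, fun f B M hf hc hL hM h0 hd0 => hS f B M _ hL hM h0 ?_⟩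
  have hsm : ContDiff ℝ ∞ (fun x => (f x : ℂ)) := Complex.ofRealCLM.contDiff.comp hf
  have hcs : HasCompactSupport (fun x => (f x : ℂ)) := hc.comp_left (g := Complex.ofReal) (by simp)
  have key := h.tendsto_two_pow_mul_integral_schwartz h1 h2 hA hβ (hcs.toSchwartzMap hsm)
    (by simp [h0])
  have e : ∀ y, deriv (hcs.toSchwartzMap hsm) y = ((deriv f y : ℝ) : ℂ) := fun y =>
    (hf.differentiable (by simp) y).hasDerivAt.ofReal_comp.deriv
  simp only [e, hd0, Complex.ofReal_zero, sub_zero] at key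
  have hre := (Complex.continuous_re.tendsto _).comp key
  simp only [← Complex.ofReal_mul] at hre
  rw [integral_complex_ofReal, Complex.ofReal_re] at hre
  refine hre.congr fun k => ?_
  simp only [Function.comp_apply, HasCompactSupport.toSchwartzMap_toFun]
  rw [integral_complex_ofReal]
  norm_cast

theorem LipBound.abs_le_mul_min {B M : ℝ} {f : ℝ → ℝ} (hM : LipBound M f) (h0 : f 0 = 0)
    (hB : ∀ x, |f x| ≤ B) (x : ℝ) : |f x| ≤ max M B * min 1 |x| := by
  have h1 := hM x 0
  rw [h0, sub_zero, sub_zero] at h1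
  rcases le_total 1 |x| with hx | hx
  · rw [min_eq_left hx, mul_one]
    exact (hB x).trans (le_max_right _ _)
  · rw [min_eq_right hx]
    exact h1.trans (mul_le_mul_of_nonneg_right (le_max_left _ _) (abs_nonneg _))

/-- The expectation of a smooth function vanishing to second order at `0` under a stable law is,
up to a bounded multiple of the second derivative, its integral against the Lévy measure. -/
theorem IsStableLaw.exists_abs_integral_sub_tail_le {α A β : ℝ} {ρ : Measure ℝ}
    (h : IsStableLaw α (stableScale α A) β ρ) (h1 : 1 < α) (h2 : α < 2) (hA : 0 < A)
    (hβ : β ∈ Set.Icc (-1 : ℝ) 1) :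
    ∃ C : ℝ, 0 ≤ C ∧ ∀ (f : ℝ → ℝ) (B M : ℝ), ContDiff ℝ ∞ f → LipBound B f →
      SecondDiffBound M f → f 0 = 0 → deriv f 0 = 0 →
      |∫ y, f y ∂ρ - ∫ x, deriv f x * stableTail α A β x| ≤ C * M := by
  have := h.isProbabilityMeasure
  have hid := h.integrable h1 (stableScale_pos h1 h2 hA)
  obtain ⟨C, hC, hS⟩ := h.exists_abs_integral_sub_tail_le_of_hasCompactSupport h1 h2 hA hβ
  obtain ⟨χ, K, hχ, hK, hχ1, hχ2, hχb, hχd, hχd2⟩ := exists_smooth_cutoff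
  refine ⟨C, hC, fun f B M hf hL hM h0 hd0 => ?_⟩
  have hfd : Differentiable ℝ f := hf.differentiable (by simp)
  have hf1 : ContDiff ℝ ∞ (deriv f) := (contDiff_infty_iff_deriv.1 hf).2
  have hχs1 : ContDiff ℝ ∞ (deriv χ) := (contDiff_infty_iff_deriv.1 hχ).2
  have hB0 := hL.nonneg
  have hM0 := hM.nonneg
  have hML := hM.lipBound_deriv hfd
  have hfx : ∀ x, |f x| ≤ B * |x| := fun x => by simpa [h0] using hL x 0
  let G : ℕ → ℝ → ℝ := fun N x => f x * χ (x / (N + 1))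
  have hG : ∀ N, ContDiff ℝ ∞ (G N) := fun N => hf.mul (hχ.comp (contDiff_id.div_const _))
  have hGd : ∀ N x, deriv (G N) x =
      deriv f x * χ (x / (N + 1)) + f x * (deriv χ (x / (N + 1)) / (N + 1)) := fun N x =>
    (hasDerivAt_mul_cutoff (hχ.differentiable (by simp)) hfd _ x).deriv
  have hχd' : ∀ x, |deriv χ x| ≤ K := fun x =>
    (le_mul_of_one_le_left (abs_nonneg _) (by linarith [abs_nonneg x])).trans (hχd x)
  have hfχ : ∀ (N : ℕ) (x v : ℝ), |x / (N + 1)| * |v| ≤ K → |f x * (v / (N + 1))| ≤ B * K :=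
    fun N x v hv => by
      have hN : (0 : ℝ) < N + 1 := by positivity
      rw [abs_mul, abs_div v, abs_of_pos hN]
      rw [abs_div, abs_of_pos hN] at hv
      refine (mul_le_mul_of_nonneg_right (hfx x) (by positivity)).trans ?_
      have := mul_le_mul_of_nonneg_left hv hB0
      refine le_trans (le_of_eq ?_) this
      field_simp
  have hGB : ∀ N x, |deriv (G N) x| ≤ B + B * K := fun N x => by
    rw [hGd]
    refine (abs_add_le _ _).trans (add_le_add ?_ (hfχ N x _ ?_))
    · rw [abs_mul]
      exact (mul_le_mul (hL.abs_deriv_le x) (hχb _) (abs_nonneg _) hB0).trans (by rw [mul_one])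
    · exact (mul_le_mul_of_nonneg_right (by linarith [abs_nonneg (x / (N + 1))])
        (abs_nonneg _)).trans (hχd _)
  -- Besides f'' χ, the second derivative of the truncation has three terms, each at most B K / (N +
  -- 1): two copies of f' χ' / (N + 1), and f χ'' / (N + 1)², where |f(x)| ≤ B |x| is used. The
  -- excess over M vanishes in the limit.
  have hGM : ∀ N : ℕ, LipBound (M + 3 * (B * K) / (N + 1)) (deriv (G N)) := fun N => by
    have hN : (0 : ℝ) < N + 1 := by positivity
    refine lipBound_of_abs_deriv_le ((contDiff_infty_iff_deriv.1 (hG N)).2.differentiable (by simp))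
      fun x => ?_
    have hfun : deriv (G N) = fun x =>
        deriv f x * χ (x / (N + 1)) + (1 / (N + 1)) * (f x * deriv χ (x / (N + 1))) := by
      funext x
      rw [hGd]
      ring
    have e1 := hasDerivAt_mul_cutoff (hχ.differentiable (by simp)) (hf1.differentiable (by simp))
      ((N : ℝ) + 1) x
    have e2 := (hasDerivAt_mul_cutoff (hχs1.differentiable (by simp)) hfd ((N : ℝ) + 1) x).const_mul
      (1 / ((N : ℝ) + 1))
    have e3 := (e1.add e2).deriv
    rw [hfun]
    refine le_trans (le_of_eq (congrArg abs e3)) ?_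
    have b1 : |deriv (deriv f) x * χ (x / (N + 1))| ≤ M := by
      rw [abs_mul]
      exact (mul_le_mul (hML.abs_deriv_le x) (hχb _) (abs_nonneg _) hM0).trans (by rw [mul_one])
    have b2 : |deriv f x * (deriv χ (x / (N + 1)) / (N + 1))| ≤ B * K / (N + 1) := by
      rw [abs_mul, abs_div, abs_of_pos hN, mul_div_assoc]
      exact mul_le_mul (hL.abs_deriv_le x) (div_le_div_of_nonneg_right (hχd' _) hN.le)
        (by positivity) hB0
    have b3 : |1 / ((N : ℝ) + 1) * (deriv f x * deriv χ (x / (N + 1)))| ≤ B * K / (N + 1) := by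
      rw [abs_mul, abs_mul, abs_of_pos (one_div_pos.2 hN), one_div, inv_mul_eq_div]
      exact div_le_div_of_nonneg_right
        (mul_le_mul (hL.abs_deriv_le x) (hχd' _) (by positivity) hB0) hN.le
    have b4 : |1 / ((N : ℝ) + 1) * (f x * (deriv (deriv χ) (x / (N + 1)) / (N + 1)))| ≤
        B * K / (N + 1) := by
      rw [abs_mul, abs_of_pos (one_div_pos.2 hN), one_div, inv_mul_eq_div]
      exact div_le_div_of_nonneg_right (hfχ N x _ (hχd2 _)) hN.le
    rw [mul_add]
    have t1 := abs_add_le (deriv (deriv f) x * χ (x / (N + 1)))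
      (deriv f x * (deriv χ (x / (N + 1)) / (N + 1)))
    have t2 := abs_add_le (1 / ((N : ℝ) + 1) * (deriv f x * deriv χ (x / (N + 1))))
      (1 / ((N : ℝ) + 1) * (f x * (deriv (deriv χ) (x / (N + 1)) / (N + 1))))
    refine (abs_add_le _ _).trans ?_
    rw [mul_div_assoc]
    linarith
  have hGN0 : ∀ N, G N 0 = 0 := fun N => by simp [G, h0]
  have hGd0 : ∀ N, deriv (G N) 0 = 0 := fun N => by rw [hGd, hd0, h0]; ring
  have hbd : ∀ N : ℕ, |∫ y, G N y ∂ρ - ∫ x, deriv (G N) x * stableTail α A β x| ≤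
      C * (M + 3 * (B * K) / (N + 1)) := fun N =>
    hS (G N) (B + B * K) _ (hG N) (hasCompactSupport_mul_cutoff hχ2 f (by positivity))
      (lipBound_of_abs_deriv_le ((hG N).differentiable (by simp)) (hGB N))
      (secondDiffBound_of_lipBound_deriv ((hG N).differentiable (by simp)) (hGM N)) (hGN0 N) (hGd0 N)
  have hlim1 : Tendsto (fun N : ℕ => ∫ y, G N y ∂ρ) atTop (𝓝 (∫ y, f y ∂ρ)) := by
    refine tendsto_integral_of_dominated_convergence (fun y => B * |y|)
      (fun N => (hG N).continuous.aestronglyMeasurable) (hid.abs.const_mul B)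
      (fun N => Eventually.of_forall fun x => ?_) (Eventually.of_forall fun x => ?_)
    · rw [norm_mul]
      exact (mul_le_mul (hfx x) (hχb _) (abs_nonneg _) (by positivity)).trans (by rw [mul_one])
    · refine tendsto_const_nhds.congr' ?_
      filter_upwards [eventuallyEq_mul_cutoff hχ1 f x] with N hN
      exact hN.eq_of_nhds.symm
  have hlim2 : Tendsto (fun N : ℕ => ∫ x, deriv (G N) x * stableTail α A β x) atTop
      (𝓝 (∫ x, deriv f x * stableTail α A β x)) := by
    refine tendsto_integral_of_dominated_convergence
      (fun x => max (M + 3 * (B * K)) (B + B * K) * (2 * A) * (min 1 |x| * |x| ^ (-α)))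
      (fun N => ((contDiff_infty_iff_deriv.1 (hG N)).2.continuous.measurable.mul
        (measurable_stableTail α A β)).aestronglyMeasurable)
      ((integrable_min_one_abs_mul_rpow h1 h2).const_mul _)
      (fun N => Eventually.of_forall fun x => ?_) (Eventually.of_forall fun x => ?_)
    · rw [norm_mul]
      refine norm_mul_stableTail_le (α := α) hA.le hβ (LipBound.abs_le_mul_min ?_ (hGd0 N) (hGB N) x)
      intro x y
      refine (hGM N x y).trans (mul_le_mul_of_nonneg_right ?_ (abs_nonneg _))
      have := div_le_self (by positivity : 0 ≤ 3 * (B * K)) (by simp : (1 : ℝ) ≤ (N : ℝ) + 1)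
      linarith
    · refine tendsto_const_nhds.congr' ?_
      filter_upwards [eventuallyEq_mul_cutoff hχ1 f x] with N hN
      rw [EventuallyEq.deriv_eq hN]
  have hlim3 : Tendsto (fun N : ℕ => C * (M + 3 * (B * K) / ((N : ℝ) + 1))) atTop (𝓝 (C * M)) := by
    have := ((tendsto_one_div_add_atTop_nhds_zero_nat (𝕜 := ℝ)).const_mul (3 * (B * K))).const_add M
    simp only [mul_zero, add_zero, mul_one_div] at this
    exact this.const_mul C
  exact le_of_tendsto_of_tendsto' (hlim1.sub hlim2).abs hlim3 hbd

/-! ### Expectations through distribution functions -/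

/-- The kernel `1_{0 < x} - 1_{y ≤ x}`. -/
noncomputable def cdfKernel (y x : ℝ) : ℝ :=
  Set.indicator (Set.Ioi 0) 1 x - Set.indicator (Set.Ici y) 1 x

theorem cdfKernel_of_pos {y : ℝ} (hy : 0 < y) :
    cdfKernel y = Set.indicator (Set.Ioo 0 y) 1 := by
  funext x
  simp only [cdfKernel, Set.indicator_apply, Set.mem_Ioi, Set.mem_Ici, Set.mem_Ioo, Pi.one_apply]
  split_ifs <;> first | (norm_num; done) | (exfalso; grind)

theorem cdfKernel_of_nonpos {y : ℝ} (hy : y ≤ 0) :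
    cdfKernel y = -Set.indicator (Set.Icc y 0) 1 := by
  funext x
  simp only [cdfKernel, Set.indicator_apply, Set.mem_Ioi, Set.mem_Ici, Set.mem_Icc, Pi.one_apply,
    Pi.neg_apply]
  split_ifs <;> first | (norm_num; done) | (exfalso; grind)

theorem measurable_cdfKernel : Measurable (fun p : ℝ × ℝ => cdfKernel p.1 p.2) := by
  have h1 : Measurable fun p : ℝ × ℝ => Set.indicator (Set.Ioi (0 : ℝ)) (1 : ℝ → ℝ) p.2 :=
    (measurable_one.indicator measurableSet_Ioi).comp measurable_snd
  have h2 : Measurable fun p : ℝ × ℝ => Set.indicator (Set.Ici p.1) (1 : ℝ → ℝ) p.2 := by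
    have : (fun p : ℝ × ℝ => Set.indicator (Set.Ici p.1) (1 : ℝ → ℝ) p.2) =
        Set.indicator {p : ℝ × ℝ | p.1 ≤ p.2} 1 := by
      funext p
      simp [Set.indicator_apply]
    rw [this]
    exact measurable_one.indicator (measurableSet_le measurable_fst measurable_snd)
  exact h1.sub h2

theorem integral_abs_cdfKernel (y : ℝ) : Integrable (cdfKernel y) ∧ ∫ x, |cdfKernel y x| = |y| := by
  rcases lt_or_ge 0 y with hy | hy
  · rw [cdfKernel_of_pos hy]
    refine ⟨(integrable_indicator_iff measurableSet_Ioo).2 (integrable_const (1 : ℝ)), ?_⟩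
    have : ∀ x, |Set.indicator (Set.Ioo 0 y) (1 : ℝ → ℝ) x| = Set.indicator (Set.Ioo 0 y) 1 x :=
      fun x => abs_of_nonneg (Set.indicator_nonneg (by simp) x)
    simp only [this]
    rw [integral_indicator_one measurableSet_Ioo, Real.volume_real_Ioo_of_le hy.le, sub_zero,
      abs_of_pos hy]
  · rw [cdfKernel_of_nonpos hy]
    refine ⟨((integrable_indicator_iff measurableSet_Icc).2 (integrable_const (1 : ℝ))).neg, ?_⟩
    have : ∀ x, |(-Set.indicator (Set.Icc y 0) (1 : ℝ → ℝ)) x| = Set.indicator (Set.Icc y 0) 1 x :=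
      fun x => by
        rw [Pi.neg_apply, abs_neg]
        exact abs_of_nonneg (Set.indicator_nonneg (by simp) x)
    simp only [this]
    rw [integral_indicator_one measurableSet_Icc, Real.volume_real_Icc_of_le hy, zero_sub,
      abs_of_nonpos hy]

theorem integral_deriv_mul_cdfKernel {g : ℝ → ℝ} (hg : Differentiable ℝ g)
    (hg' : Continuous (deriv g)) (y : ℝ) : ∫ x, deriv g x * cdfKernel y x = g y - g 0 := by
  have hftc : ∀ a b : ℝ, ∫ x in a..b, deriv g x = g b - g a := fun a b =>
    intervalIntegral.integral_deriv_eq_sub (fun x _ => hg x) (hg'.intervalIntegrable _ _)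
  rcases lt_or_ge 0 y with hy | hy
  · rw [cdfKernel_of_pos hy]
    have : ∀ x, deriv g x * Set.indicator (Set.Ioo 0 y) (1 : ℝ → ℝ) x =
        Set.indicator (Set.Ioo 0 y) (deriv g) x := fun x => by
      by_cases hx : x ∈ Set.Ioo 0 y <;> simp [hx]
    simp only [this]
    rw [integral_indicator measurableSet_Ioo, ← integral_Ioc_eq_integral_Ioo,
      ← intervalIntegral.integral_of_le hy.le, hftc]
  · rw [cdfKernel_of_nonpos hy]
    have : ∀ x, deriv g x * (-Set.indicator (Set.Icc y 0) (1 : ℝ → ℝ)) x =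
        -Set.indicator (Set.Icc y 0) (deriv g) x := fun x => by
      by_cases hx : x ∈ Set.Icc y 0 <;> simp [hx]
    simp only [this]
    rw [integral_neg, integral_indicator measurableSet_Icc, integral_Icc_eq_integral_Ioc,
      ← intervalIntegral.integral_of_le hy, hftc]
    ring

/-- Integration by parts against a distribution function. -/
theorem integral_sub_eq_integral_deriv_mul_cdf {μ : Measure ℝ} [IsProbabilityMeasure μ]
    (hμ : Integrable (fun x : ℝ => x) μ) {g : ℝ → ℝ} {B : ℝ} (hg : Differentiable ℝ g)
    (hg' : Continuous (deriv g)) (hB : LipBound B g) :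
    ∫ y, g y ∂μ - g 0 =
      ∫ x, deriv g x * (Set.indicator (Set.Ioi 0) 1 x - cdf μ x) := by
  have hm : Measurable fun p : ℝ × ℝ => deriv g p.2 * cdfKernel p.1 p.2 :=
    (hg'.measurable.comp measurable_snd).mul measurable_cdfKernel
  have hbd : ∀ y x, ‖deriv g x * cdfKernel y x‖ ≤ B * |cdfKernel y x| := fun y x => by
    rw [norm_mul]
    exact mul_le_mul_of_nonneg_right (hB.abs_deriv_le x) (abs_nonneg _)
  -- Fubini applies because the kernel has L¹ norm |y| in x and μ has a first moment.
  have hi : Integrable (fun p : ℝ × ℝ => deriv g p.2 * cdfKernel p.1 p.2) (μ.prod volume) := by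
    rw [integrable_prod_iff hm.aestronglyMeasurable]
    refine ⟨Eventually.of_forall fun y => ?_, ?_⟩
    · exact ((integral_abs_cdfKernel y).1.abs.const_mul B).mono'
        (hm.comp measurable_prodMk_left).aestronglyMeasurable (Eventually.of_forall (hbd y))
    · refine (hμ.abs.const_mul B).mono'
        hm.aestronglyMeasurable.norm.integral_prod_right' (Eventually.of_forall fun y => ?_)
      rw [Real.norm_of_nonneg (integral_nonneg fun _ => norm_nonneg _)]
      refine (integral_mono_of_nonneg (Eventually.of_forall fun _ => norm_nonneg _)
        ((integral_abs_cdfKernel y).1.abs.const_mul B) (Eventually.of_forall (hbd y))).trans ?_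
      rw [integral_const_mul, (integral_abs_cdfKernel y).2]
  have e1 : ∫ y, ∫ x, deriv g x * cdfKernel y x ∂volume ∂μ = ∫ y, g y ∂μ - g 0 := by
    simp only [integral_deriv_mul_cdfKernel hg hg']
    rw [integral_sub (hB.integrable_comp hμ) (integrable_const _)]
    simp
  rw [← e1, integral_integral_swap hi]
  refine integral_congr_ae (Eventually.of_forall fun x => ?_)
  simp only
  rw [integral_const_mul]
  congr 1
  have e2 : ∀ y, cdfKernel y x = Set.indicator (Set.Ioi 0) 1 x - Set.indicator (Set.Iic x) 1 y :=
    fun y => by simp [cdfKernel, Set.indicator_apply]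
  have e3 : Integrable (Set.indicator (Set.Iic x) (1 : ℝ → ℝ)) μ :=
    (integrable_indicator_iff measurableSet_Iic).2 (integrable_const (1 : ℝ))
  simp only [e2]
  rw [integral_sub (integrable_const _) e3, integral_indicator_one measurableSet_Iic, cdf_eq_real]
  simp

/-- A single signed formula for both tails: it is `stableTail` with A replaced by A + ε(x), so the
comparison with the stable law involves ε alone. -/
theorem HasNormalAttractionForm.indicator_sub_cdf {α A β : ℝ} {ε : ℝ → ℝ} {μ : Measure ℝ}
    (h : HasNormalAttractionForm α A β ε μ) {x : ℝ} (hx : x ≠ 0) :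
    Set.indicator (Set.Ioi 0) 1 x - cdf μ x = (A + ε x) * (Real.sign x + β) * |x| ^ (-α) := by
  rw [Real.rpow_neg (abs_nonneg x)]
  rcases lt_or_gt_of_ne hx with hx | hx
  · rw [h.cdf_neg x hx, Real.sign_of_neg hx, Set.indicator_of_notMem (by simpa using hx.le)]
    ring
  · rw [h.cdf_pos x hx, Real.sign_of_pos hx, Set.indicator_of_mem (by simpa using hx), Pi.one_apply]
    ring

theorem HasNormalAttractionForm.integrable {α A β : ℝ} {ε : ℝ → ℝ} {μ : Measure ℝ}
    [IsProbabilityMeasure μ] (h : HasNormalAttractionForm α A β ε μ) (hα : 1 < α)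
    (hβ : β ∈ Set.Icc (-1 : ℝ) 1) : Integrable (fun x : ℝ => x) μ := by
  obtain ⟨B, hB⟩ := h.bounded_eps
  refine integrable_id_of_measure_abs_gt_le (C := 2 * ((|A| + B) * 2)) hα fun r hr => ?_
  have hr0 : 0 < r := by linarith
  have key : ∀ x, |x| = r → |Set.indicator (Set.Ioi 0) 1 x - cdf μ x| ≤ (|A| + B) * 2 * r ^ (-α) := by
    intro x hx
    have hx0 : x ≠ 0 := by rintro rfl; simp at hx; linarith
    rw [h.indicator_sub_cdf hx0, abs_mul, abs_mul, hx,
      abs_of_nonneg (by positivity : 0 ≤ r ^ (-α))]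
    refine mul_le_mul_of_nonneg_right (mul_le_mul ((abs_add_le _ _).trans (by linarith [hB x]))
      (abs_sign_add_le hβ x) (abs_nonneg _) ?_) (by positivity)
    have := (abs_nonneg _).trans (hB 0)
    positivity
  have k1 := key r (abs_of_pos hr0)
  have k2 := key (-r) (by rw [abs_neg, abs_of_pos hr0])
  rw [Set.indicator_of_mem (by simpa using hr0), Pi.one_apply] at k1
  rw [Set.indicator_of_notMem (by simp [hr0.le]), zero_sub, abs_neg] at k2
  have hsub : {x : ℝ | r < |x|} ⊆ Set.Ioi r ∪ Set.Iic (-r) := fun x hx => by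
    rcases lt_abs.1 (show r < |x| from hx) with h | h
    · exact Or.inl h
    · exact Or.inr (by simp only [Set.mem_Iic]; linarith)
  have e1 : μ.real (Set.Ioi r) = 1 - cdf μ r := by
    rw [cdf_eq_real, ← Set.compl_Iic, probReal_compl_eq_one_sub measurableSet_Iic]
  have e2 : μ.real (Set.Iic (-r)) = cdf μ (-r) := (cdf_eq_real _ _).symm
  have h3 := (measureReal_mono hsub).trans (measureReal_union_le (μ := μ) _ _)
  rw [e1, e2] at h3
  have := le_abs_self (1 - cdf μ r)
  have := le_abs_self (cdf μ (-r))
  linarith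

/-! ### Moments and tail comparison in terms of ε -/

theorem integral_indicator_abs_rpow {α r : ℝ} (hα : 1 < α) (hr : 0 < r) :
    Integrable (fun x : ℝ => Set.indicator (Set.Ici r) (fun t => t ^ (-α)) |x|) ∧
      ∫ x : ℝ, Set.indicator (Set.Ici r) (fun t => t ^ (-α)) |x| = 2 * (r ^ (1 - α) / (α - 1)) := by
  have hsub : Set.Ioi (0 : ℝ) ∩ Set.Ici r = Set.Ici r :=
    Set.inter_eq_right.2 fun x hx => hr.trans_le hx
  have hi : IntegrableOn (fun t : ℝ => t ^ (-α)) (Set.Ici r) := by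
    rw [integrableOn_Ici_iff_integrableOn_Ioi]
    exact integrableOn_Ioi_rpow_of_lt (by linarith) hr
  refine ⟨integrable_comp_abs_of_integrableOn ?_, ?_⟩
  · exact ((integrable_indicator_iff measurableSet_Ici).2 hi).integrableOn
  · rw [integral_comp_abs, setIntegral_indicator measurableSet_Ici, hsub, integral_Ici_eq_integral_Ioi,
      integral_Ioi_rpow_of_lt (by linarith) hr]
    congr 1
    rw [show -α + 1 = 1 - α by ring, show 1 - α = -(α - 1) by ring, neg_div_neg_eq]

theorem HasNormalAttractionForm.intervalIntegrable {α A β : ℝ} {ε : ℝ → ℝ} {μ : Measure ℝ}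
    (h : HasNormalAttractionForm α A β ε μ) (h2 : α < 2) (a b : ℝ) :
    IntervalIntegrable (fun x => |ε x| / |x| ^ (α - 1)) volume a b := by
  obtain ⟨B, hB⟩ := h.bounded_eps
  have hm := h.measurable_eps
  have h1 : ∀ a b : ℝ, IntervalIntegrable (fun x : ℝ => |x| ^ (1 - α)) volume a b := by
    have hpos : ∀ b : ℝ, 0 ≤ b → IntervalIntegrable (fun x : ℝ => |x| ^ (1 - α)) volume 0 b :=
      fun b hb => by
        refine (intervalIntegral.intervalIntegrable_rpow' (a := 0) (b := b) (r := 1 - α)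
          (by linarith)).congr ?_
        intro x hx
        rw [Set.uIoc_of_le hb] at hx
        simp only [abs_of_pos hx.1]
    have h0 : ∀ b : ℝ, IntervalIntegrable (fun x : ℝ => |x| ^ (1 - α)) volume 0 b := fun b => by
      rcases le_total 0 b with hb | hb
      · exact hpos b hb
      · have := (hpos (-b) (by linarith)).comp_mul_left (c := -1)
        simpa using this
    exact fun a b => (h0 a).symm.trans (h0 b)
  refine ((h1 a b).const_mul B).mono_fun (Measurable.aestronglyMeasurable (by fun_prop))
    (Eventually.of_forall fun x => ?_)
  have hB0 := (abs_nonneg _).trans (hB 0)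
  simp only
  rw [Real.norm_of_nonneg (by positivity), Real.norm_of_nonneg (by positivity),
    show 1 - α = -(α - 1) by ring, Real.rpow_neg (abs_nonneg x), div_eq_mul_inv]
  exact mul_le_mul_of_nonneg_right (hB x) (by positivity)

theorem abs_indicator_sub_cdf_le_one (μ : Measure ℝ) (x : ℝ) :
    |Set.indicator (Set.Ioi 0) 1 x - cdf μ x| ≤ 1 := by
  have h0 := cdf_nonneg μ x
  have h1 := cdf_le_one μ x
  rw [abs_le]
  by_cases hx : x ∈ Set.Ioi (0 : ℝ)
  · rw [Set.indicator_of_mem hx, Pi.one_apply]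
    constructor <;> linarith
  · rw [Set.indicator_of_notMem hx]
    constructor <;> linarith

theorem indicator_Ici_abs_rpow_of_le {α r x : ℝ} (h : r ≤ |x|) :
    Set.indicator (Set.Ici r) (fun t => t ^ (-α)) |x| = |x| ^ (-α) :=
  Set.indicator_of_mem (by exact h) _

theorem indicator_Ici_abs_rpow_nonneg (α r x : ℝ) :
    0 ≤ Set.indicator (Set.Ici r) (fun t => t ^ (-α)) |x| :=
  Set.indicator_apply_nonneg fun _ => Real.rpow_nonneg (abs_nonneg x) _

theorem abs_div_abs_rpow_eq {α x : ℝ} (hx : x ≠ 0) (v : ℝ) :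
    |v| / |x| ^ (α - 1) = |x| * (|v| * |x| ^ (-α)) := by
  have h : 0 < |x| := abs_pos.2 hx
  rw [Real.rpow_sub_one h.ne', Real.rpow_neg h.le]
  have := (Real.rpow_pos_of_pos h α).ne'
  field_simp

theorem integral_indicator_Ioc_eq_intervalIntegral {s : ℝ} (hs : 0 < s) {f : ℝ → ℝ}
    (hf : IntervalIntegrable f volume (-s) s) :
    Integrable (Set.indicator (Set.Ioc (-s) s) f) ∧
      ∫ x, Set.indicator (Set.Ioc (-s) s) f x = ∫ x in (-s)..s, f x := by
  have hle : -s ≤ s := by linarith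
  refine ⟨(integrable_indicator_iff measurableSet_Ioc).2
    ((intervalIntegrable_iff_integrableOn_Ioc_of_le hle).1 hf), ?_⟩
  rw [integral_indicator measurableSet_Ioc, intervalIntegral.integral_of_le hle]

theorem HasNormalAttractionForm.abs_indicator_sub_cdf_le {α A β : ℝ} {ε : ℝ → ℝ} {μ : Measure ℝ}
    (h : HasNormalAttractionForm α A β ε μ) (hA : 0 < A) (hβ : β ∈ Set.Icc (-1 : ℝ) 1) {x : ℝ}
    (hx : x ≠ 0) :
    |Set.indicator (Set.Ioi 0) 1 x - cdf μ x| ≤ 2 * A * |x| ^ (-α) + 2 * (|ε x| * |x| ^ (-α)) := by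
  rw [h.indicator_sub_cdf hx, abs_mul, abs_mul, abs_of_nonneg (by positivity : 0 ≤ |x| ^ (-α))]
  have h1 : |A + ε x| * |Real.sign x + β| ≤ (A + |ε x|) * 2 :=
    mul_le_mul ((abs_add_le _ _).trans (by rw [abs_of_pos hA])) (abs_sign_add_le hβ x)
      (abs_nonneg _) (by positivity)
  refine (mul_le_mul_of_nonneg_right h1 (by positivity)).trans (le_of_eq ?_)
  ring

/-- A bound for the first absolute moment, in terms of the error function `ε`. -/
theorem HasNormalAttractionForm.integral_abs_le {α A β : ℝ} {ε : ℝ → ℝ} {μ : Measure ℝ}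
    [IsProbabilityMeasure μ] (h : HasNormalAttractionForm α A β ε μ) (h1 : 1 < α) (h2 : α < 2)
    (hA : 0 < A) (hβ : β ∈ Set.Icc (-1 : ℝ) 1) {s e : ℝ} (hs : 0 < s)
    (he : ∀ x, s ≤ |x| → |ε x| ≤ e) :
    ∫ y, |y| ∂μ ≤ (5 + 4 * A / (α - 1)) *
        √(1 + ∫ x in (-s)..s, |ε x| / |x| ^ (α - 1)) + 4 / (α - 1) * (e * s ^ (1 - α)) := by
  have hid := h.integrable h1 hβ
  set J := ∫ x in (-s)..s, |ε x| / |x| ^ (α - 1) with hJ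
  have hJ0 : 0 ≤ J := intervalIntegral.integral_nonneg (by linarith) fun x _ => by positivity
  -- The splitting radius. The trivial bound 1 on [-l, l] costs 2l, and the part of ε beyond l but
  -- within s costs 2J/l ≤ 2l. The square root matters because this moment is squared in the
  -- centring estimate.
  set l := √(1 + J)
  have hl1 : 1 ≤ l := Real.one_le_sqrt.2 (by linarith)
  have hl2 : l * l = 1 + J := Real.mul_self_sqrt (by linarith)
  have hl0 : 0 < l := by linarith
  have he0 : 0 ≤ e := (abs_nonneg _).trans (he s (le_abs_self s))
  -- √(1 + x²) is a smooth 1-Lipschitz majorant of |x|, to which integration by parts against F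
  -- applies.
  have hsq : ∀ x : ℝ, HasDerivAt (fun x : ℝ => √(1 + x ^ 2)) (x / √(1 + x ^ 2)) x := fun x => by
    have := ((hasDerivAt_pow 2 x).const_add 1).sqrt (by positivity)
    convert! this using 1
    have : √(1 + x ^ 2) ≠ 0 := (Real.sqrt_pos.2 (by positivity)).ne'
    field_simp
    norm_num; ring
  have hsd : deriv (fun x : ℝ => √(1 + x ^ 2)) = fun x => x / √(1 + x ^ 2) :=
    funext fun x => (hsq x).deriv
  have hsb : ∀ x : ℝ, |x / √(1 + x ^ 2)| ≤ 1 := fun x => by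
    rw [abs_div, abs_of_nonneg (Real.sqrt_nonneg _)]
    refine div_le_one_of_le₀ (Real.abs_le_sqrt (by linarith)) (Real.sqrt_nonneg _)
  have hsL : LipBound 1 (fun x : ℝ => √(1 + x ^ 2)) :=
    lipBound_of_abs_deriv_le (fun x => (hsq x).differentiableAt) fun x => by rw [hsd]; exact hsb x
  have key := integral_sub_eq_integral_deriv_mul_cdf hid (g := fun x : ℝ => √(1 + x ^ 2))
    (fun x => (hsq x).differentiableAt) (by
      rw [hsd]
      exact continuous_id.div (by fun_prop) fun x => (Real.sqrt_pos.2 (by positivity)).ne') hsL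
  rw [hsd] at key
  obtain ⟨i1, v1⟩ := integral_indicator_abs_rpow h1 hl0
  obtain ⟨i2, v2⟩ := integral_indicator_Ioc_eq_intervalIntegral hs (h.intervalIntegrable h2 (-s) s)
  obtain ⟨i3, v3⟩ := integral_indicator_abs_rpow h1 hs
  have i0 : Integrable (Set.indicator (Set.Ioc (-l) l) (1 : ℝ → ℝ)) :=
    (integrable_indicator_iff measurableSet_Ioc).2 (integrable_const (1 : ℝ))
  have v0 : ∫ x, Set.indicator (Set.Ioc (-l) l) (1 : ℝ → ℝ) x = 2 * l := by
    rw [integral_indicator_one measurableSet_Ioc, Real.volume_real_Ioc_of_le (by linarith)]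
    ring
  have j1 := i1.const_mul (2 * A)
  have j2 := i2.const_mul (2 / l)
  have j3 := i3.const_mul (2 * e)
  have hbound : ∀ x : ℝ, x ≠ 0 → |Set.indicator (Set.Ioi 0) 1 x - cdf μ x| ≤
      Set.indicator (Set.Ioc (-l) l) (1 : ℝ → ℝ) x +
        2 * A * Set.indicator (Set.Ici l) (fun t => t ^ (-α)) |x| +
        2 / l * Set.indicator (Set.Ioc (-s) s) (fun x => |ε x| / |x| ^ (α - 1)) x +
        2 * e * Set.indicator (Set.Ici s) (fun t => t ^ (-α)) |x| := fun x hx => by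
    have p1 := indicator_Ici_abs_rpow_nonneg α l x
    have p3 := indicator_Ici_abs_rpow_nonneg α s x
    have p2 : 0 ≤ Set.indicator (Set.Ioc (-s) s) (fun x => |ε x| / |x| ^ (α - 1)) x :=
      Set.indicator_nonneg (fun x _ => by positivity) x
    have p0 : 0 ≤ Set.indicator (Set.Ioc (-l) l) (1 : ℝ → ℝ) x :=
      Set.indicator_nonneg (by simp) x
    have q2 := mul_nonneg (by positivity : 0 ≤ 2 / l) p2
    have q1 := mul_nonneg (by positivity : 0 ≤ 2 * A) p1
    have q3 := mul_nonneg (by positivity : 0 ≤ 2 * e) p3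
    by_cases hxl : x ∈ Set.Ioc (-l) l
    · rw [Set.indicator_of_mem hxl, Pi.one_apply]
      linarith [abs_indicator_sub_cdf_le_one μ x]
    · have hxl' : l ≤ |x| := by
        by_contra! hlt
        exact hxl ⟨(abs_lt.1 hlt).1, (abs_lt.1 hlt).2.le⟩
      have hb := h.abs_indicator_sub_cdf_le hA hβ hx
      rw [indicator_Ici_abs_rpow_of_le hxl']
      by_cases hxs : x ∈ Set.Ioc (-s) s
      · have e2 : |ε x| * |x| ^ (-α) ≤ 1 / l * (|ε x| / |x| ^ (α - 1)) := by
          rw [abs_div_abs_rpow_eq hx, one_div, inv_mul_eq_div, le_div_iff₀ hl0, mul_comm]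
          exact mul_le_mul_of_nonneg_right hxl' (by positivity)
        rw [Set.indicator_of_mem hxs]
        have e3 : 2 / l * (|ε x| / |x| ^ (α - 1)) = 2 * (1 / l * (|ε x| / |x| ^ (α - 1))) := by ring
        linarith
      · have hxs' : s ≤ |x| := by
          by_contra! hlt
          exact hxs ⟨(abs_lt.1 hlt).1, (abs_lt.1 hlt).2.le⟩
        rw [indicator_Ici_abs_rpow_of_le hxs']
        have := mul_le_mul_of_nonneg_right (he x hxs') (by positivity : 0 ≤ |x| ^ (-α))
        linarith
  have hmain := norm_integral_le_of_norm_le (((i0.add j1).add j2).add j3)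
    (f := fun x => x / √(1 + x ^ 2) * (Set.indicator (Set.Ioi 0) 1 x - cdf μ x)) (by
      filter_upwards [compl_mem_ae_iff.2 (measure_singleton (μ := volume) (0 : ℝ))] with x hx
      rw [norm_mul]
      refine (mul_le_of_le_one_left (norm_nonneg _) (hsb x)).trans ?_
      exact hbound x hx)
  have hval : ∫ x, (((Set.indicator (Set.Ioc (-l) l) (1 : ℝ → ℝ) +
      fun x => 2 * A * Set.indicator (Set.Ici l) (fun t => t ^ (-α)) |x|) +
      fun x => 2 / l * Set.indicator (Set.Ioc (-s) s) (fun x => |ε x| / |x| ^ (α - 1)) x) +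
      fun x => 2 * e * Set.indicator (Set.Ici s) (fun t => t ^ (-α)) |x|) x =
      2 * l + 2 * A * (2 * (l ^ (1 - α) / (α - 1))) + 2 / l * J +
        2 * e * (2 * (s ^ (1 - α) / (α - 1))) := by
    rw [integral_add' ((i0.add j1).add j2) j3, integral_add' (i0.add j1) j2, integral_add' i0 j1,
      integral_const_mul, integral_const_mul, integral_const_mul, v0, v1, v2, v3]
  rw [hval, ← key] at hmain
  have hle : ∫ y, |y| ∂μ ≤ ∫ y, √(1 + y ^ 2) ∂μ :=
    integral_mono hid.abs (hsL.integrable_comp hid) fun y => Real.abs_le_sqrt (by linarith)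
  have hm2 := (le_abs_self _).trans hmain
  have hz : √(1 + (0 : ℝ) ^ 2) = 1 := by norm_num
  rw [hz] at hm2
  have hpow : l ^ (1 - α) ≤ l :=
    (Real.rpow_le_one_of_one_le_of_nonpos hl1 (by linarith)).trans hl1
  have hα : 0 < α - 1 := by linarith
  have c1 : 2 * A * (2 * (l ^ (1 - α) / (α - 1))) ≤ 4 * A / (α - 1) * l := by
    have := mul_le_mul_of_nonneg_left hpow (by positivity : 0 ≤ 4 * A / (α - 1))
    refine le_trans (le_of_eq ?_) this
    ring
  have c2 : 2 / l * J ≤ 2 * l := by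
    rw [div_mul_eq_mul_div, div_le_iff₀ hl0]
    nlinarith
  have c3 : 2 * e * (2 * (s ^ (1 - α) / (α - 1))) = 4 / (α - 1) * (e * s ^ (1 - α)) := by ring
  -- 5 = 1 + 2 + 2: the value of √(1 + x²) at 0, which is at most l, the trivial part and the
  -- ε-part.
  have : (5 + 4 * A / (α - 1)) * l = 5 * l + 4 * A / (α - 1) * l := by ring
  linarith

/-- The difference of the two integrands is f'(x) ε(x) (sign x + β) |x|^(-α). Within s, |f'(x)| ≤ M
|x| produces the integral of |ε| |x|^(1-α); beyond s, |f'| ≤ B and |ε| ≤ e leave an integral of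
|x|^(-α), of order s^(1-α). -/
theorem HasNormalAttractionForm.abs_integral_sub_integral_mul_stableTail_le {α A β : ℝ} {ε : ℝ → ℝ}
    {μ : Measure ℝ} [IsProbabilityMeasure μ] (h : HasNormalAttractionForm α A β ε μ) (h1 : 1 < α)
    (h2 : α < 2) (hA : 0 < A) (hβ : β ∈ Set.Icc (-1 : ℝ) 1) {s e : ℝ} (hs : 0 < s)
    (he : ∀ x, s ≤ |x| → |ε x| ≤ e) {f : ℝ → ℝ} {B M : ℝ} (hf : ContDiff ℝ ∞ f)
    (hB : LipBound B f) (hM : SecondDiffBound M f) (h0 : f 0 = 0) (hd0 : deriv f 0 = 0) :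
    |∫ y, f y ∂μ - ∫ x, deriv f x * stableTail α A β x| ≤
      2 * M * (∫ x in (-s)..s, |ε x| / |x| ^ (α - 1)) + 4 * B / (α - 1) * (e * s ^ (1 - α)) := by
  have hid := h.integrable h1 hβ
  have hfd : Differentiable ℝ f := hf.differentiable (by simp)
  have hfc : Continuous (deriv f) := (contDiff_infty_iff_deriv.1 hf).2.continuous
  have hML := hM.lipBound_deriv hfd
  have hB0 := hB.nonneg
  have hM0 := hM.nonneg
  have he0 : 0 ≤ e := (abs_nonneg _).trans (he s (le_abs_self s))
  have key := integral_sub_eq_integral_deriv_mul_cdf hid hfd hfc hB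
  rw [h0, sub_zero] at key
  obtain ⟨i2, v2⟩ := integral_indicator_Ioc_eq_intervalIntegral hs (h.intervalIntegrable h2 (-s) s)
  obtain ⟨i3, v3⟩ := integral_indicator_abs_rpow h1 hs
  have j2 := i2.const_mul (2 * M)
  have j3 := i3.const_mul (2 * B * e)
  have hne : ∀ᵐ x : ℝ, x ≠ 0 := compl_mem_ae_iff.2 (measure_singleton (μ := volume) (0 : ℝ))
  have hpt : ∀ x : ℝ, x ≠ 0 →
      |deriv f x * (Set.indicator (Set.Ioi 0) 1 x - cdf μ x) - deriv f x * stableTail α A β x| ≤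
      2 * M * Set.indicator (Set.Ioc (-s) s) (fun x => |ε x| / |x| ^ (α - 1)) x +
        2 * B * e * Set.indicator (Set.Ici s) (fun t => t ^ (-α)) |x| := fun x hx => by
    have p3 := indicator_Ici_abs_rpow_nonneg α s x
    have p2 : 0 ≤ Set.indicator (Set.Ioc (-s) s) (fun x => |ε x| / |x| ^ (α - 1)) x :=
      Set.indicator_nonneg (fun x _ => by positivity) x
    have e1 : deriv f x * (Set.indicator (Set.Ioi 0) 1 x - cdf μ x) -
        deriv f x * stableTail α A β x = deriv f x * (ε x * (Real.sign x + β) * |x| ^ (-α)) := by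
      rw [h.indicator_sub_cdf hx, stableTail]
      ring
    have e2 : |deriv f x * (ε x * (Real.sign x + β) * |x| ^ (-α))| ≤
        |deriv f x| * (2 * (|ε x| * |x| ^ (-α))) := by
      rw [abs_mul, abs_mul, abs_mul, abs_of_nonneg (by positivity : 0 ≤ |x| ^ (-α))]
      refine mul_le_mul_of_nonneg_left ?_ (abs_nonneg _)
      have := mul_le_mul_of_nonneg_left (abs_sign_add_le hβ x)
        (by positivity : 0 ≤ |ε x| * |x| ^ (-α))
      linarith
    rw [e1]
    refine e2.trans ?_
    by_cases hxs : x ∈ Set.Ioc (-s) s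
    · rw [Set.indicator_of_mem hxs, abs_div_abs_rpow_eq hx]
      have q3 := mul_nonneg (by positivity : 0 ≤ 2 * B * e) p3
      have := hML x 0
      rw [hd0, sub_zero, sub_zero] at this
      have := mul_le_mul_of_nonneg_right this (by positivity : 0 ≤ 2 * (|ε x| * |x| ^ (-α)))
      linarith
    · have hxs' : s ≤ |x| := by
        by_contra! hlt
        exact hxs ⟨(abs_lt.1 hlt).1, (abs_lt.1 hlt).2.le⟩
      rw [indicator_Ici_abs_rpow_of_le hxs']
      have q2 := mul_nonneg (by positivity : 0 ≤ 2 * M) p2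
      have := mul_le_mul (hB.abs_deriv_le x) (mul_le_mul_of_nonneg_right (he x hxs')
        (by positivity : 0 ≤ |x| ^ (-α))) (by positivity) hB0
      linarith
  have it : Integrable (fun x => deriv f x * stableTail α A β x) := by
    refine ((integrable_min_one_abs_mul_rpow h1 h2).const_mul (max M B * (2 * A))).mono'
      (hfc.measurable.mul (measurable_stableTail α A β)).aestronglyMeasurable
      (Eventually.of_forall fun x => ?_)
    rw [norm_mul]
    exact norm_mul_stableTail_le hA.le hβ (LipBound.abs_le_mul_min hML hd0 hB.abs_deriv_le x)
  have hcm : Measurable fun x => Set.indicator (Set.Ioi 0) (1 : ℝ → ℝ) x - cdf μ x :=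
    (measurable_one.indicator measurableSet_Ioi).sub (monotone_cdf μ).measurable
  have idiff : Integrable (fun x => deriv f x * (Set.indicator (Set.Ioi 0) 1 x - cdf μ x) -
      deriv f x * stableTail α A β x) :=
    (j2.add j3).mono' ((hfc.measurable.mul hcm).sub
      (hfc.measurable.mul (measurable_stableTail α A β))).aestronglyMeasurable
      (hne.mono fun x hx => hpt x hx)
  have ic : Integrable (fun x => deriv f x * (Set.indicator (Set.Ioi 0) 1 x - cdf μ x)) := by
    refine (idiff.add it).congr (Eventually.of_forall fun x => ?_)
    simp
  rw [key, ← integral_sub ic it]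
  have := norm_integral_le_of_norm_le (f := fun x =>
    deriv f x * (Set.indicator (Set.Ioi 0) 1 x - cdf μ x) - deriv f x * stableTail α A β x)
    (j2.add j3) (hne.mono fun x hx => hpt x hx)
  rw [integral_add' j2 j3, integral_const_mul, integral_const_mul, v2, v3] at this
  refine this.trans (le_of_eq ?_)
  ring

/-! ### The cost of exchanging one summand -/

theorem abs_integral_le_integral_abs_id (μ : Measure ℝ) : |∫ x, x ∂μ| ≤ ∫ x, |x| ∂μ :=
  norm_integral_le_integral_norm (fun x : ℝ => x)

theorem LipBound.abs_integral_comp_sub_sub_le {f : ℝ → ℝ} {B : ℝ} {μ : Measure ℝ}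
    [IsProbabilityMeasure μ] (hid : Integrable (fun x : ℝ => x) μ) (hB : LipBound B f) (m : ℝ) :
    |∫ x, f (x - m) ∂μ - ∫ x, f x ∂μ| ≤ B * |m| := by
  rw [← integral_sub (hB.integrable_comp (Z := fun x : ℝ => x - m) (hid.sub (integrable_const m)))
    (hB.integrable_comp hid)]
  have := norm_integral_le_of_norm_le_const (μ := μ) (f := fun x => f (x - m) - f x) (C := B * |m|)
    (Eventually.of_forall fun x => (hB _ _).trans (by simp))
  simpa using this

/-- On the segment from x - m to x the derivative is at most M (|x| + |m|), because it vanishes at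
0. The plain Lipschitz estimate would lose the factor M. -/
theorem SecondDiffBound.abs_integral_comp_sub_sub_le {f : ℝ → ℝ} {B M : ℝ} {μ : Measure ℝ}
    [IsProbabilityMeasure μ] (hid : Integrable (fun x : ℝ => x) μ) (hM : SecondDiffBound M f)
    (hB : LipBound B f) (hf : Differentiable ℝ f) (hd0 : deriv f 0 = 0) (m : ℝ) :
    |∫ x, f (x - m) ∂μ - ∫ x, f x ∂μ| ≤ M * (∫ x, |x| ∂μ + |m|) * |m| := by
  have hpt : ∀ x, |f (x - m) - f x| ≤ M * (|x| + |m|) * |m| := fun x => by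
    have hd : ∀ z ∈ Set.Icc (-(|x| + |m|)) (|x| + |m|), ‖deriv f z‖ ≤ M * (|x| + |m|) := by
      intro z hz
      have := hM.lipBound_deriv hf z 0
      rw [hd0, sub_zero, sub_zero] at this
      exact this.trans (mul_le_mul_of_nonneg_left (abs_le.2 hz) hM.nonneg)
    have h1 : x - m ∈ Set.Icc (-(|x| + |m|)) (|x| + |m|) := abs_le.1 (abs_sub x m)
    have h2 : x ∈ Set.Icc (-(|x| + |m|)) (|x| + |m|) :=
      abs_le.1 (le_add_of_nonneg_right (abs_nonneg m))
    have := (convex_Icc _ _).norm_image_sub_le_of_norm_deriv_le (fun z _ => hf z) hd h2 h1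
    simpa using this
  have hi : Integrable (fun x => M * (|x| + |m|) * |m|) μ :=
    ((hid.abs.add (integrable_const _)).const_mul M).mul_const _
  rw [← integral_sub (hB.integrable_comp (Z := fun x : ℝ => x - m) (hid.sub (integrable_const m)))
    (hB.integrable_comp hid)]
  have := norm_integral_le_of_norm_le (f := fun x => f (x - m) - f x) hi
    (Eventually.of_forall hpt)
  rw [integral_mul_const, integral_const_mul, integral_add hid.abs (integrable_const _)] at this
  simpa using this

/-- Replacing the centred law by the stable law in one summand. -/
theorem IsStableLaw.exists_abs_integral_sub_integral_le_of_contDiff {α A β : ℝ} {ρ : Measure ℝ}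
    (h : IsStableLaw α (stableScale α A) β ρ) (h1 : 1 < α) (h2 : α < 2) (hA : 0 < A)
    (hβ : β ∈ Set.Icc (-1 : ℝ) 1) :
    ∃ C : ℝ, 0 ≤ C ∧ ∀ (ε : ℝ → ℝ) (μ : Measure ℝ), IsProbabilityMeasure μ →
      HasNormalAttractionForm α A β ε μ → ∀ s e : ℝ, 0 < s → (∀ x, s ≤ |x| → |ε x| ≤ e) →
      ∀ (f : ℝ → ℝ) (M w : ℝ), ContDiff ℝ ∞ f → LipBound 1 f → SecondDiffBound M f →
      |∫ x, f (w + (x - ∫ y, y ∂μ)) ∂μ - ∫ y, f (w + y) ∂ρ| ≤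
        C * (M * (1 + ∫ x in (-s)..s, |ε x| / |x| ^ (α - 1)) + e * s ^ (1 - α)) := by
  have := h.isProbabilityMeasure
  have hσ := stableScale_pos h1 h2 hA
  have hidρ := h.integrable h1 hσ
  obtain ⟨C, hC, hS⟩ := h.exists_abs_integral_sub_tail_le h1 h2 hA hβ
  have hα : 0 < α - 1 := by linarith
  set c₁ := 5 + 4 * A / (α - 1)
  have hc₁ : 0 < c₁ := by positivity
  -- C comes from the stable side, 2 from the tail comparison within s, 8 c₁² from the centring
  -- shift; 24 = 8 + 16 collects the terms in e from the tails and from the shift.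
  refine ⟨C + 2 + 8 * c₁ ^ 2 + 24 / (α - 1), by positivity,
    fun ε μ hμ hε s e hs he f M w hf hL hM => ?_⟩
  have hid := hε.integrable h1 hβ
  set J := ∫ x in (-s)..s, |ε x| / |x| ^ (α - 1) with hJ
  have hJ0 : 0 ≤ J := intervalIntegral.integral_nonneg (by linarith) fun x _ => by positivity
  have he0 : 0 ≤ e := (abs_nonneg _).trans (he s (le_abs_self s))
  have hE0 : 0 ≤ e * s ^ (1 - α) := by positivity
  have hM0 := hM.nonneg
  set E := e * s ^ (1 - α)
  set m := ∫ y, y ∂μ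
  have hfd : Differentiable ℝ f := hf.differentiable (by simp)
  -- Both variables being centred, subtracting the affine part at w does not change the difference
  -- of expectations. Both g and g' vanish at 0, and g is 2-Lipschitz with the same second
  -- differences as f.
  set g : ℝ → ℝ := fun x => f (w + x) - f w - deriv f w * x with hg
  have hgd : ∀ x, HasDerivAt g (deriv f (w + x) - deriv f w) x := fun x => by
    have e1 := (hfd (w + x)).hasDerivAt.comp_const_add w x
    have e2 := (e1.sub_const (f w)).sub ((hasDerivAt_id x).const_mul (deriv f w))
    convert! e2 using 1
    simp
  have hgs : ContDiff ℝ ∞ g := by fun_prop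
  have hgdiff : Differentiable ℝ g := fun x => (hgd x).differentiableAt
  have hg0 : g 0 = 0 := by simp [hg]
  have hgd0 : deriv g 0 = 0 := by rw [(hgd 0).deriv]; simp
  have hgL : LipBound 2 g := lipBound_of_abs_deriv_le hgdiff fun x => by
    rw [(hgd x).deriv]
    have a1 := hL.abs_deriv_le (w + x)
    have a2 := hL.abs_deriv_le w
    exact (abs_sub _ _).trans (by linarith)
  have hgM : SecondDiffBound M g := fun x a b => by
    have := hM (w + x) a b
    refine le_trans (le_of_eq ?_) this
    simp only [hg]
    congr 1
    ring_nf
  have t1 := hS g 2 M hgs hgL hgM hg0 hgd0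
  have t2 := hε.abs_integral_sub_integral_mul_stableTail_le h1 h2 hA hβ hs he hgs hgL hgM hg0 hgd0
  have t3 : |∫ x, g (x - m) ∂μ - ∫ x, g x ∂μ| ≤ 8 * c₁ ^ 2 * (M * (1 + J)) + 16 / (α - 1) * E := by
    have ha := hε.integral_abs_le h1 h2 hA hβ hs he
    have hm := abs_integral_le_integral_abs_id μ
    have hsq : √(1 + J) * √(1 + J) = 1 + J := Real.mul_self_sqrt (by linarith)
    have hsq0 := Real.sqrt_nonneg (1 + J)
    have b1 := hgL.abs_integral_comp_sub_sub_le hid m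
    have b2 := hgM.abs_integral_comp_sub_sub_le hid hgL hgdiff hgd0 m
    set a := ∫ x, |x| ∂μ
    have hα4 : 0 ≤ 4 / (α - 1) * E := by positivity
    have e16 : 16 / (α - 1) * E = 4 * (4 / (α - 1) * E) := by ring
    rw [e16]
    -- If √(1 + J) dominates the moment bound, the quadratic shift estimate gives 8 c₁² M (1 + J).
    -- Otherwise the mean is of order E, and the linear estimate is enough.
    rcases le_total (4 / (α - 1) * E) (c₁ * √(1 + J)) with hc | hc
    · refine b2.trans ?_
      have a0 : a ≤ 2 * (c₁ * √(1 + J)) := by linarith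
      have a1 : (a + |m|) * |m| ≤ (2 * a) * a := by
        apply mul_le_mul <;> linarith [abs_nonneg m]
      have a2 : (2 * a) * a ≤ (2 * (2 * (c₁ * √(1 + J)))) * (2 * (c₁ * √(1 + J))) := by
        have : 0 ≤ a := (abs_nonneg m).trans hm
        apply mul_le_mul <;> linarith
      have a3 : (2 * (2 * (c₁ * √(1 + J)))) * (2 * (c₁ * √(1 + J))) = 8 * c₁ ^ 2 * (1 + J) := by
        linear_combination 8 * c₁ ^ 2 * hsq
      have := mul_le_mul_of_nonneg_left (a1.trans (a2.trans a3.le)) hM0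
      linarith
    · have : 0 ≤ 8 * c₁ ^ 2 * (M * (1 + J)) := by positivity
      linarith
  have i1 : Integrable (fun x => f (w + (x - m))) μ :=
    hL.integrable_comp (Z := fun x : ℝ => w + (x - m))
      ((integrable_const w).add (hid.sub (integrable_const m)))
  have i2 : Integrable (fun y => f (w + y)) ρ :=
    hL.integrable_comp (Z := fun x : ℝ => w + x) ((integrable_const w).add hidρ)
  have k1 : ∫ x, g (x - m) ∂μ = ∫ x, f (w + (x - m)) ∂μ - f w := by
    have j1 : Integrable (fun x => f (w + (x - m)) - f w) μ := i1.sub (integrable_const _)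
    have j2 : Integrable (fun x : ℝ => x - m) μ := hid.sub (integrable_const m)
    simp only [hg]
    rw [integral_sub j1 (j2.const_mul _), integral_sub i1 (integrable_const _), integral_const_mul,
      integral_sub hid (integrable_const m)]
    simp [m]
  have k2 : ∫ y, g y ∂ρ = ∫ y, f (w + y) ∂ρ - f w := by
    have j1 : Integrable (fun x => f (w + x) - f w) ρ := i2.sub (integrable_const _)
    simp only [hg]
    rw [integral_sub j1 (hidρ.const_mul _), integral_sub i2 (integrable_const _),
      integral_const_mul, h.integral_eq_zero h1 hσ]
    simp
  have key : ∫ x, f (w + (x - m)) ∂μ - ∫ y, f (w + y) ∂ρ =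
      (∫ x, g (x - m) ∂μ - ∫ x, g x ∂μ) + (∫ x, g x ∂μ - ∫ x, deriv g x * stableTail α A β x) -
        (∫ y, g y ∂ρ - ∫ x, deriv g x * stableTail α A β x) := by
    rw [k1, k2]; ring
  rw [key]
  refine (abs_sub _ _).trans ((add_le_add_left (abs_add_le _ _) _).trans ?_)
  have z1 : 0 ≤ M * J := by positivity
  have z2 : 0 ≤ C * (M * J) := by positivity
  have z3 : 0 ≤ (C + 2 + 8 * c₁ ^ 2) * E := by positivity
  have z4 : 0 ≤ 24 / (α - 1) * (M * (1 + J)) := by positivity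
  have z5 : 4 * 2 / (α - 1) * E + 16 / (α - 1) * E = 24 / (α - 1) * E := by ring
  have z6 : 2 * M * J ≤ 2 * (M * (1 + J)) := by linarith
  have z7 : C * M ≤ C * (M * (1 + J)) := by linarith
  linarith

/-- Mollifying f keeps both bounds and moves each expectation by at most δ / 2. -/
theorem IsStableLaw.exists_abs_integral_sub_integral_le {α A β : ℝ} {ρ : Measure ℝ}
    (h : IsStableLaw α (stableScale α A) β ρ) (h1 : 1 < α) (h2 : α < 2) (hA : 0 < A)
    (hβ : β ∈ Set.Icc (-1 : ℝ) 1) :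
    ∃ C : ℝ, 0 ≤ C ∧ ∀ (ε : ℝ → ℝ) (μ : Measure ℝ), IsProbabilityMeasure μ →
      HasNormalAttractionForm α A β ε μ → ∀ s e : ℝ, 0 < s → (∀ x, s ≤ |x| → |ε x| ≤ e) →
      ∀ (f : ℝ → ℝ) (M w : ℝ), LipBound 1 f → SecondDiffBound M f →
      |∫ x, f (w + (x - ∫ y, y ∂μ)) ∂μ - ∫ y, f (w + y) ∂ρ| ≤
        C * (M * (1 + ∫ x in (-s)..s, |ε x| / |x| ^ (α - 1)) + e * s ^ (1 - α)) := by
  have := h.isProbabilityMeasure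
  have hidρ := h.integrable h1 (stableScale_pos h1 h2 hA)
  obtain ⟨C, hC, hS⟩ := h.exists_abs_integral_sub_integral_le_of_contDiff h1 h2 hA hβ
  refine ⟨C, hC, fun ε μ hμ hε s e hs he f M w hL hM => le_of_forall_pos_le_add fun δ hδ => ?_⟩
  have hid := hε.integrable h1 hβ
  obtain ⟨g, hg, hgL, hgf, hgM⟩ := hL.exists_smooth (half_pos hδ)
  have key := hS ε μ hμ hε s e hs he g M w hg hgL (hgM M hM)
  set m := ∫ y, y ∂μ
  have close : ∀ (Q : Measure ℝ) [IsProbabilityMeasure Q] (Z : ℝ → ℝ), Integrable Z Q →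
      |∫ x, g (Z x) ∂Q - ∫ x, f (Z x) ∂Q| ≤ δ / 2 := by
    intro Q _ Z hZ
    rw [← integral_sub (hgL.integrable_comp hZ) (hL.integrable_comp hZ)]
    have := norm_integral_le_of_norm_le_const (μ := Q) (f := fun x => g (Z x) - f (Z x))
      (C := δ / 2) (Eventually.of_forall fun x => (hgf _).trans (by simp))
    simpa using this
  have c1 := close μ (fun x => w + (x - m)) ((integrable_const w).add (hid.sub (integrable_const m)))
  have c2 := close ρ (fun y => w + y) ((integrable_const w).add hidρ)
  rw [abs_le] at c1 c2 key ⊢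
  constructor <;> linarith [c1.1, c1.2, c2.1, c2.2, key.1, key.2]

/-- A one-summand bound for Lipschitz functions without smoothness. -/
theorem IsStableLaw.exists_abs_integral_sub_integral_le_of_lipBound {α A β : ℝ} {ρ : Measure ℝ}
    (h : IsStableLaw α (stableScale α A) β ρ) (h1 : 1 < α) (h2 : α < 2) (hA : 0 < A)
    (hβ : β ∈ Set.Icc (-1 : ℝ) 1) :
    ∃ C : ℝ, 0 ≤ C ∧ ∀ (ε : ℝ → ℝ) (μ : Measure ℝ), IsProbabilityMeasure μ →
      HasNormalAttractionForm α A β ε μ → ∀ s e : ℝ, 0 < s → (∀ x, s ≤ |x| → |ε x| ≤ e) →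
      ∀ (f : ℝ → ℝ) (w : ℝ), LipBound 1 f →
      |∫ x, f (w + (x - ∫ y, y ∂μ)) ∂μ - ∫ y, f (w + y) ∂ρ| ≤
        C * ((1 + ∫ x in (-s)..s, |ε x| / |x| ^ (α - 1)) + e * s ^ (1 - α)) := by
  have := h.isProbabilityMeasure
  have hidρ := h.integrable h1 (stableScale_pos h1 h2 hA)
  have hα : 0 < α - 1 := by linarith
  have hb0 : 0 ≤ ∫ y, |y| ∂ρ := integral_nonneg fun y => abs_nonneg y
  refine ⟨2 * (5 + 4 * A / (α - 1)) + 8 / (α - 1) + ∫ y, |y| ∂ρ, by positivity,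
    fun ε μ hμ hε s e hs he f w hL => ?_⟩
  have hid := hε.integrable h1 hβ
  have ha := hε.integral_abs_le h1 h2 hA hβ hs he
  have hm := abs_integral_le_integral_abs_id μ
  set J := ∫ x in (-s)..s, |ε x| / |x| ^ (α - 1) with hJ
  have hJ0 : 0 ≤ J := intervalIntegral.integral_nonneg (by linarith) fun x _ => by positivity
  have he0 : 0 ≤ e := (abs_nonneg _).trans (he s (le_abs_self s))
  have hE0 : 0 ≤ e * s ^ (1 - α) := by positivity
  set E := e * s ^ (1 - α)
  set m := ∫ y, y ∂μ
  set b := ∫ y, |y| ∂ρ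
  have close : ∀ (Q : Measure ℝ) [IsProbabilityMeasure Q] (Z : ℝ → ℝ), Integrable Z Q →
      |∫ x, f (w + Z x) ∂Q - f w| ≤ ∫ x, |Z x| ∂Q := by
    intro Q _ Z hZ
    have hi := hL.integrable_comp (Z := fun x => w + Z x) ((integrable_const w).add hZ)
    have e1 : ∫ x, f (w + Z x) ∂Q - f w = ∫ x, (f (w + Z x) - f w) ∂Q := by
      rw [integral_sub hi (integrable_const _)]; simp
    rw [e1]
    exact norm_integral_le_of_norm_le (f := fun x => f (w + Z x) - f w) hZ.abs
      (Eventually.of_forall fun x => (hL _ _).trans (by simp))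
  have c1 := close μ (fun x => x - m) (hid.sub (integrable_const m))
  have c2 := close ρ (fun y => y) hidρ
  have c3 : ∫ x, |x - m| ∂μ ≤ ∫ x, |x| ∂μ + |m| := by
    have : ∫ x, |x| ∂μ + |m| = ∫ x, (|x| + |m|) ∂μ := by
      rw [integral_add hid.abs (integrable_const _)]; simp
    rw [this]
    exact integral_mono (hid.sub (integrable_const m)).abs (hid.abs.add (integrable_const _))
      fun x => abs_sub x m
  have hsq : √(1 + J) ≤ 1 + J := Real.sqrt_le_iff.2 ⟨by linarith, by nlinarith⟩
  have c4 := mul_le_mul_of_nonneg_left hsq (by positivity : 0 ≤ 5 + 4 * A / (α - 1))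
  have z1 : 0 ≤ (2 * (5 + 4 * A / (α - 1)) + b) * E := by positivity
  have z2 : 0 ≤ 8 / (α - 1) * (1 + J) + b * J := by positivity
  have z3 : 8 / (α - 1) * E = 2 * (4 / (α - 1) * E) := by ring
  have c5 : |∫ x, f (w + (x - m)) ∂μ - ∫ y, f (w + y) ∂ρ| ≤
      |∫ x, f (w + (x - m)) ∂μ - f w| + |∫ y, f (w + y) ∂ρ - f w| := by
    refine le_trans (le_of_eq ?_) (abs_sub _ _)
    congr 1; ring
  linarith

/-! ### Lindeberg's replacement and the sum of the errors -/

/-- Comparison with the integral of t^(-p), each step being Bernoulli's inequality for the concave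
power 1 - p. The term j = 0 vanishes by the convention `0 ^ (-p) = 0` for p ≠ 0. -/
theorem sum_range_succ_rpow_neg_le {p : ℝ} (h0 : 0 < p) (h1 : p < 1) (n : ℕ) :
    ∑ j ∈ Finset.range (n + 1), (j : ℝ) ^ (-p) ≤ 1 / (1 - p) * (n : ℝ) ^ (1 - p) := by
  have hp : 0 < 1 - p := by linarith
  induction n with
  | zero => simp [Real.zero_rpow (neg_ne_zero.2 h0.ne'), Real.zero_rpow hp.ne']
  | succ n ih =>
    rw [Finset.sum_range_succ]
    have hn : (0 : ℝ) < ((n + 1 : ℕ) : ℝ) := by positivity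
    set N : ℝ := ((n + 1 : ℕ) : ℝ) with hN
    have e1 : (n : ℝ) = N * (1 + -(1 / N)) := by
      field_simp
      rw [hN]; push_cast; ring
    have hN1 : 1 / N ≤ 1 := by
      rw [div_le_one hn, hN]; push_cast; linarith [(n.cast_nonneg : (0 : ℝ) ≤ n)]
    have e2 := rpow_one_add_le_one_add_mul_self (s := -(1 / N)) (by linarith) hp.le
      (by linarith)
    have e3 : (n : ℝ) ^ (1 - p) ≤ N ^ (1 - p) * (1 + (1 - p) * -(1 / N)) := by
      rw [e1, Real.mul_rpow hn.le (by linarith)]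
      exact mul_le_mul_of_nonneg_left e2 (by positivity)
    have e4 : N ^ (-p) = N ^ (1 - p) / N := by
      rw [Real.rpow_sub hn, Real.rpow_neg hn.le, Real.rpow_one]
      field_simp
    have e5 := mul_le_mul_of_nonneg_left e3 (by positivity : 0 ≤ 1 / (1 - p))
    have e6 : 1 / (1 - p) * (N ^ (1 - p) * (1 + (1 - p) * -(1 / N))) =
        1 / (1 - p) * N ^ (1 - p) - N ^ (1 - p) / N := by
      field_simp
      ring
    rw [e4]
    linarith

section
variable {Ω : Type*} [MeasurableSpace Ω] {P : Measure Ω} [IsProbabilityMeasure P] {X : ℕ → Ω → ℝ}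

theorem LipBound.integral_comp_add_of_indepFun {f : ℝ → ℝ} {B : ℝ} (hf : LipBound B f)
    {U V : Ω → ℝ} (hU : Measurable U) (hV : Measurable V) (hUi : Integrable U P)
    (hVi : Integrable V P) (hUV : IndepFun U V P) (m : ℝ) :
    ∫ w, f (U w + (V w - m)) ∂P = ∫ w, ∫ x, f (U w + (x - m)) ∂(P.map V) ∂P := by
  have := Measure.isProbabilityMeasure_map (μ := P) hU.aemeasurable
  have := Measure.isProbabilityMeasure_map (μ := P) hV.aemeasurable
  have hc := hf.continuous
  have hp : Measurable fun w => (U w, V w) := hU.prodMk hV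
  have hi : Integrable (fun w => f (U w + (V w - m))) P :=
    hf.integrable_comp (Z := fun w => U w + (V w - m)) (hUi.add (hVi.sub (integrable_const m)))
  have hfm : AEStronglyMeasurable (fun p : ℝ × ℝ => f (p.1 + (p.2 - m)))
      (P.map fun w => (U w, V w)) := by
    have : Continuous (fun p : ℝ × ℝ => f (p.1 + (p.2 - m))) := by fun_prop
    exact this.aestronglyMeasurable
  have hprod := (indepFun_iff_map_prod_eq_prod_map_map hU.aemeasurable hV.aemeasurable).1 hUV
  have hi2 := (integrable_map_measure hfm hp.aemeasurable).2 hi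
  have e1 := integral_map hp.aemeasurable hfm
  rw [hprod] at e1 hi2
  rw [integral_prod _ hi2] at e1
  rw [← e1, integral_map hU.aemeasurable]
  have hl : LipBound B (fun u => ∫ x, f (u + (x - m)) ∂(P.map V)) := by
    refine LipBound.integral (fun u => ?_) fun x u v => ?_
    · refine hf.integrable_comp (Z := fun x : ℝ => u + (x - m)) ((integrable_const u).add
        (Integrable.sub ?_ (integrable_const m)))
      exact (integrable_map_measure (g := fun x : ℝ => x) (by fun_prop) hV.aemeasurable).2 hVi
    · refine (hf _ _).trans (le_of_eq ?_)
      congr 2; ring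
  exact hl.continuous.aestronglyMeasurable

/-- Lindeberg's replacement argument for Lipschitz test functions. -/
theorem abs_integral_comp_sum_sub_le (hX : ∀ i, Measurable (X i)) (hXi : iIndepFun X P)
    (hXd : ∀ i, IdentDistrib (X i) (X 0) P P) (hint : Integrable (X 0) P) {ρ : Measure ℝ} {m : ℝ}
    (n : ℕ) : ∀ (f : ℕ → ℝ → ℝ) (D : ℕ → ℝ), (∀ j, LipBound 1 (f j)) →
    (∀ j x, f (j + 1) x = ∫ y, f j (x + y) ∂ρ) →
    (∀ j w, |∫ x, f j (w + (x - m)) ∂(P.map (X 0)) - ∫ y, f j (w + y) ∂ρ| ≤ D j) →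
    |∫ w, f 0 (∑ i ∈ Finset.range n, X i w - n * m) ∂P - f n 0| ≤
      ∑ j ∈ Finset.range n, D j := by
  induction n with
  | zero => intro f D _ _ _; simp
  | succ n ih =>
    intro f D hf hr hD
    have hXint : ∀ i, Integrable (X i) P := fun i => (hXd i).integrable_iff.2 hint
    have hUm : Measurable fun w => ∑ i ∈ Finset.range n, X i w - n * m :=
      (Finset.measurable_sum _ fun i _ => hX i).sub_const _
    have hUi : Integrable (fun w => ∑ i ∈ Finset.range n, X i w - n * m) P :=
      (integrable_finsetSum _ fun i _ => hXint i).sub (integrable_const _)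
    have hind : IndepFun (fun w => ∑ i ∈ Finset.range n, X i w - n * m) (X n) P := by
      have := hXi.indepFun_sum_range_succ hX n
      have := this.comp (φ := fun x => x - n * m) (ψ := id) (by fun_prop) measurable_id
      convert! this using 1
      ext w
      simp
    -- The last summand is exchanged first, being independent of the sum of the others. This turns f
    -- 0 into f 1, and the induction hypothesis applies to the shifted sequences of functions and
    -- errors.
    have e1 := (hf 0).integral_comp_add_of_indepFun hUm (hX n) hUi (hXint n) hind m
    rw [(hXd n).map_eq] at e1
    have e2 : ∀ w, ∑ i ∈ Finset.range (n + 1), X i w - (n + 1 : ℕ) * m =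
        (∑ i ∈ Finset.range n, X i w - n * m) + (X n w - m) := fun w => by
      rw [Finset.sum_range_succ]; push_cast; ring
    have := Measure.isProbabilityMeasure_map (μ := P) (hX 0).aemeasurable
    have hl : LipBound 1 (fun u => ∫ x, f 0 (u + (x - m)) ∂(P.map (X 0))) := by
      refine LipBound.integral (fun u => ?_) fun x u v => ?_
      · refine (hf 0).integrable_comp (Z := fun x : ℝ => u + (x - m)) ((integrable_const u).add
          (Integrable.sub ?_ (integrable_const m)))
        exact (integrable_map_measure (g := fun x : ℝ => x) (by fun_prop)
          (hX 0).aemeasurable).2 hint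
      · refine (hf 0 _ _).trans (le_of_eq ?_)
        congr 2; ring
    have e3 : |∫ w, f 0 (∑ i ∈ Finset.range (n + 1), X i w - (n + 1 : ℕ) * m) ∂P -
        ∫ w, f 1 (∑ i ∈ Finset.range n, X i w - n * m) ∂P| ≤ D 0 := by
      simp_rw [e2]
      rw [e1, ← integral_sub (hl.integrable_comp hUi) ((hf 1).integrable_comp hUi)]
      have := norm_integral_le_of_norm_le_const (μ := P) (f := fun w =>
        ∫ x, f 0 (∑ i ∈ Finset.range n, X i w - n * m + (x - m)) ∂(P.map (X 0)) -
          f 1 (∑ i ∈ Finset.range n, X i w - n * m)) (C := D 0) (Eventually.of_forall fun w => by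
            rw [hr 0]; exact hD 0 _)
      simpa using this
    have e4 := ih (fun j => f (j + 1)) (fun j => D (j + 1)) (fun j => hf _) (fun j x => hr _ x)
      fun j w => hD _ w
    rw [Finset.sum_range_succ']
    simp only [zero_add] at e4
    rw [abs_le] at e3 e4 ⊢
    constructor <;> linarith [e3.1, e3.2, e4.1, e4.2]

end

/-- One more copy of Y raises the scale from j^(1/α) to (j + 1)^(1/α), because the α-th powers of
scales add. The case j = 0 is separate since strict stability is stated for positive factors. -/
theorem IsStableLaw.integral_comp_add_rpow_succ {α σ β : ℝ} {ρ : Measure ℝ}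
    (h : IsStableLaw α σ β ρ) (hα : 1 < α) (hσ : 0 < σ) {H : ℝ → ℝ} {B : ℝ} (hH : LipBound B H)
    (j : ℕ) (x : ℝ) :
    ∫ y, H (x + ((j + 1 : ℕ) : ℝ) ^ (1 / α) * y) ∂ρ =
      ∫ z, ∫ y, H (x + z + (j : ℝ) ^ (1 / α) * y) ∂ρ ∂ρ := by
  have := h.isProbabilityMeasure
  have hid := h.integrable hα hσ
  rcases Nat.eq_zero_or_pos j with rfl | hj
  · have : 1 / α ≠ 0 := by positivity
    simp [Real.zero_rpow (inv_ne_zero (by positivity : α ≠ 0))]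
  · have hj' : (0 : ℝ) < j := by exact_mod_cast hj
    have hr : ((1 : ℝ) ^ α + ((j : ℝ) ^ (1 / α)) ^ α) = (j + 1 : ℕ) := by
      rw [Real.one_rpow, ← Real.rpow_mul hj'.le, one_div, inv_mul_cancel₀ (by positivity),
        Real.rpow_one]
      push_cast; ring
    have hc := hH.continuous
    have := h.integral_integral_comp_add (r := 1) (s := (j : ℝ) ^ (1 / α)) (by linarith) hσ.le
      one_pos (by positivity) (f := fun z => H (x + z)) (by fun_prop)
      (hH.integrable_comp (Z := fun y : ℝ => x + _ * y) ((integrable_const x).add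
        (hid.const_mul _)))
    rw [hr] at this
    simpa only [one_mul, add_assoc] using this

theorem IsStableLaw.exists_abs_integral_comp_sum_sub_le.{u} {α A β : ℝ} {ρ : Measure ℝ}
    (h : IsStableLaw α (stableScale α A) β ρ) (h1 : 1 < α) (h2 : α < 2) (hA : 0 < A)
    (hβ : β ∈ Set.Icc (-1 : ℝ) 1) :
    ∃ C : ℝ, 0 ≤ C ∧ ∀ (Ω : Type u) (_ : MeasurableSpace Ω) (P : Measure Ω)
      (_ : IsProbabilityMeasure P) (X : ℕ → Ω → ℝ) (ε : ℝ → ℝ), (∀ i, Measurable (X i)) →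
      iIndepFun X P → (∀ i, IdentDistrib (X i) (X 0) P P) →
      HasNormalAttractionForm α A β ε (P.map (X 0)) →
      ∀ s e : ℝ, 0 < s → (∀ x, s ≤ |x| → |ε x| ≤ e) → ∀ H : ℝ → ℝ, LipBound 1 H →
      ∀ n : ℕ, 1 ≤ n →
      |∫ w, H (∑ i ∈ Finset.range n, X i w - n * ∫ w, X 0 w ∂P) ∂P -
          ∫ y, H ((n : ℝ) ^ (1 / α) * y) ∂ρ| ≤
        C * ((n : ℝ) ^ (1 - 1 / α) * (1 + ∫ x in (-s)..s, |ε x| / |x| ^ (α - 1)) +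
          n * (e * s ^ (1 - α))) := by
  have := h.isProbabilityMeasure
  have hσ := stableScale_pos h1 h2 hA
  have hidρ := h.integrable h1 hσ
  obtain ⟨C₁, hC₁, hS⟩ := h.exists_secondDiffBound h1 hσ
  obtain ⟨C₂, hC₂, hT⟩ := h.exists_abs_integral_sub_integral_le h1 h2 hA hβ
  obtain ⟨C₃, hC₃, hU⟩ := h.exists_abs_integral_sub_integral_le_of_lipBound h1 h2 hA hβ
  have hp0 : 0 < 1 / α := by positivity
  have hp1 : 1 / α < 1 := by rw [div_lt_one (by linarith)]; exact h1
  have hp2 : 0 < 1 - 1 / α := by linarith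
  refine ⟨C₂ * C₁ * (1 / (1 - 1 / α)) + C₃ + C₂, by positivity,
    fun Ω _ P _ X ε hX hXi hXd hε s e hs he H hH n hn => ?_⟩
  have hμ := Measure.isProbabilityMeasure_map (μ := P) (hX 0).aemeasurable
  have hidμ := hε.integrable h1 hβ
  have hint : Integrable (X 0) P :=
    (integrable_map_measure (g := fun x : ℝ => x) (by fun_prop) (hX 0).aemeasurable).1 hidμ
  have hmean : ∫ y, y ∂(P.map (X 0)) = ∫ w, X 0 w ∂P :=
    integral_map (f := fun x : ℝ => x) (hX 0).aemeasurable (by fun_prop)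
  have hT' := hT ε _ hμ hε s e hs he
  have hU' := hU ε _ hμ hε s e hs he
  rw [hmean] at hT' hU'
  set m := ∫ w, X 0 w ∂P
  set J := ∫ x in (-s)..s, |ε x| / |x| ^ (α - 1) with hJ
  have hJ0 : 0 ≤ J := intervalIntegral.integral_nonneg (by linarith) fun x _ => by positivity
  have he0 : 0 ≤ e := (abs_nonneg _).trans (he s (le_abs_self s))
  have hE0 : 0 ≤ e * s ^ (1 - α) := by positivity
  set E := e * s ^ (1 - α)
  let f : ℕ → ℝ → ℝ := fun j x => ∫ y, H (x + (j : ℝ) ^ (1 / α) * y) ∂ρ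
  have hf0 : ∀ x, f 0 x = H x := fun x => by
    simp [f, Real.zero_rpow (inv_ne_zero (by positivity : α ≠ 0))]
  have hf : ∀ j, LipBound 1 (f j) := fun j => by
    refine LipBound.integral (fun x => hH.integrable_comp
      (Z := fun y : ℝ => x + (j : ℝ) ^ (1 / α) * y)
      ((integrable_const x).add (hidρ.const_mul _))) fun y u v => ?_
    refine (hH _ _).trans (le_of_eq ?_)
    congr 2; ring
  -- The exchange with j = 0 sees H unaveraged, without a second-difference bound, so its error is
  -- added separately from the Lipschitz estimate; the power j ^ (-(1 / α)) is 0 there.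
  have key := abs_integral_comp_sum_sub_le hX hXi hXd hint (ρ := ρ) (m := m) n f
    (fun j => C₂ * (C₁ * (j : ℝ) ^ (-(1 / α)) * (1 + J) + E) +
      if j = 0 then C₃ * ((1 + J) + E) else 0) hf
    (fun j x => h.integral_comp_add_rpow_succ h1 hσ hH j x) fun j w => by
      rcases Nat.eq_zero_or_pos j with rfl | hj
      · have := hU' (f 0) w (hf 0)
        have q : 0 ≤ C₂ * (C₁ * ((0 : ℕ) : ℝ) ^ (-(1 / α)) * (1 + J) + E) := by positivity
        simp only [if_true]
        linarith
      · have hj' : (0 : ℝ) < j := by exact_mod_cast hj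
        have := hT' (f j) (C₁ / (j : ℝ) ^ (1 / α)) w (hf j) (hS H _ hH (by positivity))
        rw [if_neg hj.ne', add_zero, Real.rpow_neg hj'.le, ← div_eq_mul_inv]
        exact this
  have hfn : f n 0 = ∫ y, H ((n : ℝ) ^ (1 / α) * y) ∂ρ := by simp [f]
  simp_rw [hf0] at key
  rw [hfn] at key
  refine key.trans ?_
  -- The indices are j < n, so the power sum is bounded at n - 1 and then enlarged to n; the
  -- separate first error is absorbed by n^(1-1/α) ≥ 1 and n ≥ 1.
  obtain ⟨k, rfl⟩ : ∃ k, n = k + 1 := ⟨n - 1, by omega⟩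
  rw [Finset.sum_add_distrib, Finset.sum_ite_eq' (Finset.range (k + 1)) 0, if_pos (by simp),
    ← Finset.mul_sum, Finset.sum_add_distrib, ← Finset.sum_mul, ← Finset.mul_sum,
    Finset.sum_const, Finset.card_range, nsmul_eq_mul]
  have hk : (k : ℝ) ≤ (k + 1 : ℕ) := by push_cast; linarith
  have hk1 : (1 : ℝ) ≤ (k + 1 : ℕ) := by push_cast; linarith [(k.cast_nonneg : (0 : ℝ) ≤ k)]
  have s1 := (sum_range_succ_rpow_neg_le hp0 hp1 k).trans
    (mul_le_mul_of_nonneg_left (Real.rpow_le_rpow k.cast_nonneg hk hp2.le)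
      (by positivity : 0 ≤ 1 / (1 - 1 / α)))
  have s2 : (1 : ℝ) ≤ ((k + 1 : ℕ) : ℝ) ^ (1 - 1 / α) := Real.one_le_rpow hk1 hp2.le
  set N : ℝ := ((k + 1 : ℕ) : ℝ)
  set T := N ^ (1 - 1 / α)
  have r1 := mul_le_mul_of_nonneg_left s1 (by positivity : 0 ≤ C₂ * C₁ * (1 + J))
  have r2 := mul_le_mul_of_nonneg_left s2 (by positivity : 0 ≤ C₃ * (1 + J))
  have r3 := mul_le_mul_of_nonneg_left hk1 (by positivity : 0 ≤ C₃ * E)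
  have r4 : 0 ≤ C₂ * C₁ * (1 / (1 - 1 / α)) * (N * E) := by positivity
  have r5 : 0 ≤ C₂ * (T * (1 + J)) := by positivity
  linarith

/-! ### Rescaling to the Wasserstein bound -/

theorem IsStableLaw.exists_wassersteinDist_le.{u} {α A β : ℝ} {ν : Measure ℝ}
    (h : IsStableLaw α 1 β ν) (h1 : 1 < α) (h2 : α < 2) (hA : 0 < A)
    (hβ : β ∈ Set.Icc (-1 : ℝ) 1) :
    ∃ C : ℝ, ∀ (Ω : Type u) (_ : MeasurableSpace Ω) (P : Measure Ω)
      (_ : IsProbabilityMeasure P) (X : ℕ → Ω → ℝ) (ε : ℝ → ℝ), (∀ i, Measurable (X i)) →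
      iIndepFun X P → (∀ i, IdentDistrib (X i) (X 0) P P) →
      HasNormalAttractionForm α A β ε (P.map (X 0)) → ∀ n : ℕ, 1 ≤ n →
        wassersteinDist (P.map (normalizedSum P α A X n)) ν ≤
          ENNReal.ofReal (C *
            ((n : ℝ) ^ (1 - 2 / α) *
                (1 + ∫ x in (-(stableScale α A * (n : ℝ) ^ (1 / α)))..
                      (stableScale α A * (n : ℝ) ^ (1 / α)), |ε x| / |x| ^ (α - 1)) +
              sSup ((fun x : ℝ => |ε x|) ''
                {x : ℝ | stableScale α A * (n : ℝ) ^ (1 / α) ≤ |x|}))) := by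
  have := h.isProbabilityMeasure
  have hσ := stableScale_pos h1 h2 hA
  have hρ := h.map_mul zero_le_one hσ
  rw [mul_one] at hρ
  obtain ⟨C, hC, hS⟩ := hρ.exists_abs_integral_comp_sum_sub_le h1 h2 hA hβ
  set σ := stableScale α A with hσd
  -- Dividing by s = σ n^(1/α) gives n^(1-1/α) / s = n^(1-2/α) / σ and n s^(1-α) / s = σ^(-α); the
  -- sum of the two coefficients serves for both terms.
  refine ⟨C * (1 / σ + σ ^ (-α)), fun Ω _ P _ X ε hX hXi hXd hε n hn =>
    iSup₂_le fun g hg => ENNReal.ofReal_le_ofReal ?_⟩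
  have hn0 : (0 : ℝ) < n := by exact_mod_cast hn
  set s := σ * (n : ℝ) ^ (1 / α) with hs
  have hs0 : 0 < s := by positivity
  set e := sSup ((fun x : ℝ => |ε x|) '' {x : ℝ | s ≤ |x|})
  -- Boundedness of ε makes the real `sSup` a genuine upper bound.
  have he : ∀ x, s ≤ |x| → |ε x| ≤ e := fun x hx => by
    obtain ⟨b, hb⟩ := hε.bounded_eps
    exact le_csSup ⟨b, by rintro _ ⟨y, -, rfl⟩; exact hb y⟩ ⟨x, hx, rfl⟩
  have he0 : 0 ≤ e := (abs_nonneg _).trans (he s (le_abs_self s))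
  have hgL : LipBound 1 g := fun x y => by simpa [Real.dist_eq] using hg.dist_le_mul x y
  have hgc := hgL.continuous
  -- Dilating the test function by s keeps the Lipschitz constant 1 and lets it act on the
  -- unnormalised sum; the resulting estimate is divided by s.
  have hH : LipBound 1 (fun x => s * g (x / s)) := fun x y => by
    have := hgL (x / s) (y / s)
    rw [← mul_sub, abs_mul, abs_of_pos hs0]
    refine (mul_le_mul_of_nonneg_left this hs0.le).trans (le_of_eq ?_)
    rw [← sub_div, abs_div, abs_of_pos hs0]
    field_simp
  have key := hS Ω _ P ‹_› X ε hX hXi hXd hε s e hs0 he _ hH n hn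
  set J := ∫ x in (-s)..s, |ε x| / |x| ^ (α - 1) with hJ
  have hJ0 : 0 ≤ J := intervalIntegral.integral_nonneg (by linarith) fun x _ => by positivity
  have hmeas : Measurable (normalizedSum P α A X n) :=
    ((Finset.measurable_sum _ fun i _ => hX i).sub_const _).const_mul _
  rw [integral_map hmeas.aemeasurable hgc.aestronglyMeasurable]
  rw [integral_map (by fun_prop) (by fun_prop), integral_const_mul, integral_const_mul,
    ← mul_sub, abs_mul, abs_of_pos hs0] at key
  have e1 : ∀ w, (∑ i ∈ Finset.range n, X i w - n * ∫ w, X 0 w ∂P) / s =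
      normalizedSum P α A X n w := fun w => by
    rw [normalizedSum, ← hσd, hs, Real.rpow_neg hn0.le]
    field_simp
  have e2 : ∀ y : ℝ, (n : ℝ) ^ (1 / α) * (σ * y) / s = y := fun y => by
    rw [hs]; field_simp
  simp_rw [e1, e2] at key
  have p1 : (n : ℝ) ^ (1 - 1 / α) = s * ((n : ℝ) ^ (1 - 2 / α) / σ) := by
    have : (n : ℝ) ^ (1 - 1 / α) = (n : ℝ) ^ (1 / α) * (n : ℝ) ^ (1 - 2 / α) := by
      rw [← Real.rpow_add hn0]; congr 1; ring
    rw [this, hs]; field_simp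
  have p2 : n * s ^ (1 - α) = s * σ ^ (-α) := by
    rw [show (1 - α) = 1 + -α by ring, Real.rpow_add hs0, Real.rpow_one, hs,
      Real.mul_rpow hσ.le (by positivity), ← Real.rpow_mul hn0.le,
      show 1 / α * -α = -1 by field_simp, Real.rpow_neg_one]
    field_simp
  have p3 : C * ((n : ℝ) ^ (1 - 1 / α) * (1 + J) + n * (e * s ^ (1 - α))) =
      s * (C * ((n : ℝ) ^ (1 - 2 / α) * (1 + J) * (1 / σ) + σ ^ (-α) * e)) := by
    rw [p1]
    linear_combination C * e * p2
  rw [p3] at key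
  refine (le_of_mul_le_mul_left key hs0).trans ?_
  rw [mul_assoc C (1 / σ + σ ^ (-α))]
  refine mul_le_mul_of_nonneg_left ?_ hC
  have q1 : 0 ≤ (n : ℝ) ^ (1 - 2 / α) * (1 + J) * σ ^ (-α) := by positivity
  have q2 : 0 ≤ 1 / σ * e := by positivity
  linarith

theorem theorem3 (α β A : ℝ) (hα : α ∈ Set.Ioo (1 : ℝ) 2) (hβ : β ∈ Set.Icc (-1 : ℝ) 1)
    (hA : 0 < A) :
    ∃ c : ℝ, ∀ (Ω : Type*) (_ : MeasurableSpace Ω) (P : Measure Ω) (_ : IsProbabilityMeasure P)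
      (X : ℕ → Ω → ℝ) (ε : ℝ → ℝ) (K γ : ℝ) (ν : Measure ℝ),
      (∀ i, Measurable (X i)) →
      iIndepFun X P →
      (∀ i, IdentDistrib (X i) (X 0) P P) →
      HasNormalAttractionForm α A β ε (P.map (X 0)) →
      0 < K → 0 ≤ γ → (∀ x : ℝ, x ≠ 0 → |ε x| ≤ K / |x| ^ γ) →
      UltimatelyMonotone α ε →
      IsStableLaw α 1 β ν →
      Integrable (X 0) P ∧ Integrable (fun x : ℝ => x) ν ∧
      ∀ n : ℕ, 1 ≤ n →
        wassersteinDist (P.map (normalizedSum P α A X n)) ν ≤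
          ENNReal.ofReal (c *
            ((n : ℝ) ^ (1 - 2 / α) *
                (1 + ∫ x in (-(stableScale α A * (n : ℝ) ^ (1 / α)))..
                      (stableScale α A * (n : ℝ) ^ (1 / α)), |ε x| / |x| ^ (α - 1)) +
              sSup ((fun x : ℝ => |ε x|) ''
                {x : ℝ | stableScale α A * (n : ℝ) ^ (1 / α) ≤ |x|}))) := by
  obtain ⟨h1, h2⟩ := hα
  -- The constant has to be chosen before ν. A stable law is determined by its parameters, so the
  -- constant of one serves for all; if there were none the claim would be vacuous, hence existence
  -- need not be proved.
  by_cases hex : ∃ ν₀, IsStableLaw α 1 β ν₀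
  · obtain ⟨ν₀, h₀⟩ := hex
    obtain ⟨c, hc⟩ := h₀.exists_wassersteinDist_le h1 h2 hA hβ
    refine ⟨c, fun Ω _ P _ X ε K γ ν hX hXi hXd hε _ _ _ _ hν => ⟨?_, hν.integrable h1 one_pos,
      ?_⟩⟩
    · have := Measure.isProbabilityMeasure_map (μ := P) (hX 0).aemeasurable
      exact (integrable_map_measure (g := fun x : ℝ => x) (by fun_prop) (hX 0).aemeasurable).1
        (hε.integrable h1 hβ)
    · rw [hν.eq h₀]
      exact hc Ω _ P ‹_› X ε hX hXi hXd hε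
  · exact ⟨0, fun Ω _ P _ X ε K γ ν _ _ _ _ _ _ _ _ hν => absurd ⟨ν, hν⟩ hex⟩
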